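/- Let $(M,g)$ be a smooth four-dimensional Lorentzian manifold of signature $(-,+,+,+)$ containing an open exterior region that is parametrised smoothly and injectively by Hartle–Thorne coordinates $(t,r,\theta,\phi)$, $t\in\mathbb R$, $r>r_H\ge 0$, $(\theta,\phi)\in S^2$ (regular on the axis), in which $$ds^2=-N^2dt^2+A^2dr^2+r^2B^2\bigl\{d\theta^2+\sin^2\theta\,[d\phi-\omega\,dt]^2\bigr\},$$ where $N,A,B>0$ and $\omega$ are smooth functions of $(r,\theta)$ only, regular on the axis. Assume asymptotic flatness: $N-1$, $A-1$, $B-1$ and $\omega$ are $O(r^{-1})$ as $r\to\infty$. Here and below, $f=O(r^{-k})$ for an asymptotic expansion means $\partial_r^i\partial_\theta^jf=O(r^{-k-i})$ for $i+j\le 2$, uniformly in $\theta$. (The asymptotically mass centered expansions $N=1-\frac Mr+O(r^{-2})$, $A=1+\frac Mr+O(r^{-2})$, $B=1+O(r^{-2})$, $\omega=\frac{2J}{r^3}+O(r^{-4})$ are a special case.) Let $t^\mu,\phi^\mu$ be smooth vector fields on $M$ equal to the Killing fields $\partial_t,\partial_\phi$ in the exterior, and let the event horizon $\mathcal H$, contained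 in the boundary of the exterior and located at $r\to r_H$, be a null surface generated by $X^\mu=t^\mu+\Omega_{\mathcal H}\phi^\mu$ for a constant $\Omega_{\mathcal H}$ (points of a bifurcation surface, where $X=0$, are allowed). Let $\Phi$ be a smooth and $\mathcal F$ a continuous real function on $M$ that in the exterior depend on $(r,\theta)$ only, with $$\Box\Phi+\epsilon\,\mathcal F=0\quad\text{in the exterior},\qquad |\mathcal F|\le C\,r^{-5}\ \text{for large } r,$$ $\epsilon\in\mathbb R$ a constant, and $$\Phi=\frac{\mu_1(\theta)}{r}+\frac{\mu_2(\theta)}{r^2}+O(r^{-3})\qquad(r\to\infty),$$ where $\mu_1,\mu_2$ are regular ($C^2$ on $[0,\pi]$). Let $\Sigma$ be a partial Cauchy surface: a smoothly embedded, achronal, spacelike hypersurface with boundary, diffeomorphic to $[1,\infty)\times S^2$, whose boundary is a cross section of $\mathcal H$ and whose interior lies in the exterior and runs to $r\to\infty$. Let $d\Sigma_\mu=-n_\mu\,dV_h$, where $n$ is the future unit normal of $\Sigma$ and $dV_h$ is the volume element of the induced metric (so that $X^\mu d\Sigma_\mu=\sqrt{-g}\,dr\,d\theta\,d\phi$ on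 $\{t=\mathrm{const}\}$, with $\sqrt{-g}=r^2AB^2N\sin\theta$). Then $\mathcal F X^\mu d\Sigma_\mu$ is integrable on $\Sigma$, and the monopole hair is independent of $\theta$ and given by $$\mu_1(\theta)=\mu_1=\frac{\epsilon}{4\pi}\int_\Sigma \mathcal F(r,\theta)\,X^\mu\,d\Sigma_\mu\qquad\text{for all }\theta\in[0,\pi].$$ -/

import Mathlib

open Set Filter Topology MeasureTheory Bundle
open scoped Manifold ContDiff Matrix

noncomputable section

/-- Euclidean three-space. -/
abbrev E3 : Type := EuclideanSpace ℝ (Fin 3)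

/-- The model space of four-dimensional spacetimes. -/
abbrev E4 : Type := EuclideanSpace ℝ (Fin 4)

/-! ### Hartle–Thorne coordinates

A point of a Hartle–Thorne coordinate patch is `x : Fin 4 → ℝ`, with
`x 0 = t`, `x 1 = r`, `x 2 = θ`, `x 3 = φ`. -/

/-- The line element
`-N² dt² + A² dr² + r² B² (dθ² + sin² θ (dφ - w dt)²)` as a matrix in the coordinates
`(t, r, θ, φ)`, where `w` is the dragging frequency `ω`; the metric functions depend on `(r, θ)`
only, so that `∂_t` and `∂_φ` are Killing fields. -/
def hartleThorne (N A B w : ℝ → ℝ → ℝ) (x : Fin 4 → ℝ) : Matrix (Fin 4) (Fin 4) ℝ :=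
  let r := x 1
  let θ := x 2
  let gφφ := r ^ 2 * B r θ ^ 2 * Real.sin θ ^ 2
  !![-(N r θ) ^ 2 + gφφ * w r θ ^ 2, 0, 0, -(gφφ * w r θ);
     0, A r θ ^ 2, 0, 0;
     0, 0, r ^ 2 * B r θ ^ 2, 0;
     -(gφφ * w r θ), 0, 0, gφφ]

/-- The coordinate partial derivative `∂_μ f`. -/
def pderiv4 (μ : Fin 4) (f : (Fin 4 → ℝ) → ℝ) (x : Fin 4 → ℝ) : ℝ :=
  fderiv ℝ f x (Pi.single μ 1)

/-- The wave operator `□ f = (√|det G|)⁻¹ ∂_μ (√|det G| G^{μν} ∂_ν f)` of the metric whose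
coordinate components are `G`. -/
def dAlembertian (G : (Fin 4 → ℝ) → Matrix (Fin 4) (Fin 4) ℝ) (f : (Fin 4 → ℝ) → ℝ)
    (x : Fin 4 → ℝ) : ℝ :=
  (√|(G x).det|)⁻¹ *
    ∑ μ, pderiv4 μ (fun y => √|(G y).det| * ∑ ν, (G y)⁻¹ μ ν * pderiv4 ν f y) x

/-- The exterior in Cartesian form: pairs `(t, y)` with `‖y‖ > r_H`. It contains the axis. -/
def exterior (rH : ℝ) : Set (ℝ × E3) := {q | rH < ‖q.2‖}

/-- The exterior without its axis, in the coordinates `(t, r, θ, φ)`. -/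
def polarExterior (rH : ℝ) : Set (Fin 4 → ℝ) := {x | rH < x 1 ∧ x 2 ∈ Ioo 0 Real.pi}

/-- Polar coordinates `(t, r, θ, φ) ↦ (t, r (sin θ cos φ, sin θ sin φ, cos θ))`. -/
def polar (x : Fin 4 → ℝ) : ℝ × E3 :=
  (x 0, !₂[x 1 * Real.sin (x 2) * Real.cos (x 3), x 1 * Real.sin (x 2) * Real.sin (x 3),
    x 1 * Real.cos (x 2)])

/-- The polar angle `θ ∈ [0, π]` of a point of three-space. -/
def polarAngle (y : E3) : ℝ := Real.arccos (y 2 / ‖y‖)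

/-- `f(r, θ)` is smooth for `r > r_H`, including on the axis `θ = 0, π`. -/
def SmoothExterior (rH : ℝ) (f : ℝ → ℝ → ℝ) : Prop :=
  ContDiffOn ℝ ∞ (fun y : E3 => f ‖y‖ (polarAngle y)) {y | rH < ‖y‖}

/-- The mixed partial derivative `∂_r^i ∂_θ^j f`. -/
def pderivPolar (i j : ℕ) (f : ℝ → ℝ → ℝ) (r θ : ℝ) : ℝ :=
  iteratedDeriv i (fun r' => iteratedDeriv j (fun θ' => f r' θ') θ) r

/-- `f = O(r^{-k})` as `r → ∞`, uniformly in the angle, in the sense of asymptotic expansions in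
`1/r` that may be differentiated twice:
`∂_r^i ∂_θ^j f = O(r^{-k-i})` for `i + j ≤ 2`. -/
def IsBigOInv (k : ℕ) (f : ℝ → ℝ → ℝ) : Prop :=
  ∀ i j : ℕ, i + j ≤ 2 → ∃ C R : ℝ, ∀ r > R, ∀ θ ∈ Ioo 0 Real.pi,
    |pderivPolar i j f r θ| ≤ C / r ^ (k + i)

/-! ### Spacetimes -/

section Spacetime

variable (M : Type*) [TopologicalSpace M] [ChartedSpace E4 M] [IsManifold (𝓡 4) ∞ M]

/-- A smooth metric of signature `(-,+,+,+)` on `M`. -/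
structure LorentzMetric where
  inner (p : M) : TangentSpace (𝓡 4) p →L[ℝ] TangentSpace (𝓡 4) p →L[ℝ] ℝ
  symm (p : M) (v w : TangentSpace (𝓡 4) p) : inner p v w = inner p w v
  signature (p : M) : ∃ e : Fin 4 → TangentSpace (𝓡 4) p, ∀ i j,
    inner p (e i) (e j) = if i = j then (if i = 0 then -1 else 1) else 0
  contMDiff : ContMDiff (𝓡 4) ((𝓡 4).prod 𝓘(ℝ, E4 →L[ℝ] E4 →L[ℝ] ℝ)) ∞
    (fun p ↦ TotalSpace.mk' (E4 →L[ℝ] E4 →L[ℝ] ℝ) p (inner p))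

variable {M}

/-- `H` is a null hypersurface generated by the vector field `X`: on `H` the field `X` is null,
and near each point of `H` where `X ≠ 0` the set `H` is the zero set of a smooth function whose
gradient at that point is `X` (so `X` is at once normal and tangent to `H`). Points where
`X = 0` are points of a bifurcation surface. -/
def IsNullGenerated (g : LorentzMetric M) (X : (p : M) → TangentSpace (𝓡 4) p) (H : Set M) :
    Prop :=
  ∀ p ∈ H, X p = 0 ∨ (g.inner p (X p) (X p) = 0 ∧
    ∃ f : M → ℝ, ContMDiffAt (𝓡 4) 𝓘(ℝ, ℝ) ∞ f p ∧ (∀ᶠ q in 𝓝 p, q ∈ H ↔ f q = 0) ∧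
      ∀ v : TangentSpace (𝓡 4) p, mfderiv (𝓡 4) 𝓘(ℝ, ℝ) f p v = g.inner p (X p) v)

variable (M)

/-- A stationary, axisymmetric, circular, asymptotically flat black hole: a smooth Lorentzian
manifold `M`, an exterior region of `M` covered by Hartle–Thorne coordinates, and an event horizon
in the boundary of the exterior region. -/
structure CircularBlackHole where
  /-- the spacetime metric, regular across the horizon -/
  g : LorentzMetric M
  /-- the horizon radius -/
  rH : ℝ
  /-- the metric functions of the Hartle–Thorne line element -/
  N : ℝ → ℝ → ℝ
  A : ℝ → ℝ → ℝ
  B : ℝ → ℝ → ℝ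
  w : ℝ → ℝ → ℝ
  /-- the identification of the coordinate exterior with a region of `M` -/
  Ψ : ℝ × E3 → M
  /-- the stationary and the axial Killing field -/
  killT : (p : M) → TangentSpace (𝓡 4) p
  killφ : (p : M) → TangentSpace (𝓡 4) p
  /-- the angular velocity of the horizon -/
  Ω : ℝ
  /-- the event horizon -/
  H : Set M
  rH_nonneg : 0 ≤ rH
  N_smooth : SmoothExterior rH N
  A_smooth : SmoothExterior rH A
  B_smooth : SmoothExterior rH B
  w_smooth : SmoothExterior rH w
  N_pos : ∀ r > rH, ∀ θ ∈ Icc 0 Real.pi, 0 < N r θ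
  A_pos : ∀ r > rH, ∀ θ ∈ Icc 0 Real.pi, 0 < A r θ
  B_pos : ∀ r > rH, ∀ θ ∈ Icc 0 Real.pi, 0 < B r θ
  /-- asymptotic flatness; asymptotically mass centered expansions such as `N = 1 - M/r + O(r⁻²)`,
  `A = 1 + M/r + O(r⁻²)`, `B = 1 + O(r⁻²)`, `ω = 2J/r³ + O(r⁻⁴)` are a special case -/
  N_asymp : IsBigOInv 1 (fun r θ => N r θ - 1)
  A_asymp : IsBigOInv 1 (fun r θ => A r θ - 1)
  B_asymp : IsBigOInv 1 (fun r θ => B r θ - 1)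
  w_asymp : IsBigOInv 1 w
  Ψ_smooth : ContMDiffOn 𝓘(ℝ, ℝ × E3) (𝓡 4) ∞ Ψ (exterior rH)
  Ψ_inj : InjOn Ψ (exterior rH)
  /-- in the coordinates `(t, r, θ, φ)` the metric is the Hartle–Thorne line element -/
  Ψ_metric : ∀ x ∈ polarExterior rH, ∀ u v : Fin 4 → ℝ,
    g.inner (Ψ (polar x))
      (mfderiv 𝓘(ℝ, Fin 4 → ℝ) (𝓡 4) (fun z => Ψ (polar z)) x u)
      (mfderiv 𝓘(ℝ, Fin 4 → ℝ) (𝓡 4) (fun z => Ψ (polar z)) x v) =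
      u ⬝ᵥ (hartleThorne N A B w x *ᵥ v)
  killT_smooth : ContMDiff (𝓡 4) (𝓡 4).tangent ∞ (fun p => (⟨p, killT p⟩ : TangentBundle (𝓡 4) M))
  killφ_smooth : ContMDiff (𝓡 4) (𝓡 4).tangent ∞ (fun p => (⟨p, killφ p⟩ : TangentBundle (𝓡 4) M))
  /-- in the exterior, the Killing fields are `∂_t` and `∂_φ` -/
  killT_eq : ∀ x ∈ polarExterior rH,
    mfderiv 𝓘(ℝ, Fin 4 → ℝ) (𝓡 4) (fun z => Ψ (polar z)) x (Pi.single 0 1 : Fin 4 → ℝ)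
      = killT (Ψ (polar x))
  killφ_eq : ∀ x ∈ polarExterior rH,
    mfderiv 𝓘(ℝ, Fin 4 → ℝ) (𝓡 4) (fun z => Ψ (polar z)) x (Pi.single 3 1 : Fin 4 → ℝ)
      = killφ (Ψ (polar x))
  /-- the horizon lies in the boundary of the exterior region, at `r = r_H` -/
  H_frontier : H ⊆ frontier (Ψ '' exterior rH)
  H_radius : ∀ p ∈ H, ∀ r > rH, ∀ᶠ z in 𝓝 p, ∀ q ∈ exterior rH, Ψ q = z → ‖q.2‖ < r
  /-- the horizon is a null surface generated by `t + Ω φ` -/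
  H_null : IsNullGenerated g (fun p => killT p + Ω • killφ p) H

variable {M}

namespace CircularBlackHole

/-- The horizon generator `X = t + Ω φ`. -/
def X (S : CircularBlackHole M) (p : M) : TangentSpace (𝓡 4) p := S.killT p + S.Ω • S.killφ p

end CircularBlackHole

/-- `S` is achronal: no timelike curve meets it at two parameter values. -/
def IsAchronal (g : LorentzMetric M) (S : Set M) : Prop :=
  ∀ (γ : ℝ → M) (a b : ℝ), a < b →
    (∀ s ∈ Icc a b, ContMDiffAt 𝓘(ℝ, ℝ) (𝓡 4) ∞ γ s ∧
      g.inner (γ s) (mfderiv 𝓘(ℝ, ℝ) (𝓡 4) γ s (1 : ℝ))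
        (mfderiv 𝓘(ℝ, ℝ) (𝓡 4) γ s (1 : ℝ)) < 0) →
    ¬ (γ a ∈ S ∧ γ b ∈ S)

/-- The closed exterior `‖x‖ ≥ 1` of the unit ball, on which hypersurfaces that run from a
horizon cross section to infinity are parametrised. -/
def outerRegion : Set E3 := {x | 1 ≤ ‖x‖}

/-- A partial Cauchy surface of a circular black hole: a smoothly embedded, achronal, spacelike
hypersurface with boundary. Its boundary is a cross section of the event horizon, its interior
lies in the exterior region and runs off to spatial infinity. -/
structure PartialCauchySurface (S : CircularBlackHole M) where
  /-- the embedding -/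
  σ : E3 → M
  /-- the unit normal -/
  n : (x : E3) → TangentSpace (𝓡 4) (σ x)
  smooth : ∀ x ∈ outerRegion, ContMDiffAt (𝓡 3) (𝓡 4) ∞ σ x
  inj : InjOn σ outerRegion
  spacelike : ∀ x ∈ outerRegion, ∀ v : TangentSpace (𝓡 3) x, v ≠ 0 →
    0 < S.g.inner (σ x) (mfderiv (𝓡 3) (𝓡 4) σ x v) (mfderiv (𝓡 3) (𝓡 4) σ x v)
  achronal : IsAchronal S.g (σ '' outerRegion)
  boundary : ∀ x, ‖x‖ = 1 → σ x ∈ S.H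
  interior : ∀ x, 1 < ‖x‖ → σ x ∈ S.Ψ '' exterior S.rH
  infinity : ∀ R : ℝ, ∃ L : ℝ, ∀ x, L < ‖x‖ → ∀ q ∈ exterior S.rH, S.Ψ q = σ x → R < ‖q.2‖
  n_continuous : ContinuousOn (fun x => (⟨σ x, n x⟩ : TangentBundle (𝓡 4) M)) outerRegion
  n_unit : ∀ x ∈ outerRegion, S.g.inner (σ x) (n x) (n x) = -1
  n_normal : ∀ x ∈ outerRegion, ∀ v : TangentSpace (𝓡 3) x,
    S.g.inner (σ x) (n x) (mfderiv (𝓡 3) (𝓡 4) σ x v) = 0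
  /-- the normal is future directed: `dt(n) > 0` in the exterior -/
  n_future : ∀ x, 1 < ‖x‖ → ∃ q ∈ exterior S.rH, ∃ w : ℝ × E3, S.Ψ q = σ x ∧ 0 < w.1 ∧
    (mfderiv 𝓘(ℝ, ℝ × E3) (𝓡 4) S.Ψ q w : E4) = n x

namespace PartialCauchySurface

variable {S : CircularBlackHole M}

/-- The induced metric `h_{ij}` on the hypersurface. -/
def induced (Sig : PartialCauchySurface S) (x : E3) : Matrix (Fin 3) (Fin 3) ℝ :=
  Matrix.of fun i j => S.g.inner (Sig.σ x)
    (mfderiv (𝓡 3) (𝓡 4) Sig.σ x (EuclideanSpace.single i (1 : ℝ) : E3))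
    (mfderiv (𝓡 3) (𝓡 4) Sig.σ x (EuclideanSpace.single j (1 : ℝ) : E3))

/-- The density of `V^μ dΣ_μ` in the parameters `x`, with the surface element
`dΣ_μ = -n_μ √(det h) d³x` of a spacelike hypersurface with future unit normal `n`. -/
def surfaceDensity (Sig : PartialCauchySurface S) (V : (p : M) → TangentSpace (𝓡 4) p)
    (x : E3) : ℝ :=
  -S.g.inner (Sig.σ x) (Sig.n x) (V (Sig.σ x)) * √(Sig.induced x).det

end PartialCauchySurface

end Spacetime

end

/-! The field equation is a conservation law along `X`. Since `X` is Killing and annihilates `Φ`,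
the divergence of the antisymmetric tensor X^μ ∇^ν Φ − X^ν ∇^μ Φ is X^μ □Φ, that is, −ε F X^μ.
Contraction with the unit normal of the surface gives a tangential vector density (`current`) whose
divergence is −ε times the source density. Gauss's theorem then equates the integral of the source
with the fluxes at the two ends of the surface.

At infinity the flux tends to the integral of r² ∂_r Φ over the sphere, which is −4π μ₁. At the
horizon it vanishes (`current_boundary`): `X` is null and normal to the cross section, so its part
tangential to the surface is a multiple of the normal of the cross section within the surface, and
then g(X, X) = 0 and XΦ = 0 together cancel the normal component of the current. At bifurcation
points the current vanishes with `X`.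

The angle independence is separate (`monopole_const`): at leading order at infinity the field
equation reads (sin θ μ₁')' = 0, so sin θ μ₁' is constant, and regularity on the axis makes this
constant zero.

The surface is not assumed to be a graph over the exterior; this is proved. The observers of zero
angular momentum, with velocity ∂_t + ω ∂_φ of norm −N², are timelike throughout the exterior, which
need not hold for ∂_t. In corotating coordinates their worldlines are the lines of constant y.
Projection along them is injective by achronality, a local diffeomorphism by spacelikeness, and
proper by the behaviour of the surface at its two ends, hence onto (`image_proj`). The surface is
therefore t = T(r, θ, φ) with a corotating azimuth φ, and all densities become explicit: that of `X`
is √−g (1 − (Ω − ω) ∂_φ T) (`surfaceDensity_K`). Spacelikeness also gives N |∂_φ T| ≤ r B, so the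
source is O(r⁻²) in these coordinates and integrable.

Nothing is known about T at the horizon, so Gauss's theorem in spherical coordinates is applied only
to the current times a cutoff supported away from the boundary (`setIntegral_cutoffDivergence`). The
cutoff is removed in the parameters x of the surface, where the current is continuous up to ‖x‖ = 1
and tangential to the unit sphere there (`tendsto_integral_fderiv_cutoff`). -/

noncomputable section

/-! ### Continuity of vector fields, differentials and scalar products along maps into spacetime. -/

section Continuity

variable {M : Type*} [TopologicalSpace M] [ChartedSpace E4 M] [IsManifold (𝓡 4) ∞ M]

/-- The scalar product of two continuous vector fields along a map is continuous. -/
lemma LorentzMetric.continuousOn_inner (g : LorentzMetric M) {Y : Type*} [TopologicalSpace Y]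
    {b : Y → M} {v w : (y : Y) → TangentSpace (𝓡 4) (b y)} {s : Set Y}
    (hv : ContinuousOn (fun y => (⟨b y, v y⟩ : TangentBundle (𝓡 4) M)) s)
    (hw : ContinuousOn (fun y => (⟨b y, w y⟩ : TangentBundle (𝓡 4) M)) s) :
    ContinuousOn (fun y => g.inner (b y) (v y) (w y)) s := by
  have hb : ContinuousOn b s :=
    (FiberBundle.continuous_proj E4 (TangentSpace (𝓡 4) (M := M))).comp_continuousOn hv
  have hg : ContinuousOn (fun y ↦ TotalSpace.mk' (E4 →L[ℝ] E4 →L[ℝ] ℝ)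
      (E := fun x : M ↦ (TangentSpace (𝓡 4) x →L[ℝ] TangentSpace (𝓡 4) x →L[ℝ] ℝ))
      (b y) (g.inner (b y))) s :=
    g.contMDiff.continuous.comp_continuousOn hb
  have h1 : ContinuousOn (fun y ↦ TotalSpace.mk' (E4 →L[ℝ] ℝ)
      (E := fun x : M ↦ (TangentSpace (𝓡 4) x →L[ℝ] ℝ)) (b y) (g.inner (b y) (v y))) s :=
    ContinuousOn.clm_bundle_apply (F₁ := E4) (F₂ := E4 →L[ℝ] ℝ)
      (E₂ := fun x : M ↦ (TangentSpace (𝓡 4) x →L[ℝ] Trivial M ℝ x)) hg hv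
  have h2 : ContinuousOn (fun y ↦ TotalSpace.mk' ℝ (E := Bundle.Trivial M ℝ) (b y)
      (g.inner (b y) (v y) (w y))) s :=
    ContinuousOn.clm_bundle_apply (F₁ := E4) (F₂ := ℝ) (E₂ := Trivial M ℝ) h1 hw
  intro x hx
  exact ((FiberBundle.continuousWithinAt_totalSpace ℝ _).1 (h2 x hx)).2

/-- Images of a fixed vector under the differentials of a smooth map form a continuous field. -/
lemma continuousOn_mfderiv_apply {E : Type*} [NormedAddCommGroup E] [NormedSpace ℝ E]
    {f : E → M} {s : Set E} (hf : ∀ x ∈ s, ContMDiffAt 𝓘(ℝ, E) (𝓡 4) ∞ f x) (v : E) :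
    ContinuousOn (fun x => (⟨f x, mfderiv 𝓘(ℝ, E) (𝓡 4) f x v⟩ : TangentBundle (𝓡 4) M)) s := by
  intro x hx
  refine ContinuousAt.continuousWithinAt ?_
  have : IsManifold (𝓡 4) 1 M := IsManifold.of_le (n := ∞) (by simp)
  have h1 := (hf x hx).mfderiv_const (m := 0) (by simp)
  have hv : ContinuousAt (fun x : E => (⟨x, v⟩ : TangentBundle 𝓘(ℝ, E) E)) x :=
    ((tangentBundleModelSpaceHomeomorph 𝓘(ℝ, E)).symm.continuous.comp
      (Continuous.prodMk_left v : Continuous fun x : E => (x, v))).continuousAt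
  exact ContinuousAt.clm_apply_of_inCoordinates (F₁ := E) (F₂ := E4) (E₁ := TangentSpace 𝓘(ℝ, E))
    (E₂ := TangentSpace (𝓡 4) (M := M)) (b₁ := id) (b₂ := f) h1.continuousAt hv (hf x hx).continuousAt

/-- The derivative of a smooth function along a continuous vector field is continuous. -/
lemma continuousOn_mfderiv_section {Φ : M → ℝ} (hΦ : ContMDiff (𝓡 4) 𝓘(ℝ, ℝ) ∞ Φ)
    {Y : Type*} [TopologicalSpace Y]
    {b : Y → M} {v : (y : Y) → TangentSpace (𝓡 4) (b y)} {s : Set Y}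
    (hv : ContinuousOn (fun y => (⟨b y, v y⟩ : TangentBundle (𝓡 4) M)) s) :
    ContinuousOn (fun y => (mfderiv (𝓡 4) 𝓘(ℝ, ℝ) Φ (b y) (v y) : ℝ)) s := by
  have : IsManifold (𝓡 4) 1 M := IsManifold.of_le (n := ∞) (by simp)
  have h := (hΦ.continuous_tangentMap (by simp)).comp_continuousOn hv
  intro x hx
  have h3 := ((FiberBundle.continuousWithinAt_totalSpace ℝ _).1 (h x hx)).2
  simpa [tangentMap, TangentBundle.trivializationAt_apply, Function.comp_def] using h3

lemma ContMDiff.continuousOn_along {X : (p : M) → TangentSpace (𝓡 4) p}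
    (hX : ContMDiff (𝓡 4) (𝓡 4).tangent ∞ (fun p => (⟨p, X p⟩ : TangentBundle (𝓡 4) M)))
    {Y : Type*} [TopologicalSpace Y] {b : Y → M} {s : Set Y} (hb : ContinuousOn b s) :
    ContinuousOn (fun y => (⟨b y, X (b y)⟩ : TangentBundle (𝓡 4) M)) s :=
  hX.continuous.comp_continuousOn hb

lemma CircularBlackHole.X_smooth (S : CircularBlackHole M) :
    ContMDiff (𝓡 4) (𝓡 4).tangent ∞ (fun p => (⟨p, S.X p⟩ : TangentBundle (𝓡 4) M)) :=
  S.killT_smooth.add_section (S.killφ_smooth.const_smul_section)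

end Continuity

/-! ### Spherical coordinates on three-space, their inverse and their differential. -/

section Polar

/-- The point of three-space with spherical coordinates `(r, θ, φ)`. -/
def sph (r θ φ : ℝ) : E3 :=
  !₂[r * Real.sin θ * Real.cos φ, r * Real.sin θ * Real.sin φ, r * Real.cos θ]

lemma polar_eq (x : Fin 4 → ℝ) : polar x = (x 0, sph (x 1) (x 2) (x 3)) := rfl

/-- Rotation about the axis. -/
def rotZ (α : ℝ) (y : E3) : E3 :=
  !₂[Real.cos α * y 0 - Real.sin α * y 1, Real.sin α * y 0 + Real.cos α * y 1, y 2]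

/-- The generator of the rotations about the axis. -/
def rotGen (y : E3) : E3 := !₂[-y 1, y 0, 0]

lemma E3_norm_sq (y : E3) : ‖y‖ ^ 2 = y 0 ^ 2 + y 1 ^ 2 + y 2 ^ 2 := by
  rw [EuclideanSpace.norm_sq_eq, Fin.sum_univ_three]; simp

lemma E3_ext {y z : E3} (h0 : y 0 = z 0) (h1 : y 1 = z 1) (h2 : y 2 = z 2) : y = z := by
  ext i; fin_cases i <;> assumption

@[simp] lemma sph_zero (r θ φ : ℝ) : sph r θ φ 0 = r * Real.sin θ * Real.cos φ := rfl
@[simp] lemma sph_one (r θ φ : ℝ) : sph r θ φ 1 = r * Real.sin θ * Real.sin φ := rfl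
@[simp] lemma sph_two (r θ φ : ℝ) : sph r θ φ 2 = r * Real.cos θ := rfl
@[simp] lemma rotZ_zero (α : ℝ) (y : E3) :
    rotZ α y 0 = Real.cos α * y 0 - Real.sin α * y 1 := rfl
@[simp] lemma rotZ_one (α : ℝ) (y : E3) :
    rotZ α y 1 = Real.sin α * y 0 + Real.cos α * y 1 := rfl
@[simp] lemma rotZ_two (α : ℝ) (y : E3) : rotZ α y 2 = y 2 := rfl
@[simp] lemma rotGen_zero (y : E3) : rotGen y 0 = -y 1 := rfl
@[simp] lemma rotGen_one (y : E3) : rotGen y 1 = y 0 := rfl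
@[simp] lemma rotGen_two (y : E3) : rotGen y 2 = 0 := rfl

lemma norm_sph {r : ℝ} (hr : 0 ≤ r) (θ φ : ℝ) : ‖sph r θ φ‖ = r := by
  have h : ‖sph r θ φ‖ ^ 2 = r ^ 2 := by
    rw [E3_norm_sq, sph_zero, sph_one, sph_two]
    linear_combination (r ^ 2 * Real.sin θ ^ 2) * Real.sin_sq_add_cos_sq φ
      + r ^ 2 * Real.sin_sq_add_cos_sq θ
  exact (pow_left_inj₀ (norm_nonneg _) hr two_ne_zero).1 h

lemma polarAngle_sph {r : ℝ} (hr : 0 < r) {θ : ℝ} (hθ : θ ∈ Icc 0 Real.pi) (φ : ℝ) :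
    polarAngle (sph r θ φ) = θ := by
  rw [polarAngle, norm_sph hr.le, sph_two, mul_div_cancel_left₀ _ hr.ne',
    Real.arccos_cos hθ.1 hθ.2]

lemma polarAngle_mem (y : E3) : polarAngle y ∈ Icc 0 Real.pi :=
  ⟨Real.arccos_nonneg _, Real.arccos_le_pi _⟩

lemma norm_rotZ (α : ℝ) (y : E3) : ‖rotZ α y‖ = ‖y‖ := by
  have h : ‖rotZ α y‖ ^ 2 = ‖y‖ ^ 2 := by
    rw [E3_norm_sq, E3_norm_sq, rotZ_zero, rotZ_one, rotZ_two]
    linear_combination (y 0 ^ 2 + y 1 ^ 2) * Real.sin_sq_add_cos_sq α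
  exact (pow_left_inj₀ (norm_nonneg _) (norm_nonneg _) two_ne_zero).1 h

lemma polarAngle_rotZ (α : ℝ) (y : E3) : polarAngle (rotZ α y) = polarAngle y := by
  rw [polarAngle, polarAngle, norm_rotZ, rotZ_two]

lemma rotZ_sph (α r θ φ : ℝ) : rotZ α (sph r θ φ) = sph r θ (φ + α) := by
  apply E3_ext
  · simp [Real.cos_add]; ring
  · simp [Real.sin_add]; ring
  · simp

lemma rotZ_rotZ (α β : ℝ) (y : E3) : rotZ α (rotZ β y) = rotZ (α + β) y := by
  apply E3_ext
  · simp [Real.cos_add, Real.sin_add]; ring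
  · simp [Real.sin_add, Real.cos_add]; ring
  · simp

lemma rotZ_zero_angle (y : E3) : rotZ 0 y = y := by
  apply E3_ext <;> simp

/-- The azimuth of a point of three-space. -/
def azimuth (y : E3) : ℝ := Complex.arg ⟨y 0, y 1⟩

/-- Both sides are the distance from the axis. Writing it as a complex modulus lets the polar form
of a complex number supply the azimuth. -/
lemma norm_mul_sin_polarAngle {y : E3} (hy : y ≠ 0) :
    ‖y‖ * Real.sin (polarAngle y) = ‖(⟨y 0, y 1⟩ : ℂ)‖ := by
  have hp : 0 < ‖y‖ := norm_pos_iff.2 hy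
  have h0 : 0 ≤ ‖y‖ * Real.sin (polarAngle y) :=
    mul_nonneg hp.le (Real.sin_nonneg_of_mem_Icc (polarAngle_mem y))
  refine (pow_left_inj₀ h0 (norm_nonneg _) two_ne_zero).1 ?_
  have h2 := E3_norm_sq y
  have hb : (y 2 / ‖y‖) ^ 2 ≤ 1 := by
    rw [div_pow, div_le_one (by positivity), h2]
    nlinarith [sq_nonneg (y 0), sq_nonneg (y 1)]
  rw [mul_pow, polarAngle, Real.sin_arccos, Real.sq_sqrt (by linarith), ← Complex.normSq_eq_norm_sq,
    Complex.normSq_mk]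
  field_simp
  linarith

lemma sph_polarAngle_azimuth {y : E3} (hy : y ≠ 0) :
    sph ‖y‖ (polarAngle y) (azimuth y) = y := by
  have hp : 0 < ‖y‖ := norm_pos_iff.2 hy
  have h2 := E3_norm_sq y
  have hb : |y 2 / ‖y‖| ≤ 1 := by
    rw [← sq_le_one_iff_abs_le_one, div_pow, div_le_one (by positivity), h2]
    nlinarith [sq_nonneg (y 0), sq_nonneg (y 1)]
  apply E3_ext
  · rw [sph_zero, norm_mul_sin_polarAngle hy, azimuth, Complex.norm_mul_cos_arg]
  · rw [sph_one, norm_mul_sin_polarAngle hy, azimuth, Complex.norm_mul_sin_arg]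
  · rw [sph_two, polarAngle, Real.cos_arccos (abs_le.1 hb).1 (abs_le.1 hb).2]
    field_simp

lemma polarAngle_mem_Ioo {y : E3} (hy : y 0 ≠ 0 ∨ y 1 ≠ 0) : polarAngle y ∈ Ioo 0 Real.pi := by
  have hy0 : y ≠ 0 := by rintro rfl; simp at hy
  have h := norm_mul_sin_polarAngle hy0
  have hc : 0 < ‖(⟨y 0, y 1⟩ : ℂ)‖ := by
    rw [norm_pos_iff]; intro h
    have h1 := congrArg Complex.re h
    have h2 := congrArg Complex.im h
    simp at h1 h2
    tauto
  have hs : Real.sin (polarAngle y) ≠ 0 := by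
    intro h0; rw [h0, mul_zero] at h; exact hc.ne h
  obtain ⟨h1, h2⟩ := polarAngle_mem y
  refine ⟨lt_of_le_of_ne h1 ?_, lt_of_le_of_ne h2 ?_⟩
  · intro h; exact hs (by rw [← h, Real.sin_zero])
  · intro h; exact hs (by rw [h, Real.sin_pi])

lemma azimuth_mem (y : E3) : azimuth y ∈ Ioc (-Real.pi) Real.pi := Complex.arg_mem_Ioc _

lemma contDiff_sph : ContDiff ℝ ∞ (fun z : ℝ × ℝ × ℝ => sph z.1 z.2.1 z.2.2) := by
  rw [contDiff_euclidean]
  intro i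
  fin_cases i
  · simp only [Fin.zero_eta, sph_zero]; fun_prop
  · simp only [Fin.mk_one, sph_one]; fun_prop
  · simp only [Fin.reduceFinMk, sph_two]; fun_prop

lemma contDiff_polar : ContDiff ℝ ∞ polar := by
  have h : ContDiff ℝ ∞ (fun x : Fin 4 → ℝ => (x 1, x 2, x 3)) := by fun_prop
  exact (contDiff_apply ℝ ℝ 0).prodMk (contDiff_sph.comp h)

/-- The differential of polar coordinates. -/
def polarD (x ν : Fin 4 → ℝ) : ℝ × E3 :=
  (ν 0, !₂[ν 1 * Real.sin (x 2) * Real.cos (x 3) + x 1 * ν 2 * Real.cos (x 2) * Real.cos (x 3)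
      - x 1 * ν 3 * Real.sin (x 2) * Real.sin (x 3),
    ν 1 * Real.sin (x 2) * Real.sin (x 3) + x 1 * ν 2 * Real.cos (x 2) * Real.sin (x 3)
      + x 1 * ν 3 * Real.sin (x 2) * Real.cos (x 3),
    ν 1 * Real.cos (x 2) - x 1 * ν 2 * Real.sin (x 2)])

lemma fderiv_polar (x ν : Fin 4 → ℝ) : fderiv ℝ polar x ν = polarD x ν := by
  have hd : HasFDerivAt polar (fderiv ℝ polar x) x :=
    (contDiff_polar.differentiable (by simp) x).hasFDerivAt
  have hp (i : Fin 4) : HasFDerivAt (fun x : Fin 4 → ℝ => x i)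
      (ContinuousLinearMap.proj (R := ℝ) (φ := fun _ : Fin 4 => ℝ) i) x :=
    (ContinuousLinearMap.proj (R := ℝ) (φ := fun _ : Fin 4 => ℝ) i).hasFDerivAt
  have hc (i : Fin 3) : HasFDerivAt (fun x => (polar x).2 i) _ x :=
    ((EuclideanSpace.proj (𝕜 := ℝ) i).hasFDerivAt.comp x
      ((ContinuousLinearMap.snd ℝ ℝ E3).hasFDerivAt.comp x hd))
  apply Prod.ext
  · have h0 : HasFDerivAt (fun x => (polar x).1) _ x :=
      (ContinuousLinearMap.fst ℝ ℝ E3).hasFDerivAt.comp x hd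
    have := DFunLike.congr_fun (h0.unique (hp 0)) ν
    simpa [polarD] using this
  · apply E3_ext
    · have h := DFunLike.congr_fun ((hc 0).unique (((hp 1).mul (hp 2).sin).mul (hp 3).cos)) ν
      simp at h
      rw [h]; simp [polarD]; ring
    · have h := DFunLike.congr_fun ((hc 1).unique (((hp 1).mul (hp 2).sin).mul (hp 3).sin)) ν
      simp at h
      rw [h]; simp [polarD]; ring
    · have h := DFunLike.congr_fun ((hc 2).unique ((hp 1).mul (hp 2).cos)) ν
      simp at h
      rw [h]; simp [polarD]; ring

/-- Off the axis the differential of polar coordinates is onto. -/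
lemma polarD_surjective {x : Fin 4 → ℝ} (hr : x 1 ≠ 0) (hs : Real.sin (x 2) ≠ 0) (w : ℝ × E3) :
    ∃ ν, polarD x ν = w := by
  refine ⟨![w.1, w.2 0 * Real.sin (x 2) * Real.cos (x 3) + w.2 1 * Real.sin (x 2) * Real.sin (x 3)
      + w.2 2 * Real.cos (x 2),
    (w.2 0 * Real.cos (x 2) * Real.cos (x 3) + w.2 1 * Real.cos (x 2) * Real.sin (x 3)
      - w.2 2 * Real.sin (x 2)) / x 1,
    (-w.2 0 * Real.sin (x 3) + w.2 1 * Real.cos (x 3)) / (x 1 * Real.sin (x 2))], ?_⟩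
  have h1 := Real.sin_sq_add_cos_sq (x 2)
  have h2 := Real.sin_sq_add_cos_sq (x 3)
  apply Prod.ext
  · simp [polarD]
  · apply E3_ext
    · simp [polarD]; field_simp
      linear_combination (w.2 0 * Real.cos (x 3) ^ 2 + w.2 1 * Real.cos (x 3) * Real.sin (x 3)) * h1
        + w.2 0 * h2
    · simp [polarD]; field_simp
      linear_combination (w.2 1 * Real.sin (x 3) ^ 2 + w.2 0 * Real.cos (x 3) * Real.sin (x 3)) * h1
        + w.2 1 * h2
    · simp [polarD]; field_simp
      linear_combination (w.2 2) * h1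

end Polar

/-! ### The metric in Cartesian form, regular on the axis. -/

section Metric

variable {M : Type*} [TopologicalSpace M] [ChartedSpace E4 M] [IsManifold (𝓡 4) ∞ M]

/-- The function `f(r, θ)` as a function on three-space. -/
def onE3 (f : ℝ → ℝ → ℝ) (y : E3) : ℝ := f ‖y‖ (polarAngle y)

/-- Three-space outside of the horizon radius. -/
def outside (rH : ℝ) : Set E3 := {y | rH < ‖y‖}

lemma isOpen_outside (rH : ℝ) : IsOpen (outside rH) := isOpen_lt continuous_const continuous_norm

lemma isOpen_exterior (rH : ℝ) : IsOpen (exterior rH) :=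
  isOpen_lt continuous_const (continuous_norm.comp continuous_snd)

lemma onE3_rotZ (f : ℝ → ℝ → ℝ) (α : ℝ) (y : E3) : onE3 f (rotZ α y) = onE3 f y := by
  rw [onE3, onE3, norm_rotZ, polarAngle_rotZ]

lemma onE3_sph (f : ℝ → ℝ → ℝ) {r : ℝ} (hr : 0 < r) {θ : ℝ} (hθ : θ ∈ Icc 0 Real.pi) (φ : ℝ) :
    onE3 f (sph r θ φ) = f r θ := by
  rw [onE3, norm_sph hr.le, polarAngle_sph hr hθ]

/-- The metric of a circular black hole in Cartesian coordinates, as a quadratic form. -/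
def cartForm (N A B w : ℝ → ℝ → ℝ) (q v : ℝ × E3) : ℝ :=
  let v' := v.2 - (v.1 * onE3 w q.2) • rotGen q.2
  onE3 B q.2 ^ 2 * ‖v'‖ ^ 2 - (onE3 N q.2 * v.1) ^ 2
    + (onE3 A q.2 ^ 2 - onE3 B q.2 ^ 2) * ((q.2 0 * v' 0 + q.2 1 * v' 1 + q.2 2 * v' 2) / ‖q.2‖) ^ 2

/-- After subtraction of the dragging velocity, the spatial part of the vector has orthogonal
components ν₁, r ν₂ and r sin θ (ν₃ − ω ν₀). The line element weights the first by A² and the other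
two by B². -/
lemma cartForm_polar (N A B w : ℝ → ℝ → ℝ) {x : Fin 4 → ℝ} (hr : 0 < x 1)
    (hθ : x 2 ∈ Icc 0 Real.pi) (ν : Fin 4 → ℝ) :
    cartForm N A B w (polar x) (polarD x ν) = ν ⬝ᵥ (hartleThorne N A B w x *ᵥ ν) := by
  have h1 := Real.sin_sq_add_cos_sq (x 2)
  have h2 := Real.sin_sq_add_cos_sq (x 3)
  have hn : ‖(polarD x ν).2 - ((polarD x ν).1 * w (x 1) (x 2)) • rotGen (polar x).2‖ ^ 2
      = ν 1 ^ 2 + x 1 ^ 2 * ν 2 ^ 2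
        + x 1 ^ 2 * Real.sin (x 2) ^ 2 * (ν 3 - w (x 1) (x 2) * ν 0) ^ 2 := by
    rw [E3_norm_sq]
    simp [polarD, polar_eq]
    linear_combination ((ν 1 * Real.sin (x 2) + x 1 * ν 2 * Real.cos (x 2)) ^ 2
      + (x 1 * Real.sin (x 2) * (ν 3 - w (x 1) (x 2) * ν 0)) ^ 2) * h2
      + (ν 1 ^ 2 + x 1 ^ 2 * ν 2 ^ 2) * h1
  have hi : (polar x).2 0 * ((polarD x ν).2 - ((polarD x ν).1 * w (x 1) (x 2)) • rotGen (polar x).2) 0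
      + (polar x).2 1 * ((polarD x ν).2 - ((polarD x ν).1 * w (x 1) (x 2)) • rotGen (polar x).2) 1
      + (polar x).2 2 * ((polarD x ν).2 - ((polarD x ν).1 * w (x 1) (x 2)) • rotGen (polar x).2) 2
      = x 1 * ν 1 := by
    simp [polarD, polar_eq]
    linear_combination (x 1 * Real.sin (x 2) * (ν 1 * Real.sin (x 2) + x 1 * ν 2 * Real.cos (x 2))) * h2
      + (x 1 * ν 1) * h1
  have hw : onE3 w (polar x).2 = w (x 1) (x 2) := onE3_sph w hr hθ _
  rw [cartForm, hw]
  simp only [hn, hi]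
  rw [polar_eq, onE3_sph N hr hθ, onE3_sph A hr hθ, onE3_sph B hr hθ, norm_sph hr.le]
  rw [mul_div_cancel_left₀ _ hr.ne']
  simp [hartleThorne, Matrix.mulVec, dotProduct, Fin.sum_univ_four, polarD]
  ring

/-- A continuous identity on the exterior may be checked off the axis. -/
lemma eqOn_exterior_of_polar {rH : ℝ} {f g : ℝ × E3 → ℝ}
    (hf : ContinuousOn f (exterior rH)) (hg : ContinuousOn g (exterior rH))
    (h : ∀ x ∈ polarExterior rH, f (polar x) = g (polar x)) : EqOn f g (exterior rH) := by
  -- `L` reads off the first Cartesian coordinate. The set where it is nonzero is dense and misses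
  -- the axis.
  set L : ℝ × E3 →L[ℝ] ℝ := (EuclideanSpace.proj (𝕜 := ℝ) (0 : Fin 3)).comp
    (ContinuousLinearMap.snd ℝ ℝ E3) with hL
  have hsurj : Function.Surjective L := fun c => ⟨(0, !₂[c, 0, 0]), by simp [hL]⟩
  have hd : Dense (L ⁻¹' {0}ᶜ) := (dense_compl_singleton (0 : ℝ)).preimage (L.isOpenMap hsurj)
  have hs : exterior rH ∩ (L ⁻¹' {0}ᶜ) ⊆ exterior rH := inter_subset_left
  refine EqOn.of_subset_closure (s := exterior rH ∩ (L ⁻¹' {0}ᶜ)) ?_ hf hg hs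
    (hd.open_subset_closure_inter (isOpen_exterior rH))
  rintro ⟨t, y⟩ ⟨hq, hq0⟩
  have hq' : rH < ‖y‖ := hq
  have hy : y 0 ≠ 0 := by simpa [hL] using hq0
  have hy0 : y ≠ 0 := by rintro rfl; simp at hy
  have hx := h ![t, ‖y‖, polarAngle y, azimuth y] ⟨by simpa using hq', by
    simpa using polarAngle_mem_Ioo (Or.inl hy)⟩
  have hpol : polar ![t, ‖y‖, polarAngle y, azimuth y] = (t, y) := by
    rw [polar_eq]; simp [sph_polarAngle_azimuth hy0]
  rwa [hpol] at hx

lemma continuousOn_onE3 {rH : ℝ} {f : ℝ → ℝ → ℝ} (hf : SmoothExterior rH f) :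
    ContinuousOn (fun q : ℝ × E3 => onE3 f q.2) (exterior rH) :=
  (ContDiffOn.continuousOn hf).comp continuousOn_snd (fun _ hq => hq)

lemma continuousOn_cartForm {rH : ℝ} (h0 : 0 ≤ rH) {N A B w : ℝ → ℝ → ℝ}
    (hN : SmoothExterior rH N) (hA : SmoothExterior rH A) (hB : SmoothExterior rH B)
    (hw : SmoothExterior rH w) (v : ℝ × E3) :
    ContinuousOn (fun q => cartForm N A B w q v) (exterior rH) := by
  have hN' := continuousOn_onE3 hN
  have hA' := continuousOn_onE3 hA
  have hB' := continuousOn_onE3 hB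
  have hw' := continuousOn_onE3 hw
  have hJ : Continuous (fun q : ℝ × E3 => rotGen q.2) := by
    refine (PiLp.continuous_toLp 2 _).comp (continuous_pi fun i => ?_)
    fin_cases i
    · simp; fun_prop
    · simp; fun_prop
    · simp; fun_prop
  have hv' : ContinuousOn (fun q : ℝ × E3 => v.2 - (v.1 * onE3 w q.2) • rotGen q.2) (exterior rH) :=
    continuousOn_const.sub ((continuousOn_const.mul hw').smul hJ.continuousOn)
  have hvi (i : Fin 3) :
      ContinuousOn (fun q : ℝ × E3 => (v.2 - (v.1 * onE3 w q.2) • rotGen q.2) i) (exterior rH) :=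
    (EuclideanSpace.proj (𝕜 := ℝ) i).continuous.comp_continuousOn hv'
  have hqi (i : Fin 3) : ContinuousOn (fun q : ℝ × E3 => q.2 i) (exterior rH) := by fun_prop
  unfold cartForm
  refine (((hB'.pow 2).mul (hv'.norm.pow 2)).sub ((hN'.mul continuousOn_const).pow 2)).add
    (((hA'.pow 2).sub (hB'.pow 2)).mul (ContinuousOn.pow (ContinuousOn.div ?_ ?_ ?_) 2))
  · exact (((hqi 0).mul (hvi 0)).add ((hqi 1).mul (hvi 1))).add ((hqi 2).mul (hvi 2))
  · fun_prop
  · intro q hq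
    exact (h0.trans_lt hq).ne'

namespace CircularBlackHole

variable (S : CircularBlackHole M)

lemma Ψ_contMDiffAt {q : ℝ × E3} (hq : q ∈ exterior S.rH) :
    ContMDiffAt 𝓘(ℝ, ℝ × E3) (𝓡 4) ∞ S.Ψ q :=
  S.Ψ_smooth.contMDiffAt ((isOpen_exterior _).mem_nhds hq)

lemma polar_mem_exterior {x : Fin 4 → ℝ} (hx : S.rH < x 1) : polar x ∈ exterior S.rH := by
  change S.rH < ‖sph _ _ _‖
  rwa [norm_sph (S.rH_nonneg.trans hx.le)]

lemma mfderiv_Ψ_polar {x : Fin 4 → ℝ} (hx : S.rH < x 1) (ν : Fin 4 → ℝ) :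
    mfderiv 𝓘(ℝ, Fin 4 → ℝ) (𝓡 4) (fun z => S.Ψ (polar z)) x ν
      = mfderiv 𝓘(ℝ, ℝ × E3) (𝓡 4) S.Ψ (polar x) (polarD x ν) := by
  have h1 : MDifferentiableAt 𝓘(ℝ, ℝ × E3) (𝓡 4) S.Ψ (polar x) :=
    (S.Ψ_contMDiffAt (S.polar_mem_exterior hx)).mdifferentiableAt (by simp)
  have h2 : MDifferentiableAt 𝓘(ℝ, Fin 4 → ℝ) 𝓘(ℝ, ℝ × E3) polar x :=
    (contDiff_polar.differentiable (by simp) x).mdifferentiableAt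
  have h3 := mfderiv_comp x h1 h2
  have h4 : mfderiv 𝓘(ℝ, Fin 4 → ℝ) (𝓡 4) (fun z => S.Ψ (polar z)) x
      = (mfderiv 𝓘(ℝ, ℝ × E3) (𝓡 4) S.Ψ (polar x)).comp
        (mfderiv 𝓘(ℝ, Fin 4 → ℝ) 𝓘(ℝ, ℝ × E3) polar x) := h3
  rw [h4]
  rw [mfderiv_eq_fderiv]
  exact congrArg (mfderiv 𝓘(ℝ, ℝ × E3) (𝓡 4) S.Ψ (polar x)) (fderiv_polar x ν)

/-- The metric in Cartesian coordinates, also on the axis. -/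
lemma inner_mfderiv_Ψ {q : ℝ × E3} (hq : q ∈ exterior S.rH) (v : ℝ × E3) :
    S.g.inner (S.Ψ q) (mfderiv 𝓘(ℝ, ℝ × E3) (𝓡 4) S.Ψ q v)
      (mfderiv 𝓘(ℝ, ℝ × E3) (𝓡 4) S.Ψ q v) = cartForm S.N S.A S.B S.w q v := by
  have hv := continuousOn_mfderiv_apply (fun q hq => S.Ψ_contMDiffAt hq) v
  refine eqOn_exterior_of_polar (S.g.continuousOn_inner hv hv)
    (continuousOn_cartForm S.rH_nonneg S.N_smooth S.A_smooth S.B_smooth S.w_smooth v)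
    (fun x hx => ?_) hq
  have hr : 0 < x 1 := S.rH_nonneg.trans_lt hx.1
  obtain ⟨ν, rfl⟩ := polarD_surjective hr.ne' (Real.sin_pos_of_mem_Ioo hx.2).ne' v
  rw [cartForm_polar _ _ _ _ hr ⟨hx.2.1.le, hx.2.2.le⟩, ← S.Ψ_metric x hx,
    S.mfderiv_Ψ_polar hx.1]

/-- The differential of the coordinates has no kernel. -/
lemma mfderiv_Ψ_injective {q : ℝ × E3} (hq : q ∈ exterior S.rH) {v : ℝ × E3}
    (hv : (mfderiv 𝓘(ℝ, ℝ × E3) (𝓡 4) S.Ψ q v : E4) = 0) : v = 0 := by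
  set W := onE3 S.w q.2 with hW
  have hr : 0 < ‖q.2‖ := S.rH_nonneg.trans_lt hq
  have hN : 0 < onE3 S.N q.2 := S.N_pos _ hq _ (polarAngle_mem _)
  have hA : 0 < onE3 S.A q.2 := S.A_pos _ hq _ (polarAngle_mem _)
  have hB : 0 < onE3 S.B q.2 := S.B_pos _ hq _ (polarAngle_mem _)
  -- Polarisation by hand, since only the quadratic form is available: adding a kernel vector to
  -- multiples of the zero-angular-momentum direction does not change their norm. Comparing `s = 0`
  -- with `s = 1` isolates the cross term −2 N² v₀, so the time component vanishes.
  have key (s : ℝ) : cartForm S.N S.A S.B S.w q (v + s • (1, W • rotGen q.2))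
      = cartForm S.N S.A S.B S.w q (s • (1, W • rotGen q.2)) := by
    rw [← S.inner_mfderiv_Ψ hq, ← S.inner_mfderiv_Ψ hq]
    have : mfderiv 𝓘(ℝ, ℝ × E3) (𝓡 4) S.Ψ q (v + s • ((1 : ℝ), W • rotGen q.2))
      = mfderiv 𝓘(ℝ, ℝ × E3) (𝓡 4) S.Ψ q (s • ((1 : ℝ), W • rotGen q.2)) := by
      refine (map_add (mfderiv 𝓘(ℝ, ℝ × E3) (𝓡 4) S.Ψ q) v _).trans ?_
      exact (congrArg (· + _) hv).trans (zero_add _)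
    rw [this]
  have e1 (s : ℝ) : cartForm S.N S.A S.B S.w q (v + s • (1, W • rotGen q.2))
      = cartForm S.N S.A S.B S.w q v - onE3 S.N q.2 ^ 2 * (2 * s * v.1 + s ^ 2) := by
    have : (v + s • ((1 : ℝ), W • rotGen q.2)).2 -
      ((v + s • ((1 : ℝ), W • rotGen q.2)).1 * onE3 S.w q.2) • rotGen q.2
        = v.2 - (v.1 * onE3 S.w q.2) • rotGen q.2 := by
      simp [← hW]; module
    rw [cartForm, cartForm, this]
    simp; ring
  have e2 (s : ℝ) : cartForm S.N S.A S.B S.w q (s • (1, W • rotGen q.2))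
      = - onE3 S.N q.2 ^ 2 * s ^ 2 := by
    have : (s • ((1 : ℝ), W • rotGen q.2)).2 -
      ((s • ((1 : ℝ), W • rotGen q.2)).1 * onE3 S.w q.2) • rotGen q.2 = 0 := by
      simp [← hW]; module
    rw [cartForm, this]
    simp; ring
  have k0 := key 0
  have k1 := key 1
  rw [e1, e2] at k0 k1
  have ht : v.1 = 0 := by
    have : onE3 S.N q.2 ^ 2 * v.1 = 0 := by linarith
    rcases mul_eq_zero.1 this with h | h
    · exact absurd h (by positivity)
    · exact h
  have hc : cartForm S.N S.A S.B S.w q v = 0 := by linarith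
  rw [cartForm] at hc
  simp only [ht, zero_mul, zero_smul, sub_zero, mul_zero] at hc
  -- By Cauchy–Schwarz the squared radial component D is at most ‖v‖², so the remaining form A² D +
  -- B² (‖v‖² − D) is a sum of nonnegative terms.
  have cs : (q.2 0 * v.2 0 + q.2 1 * v.2 1 + q.2 2 * v.2 2) ^ 2 ≤ ‖q.2‖ ^ 2 * ‖v.2‖ ^ 2 := by
    rw [E3_norm_sq, E3_norm_sq]
    nlinarith [sq_nonneg (q.2 0 * v.2 1 - q.2 1 * v.2 0), sq_nonneg (q.2 0 * v.2 2 - q.2 2 * v.2 0),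
      sq_nonneg (q.2 1 * v.2 2 - q.2 2 * v.2 1)]
  set D := ((q.2 0 * v.2 0 + q.2 1 * v.2 1 + q.2 2 * v.2 2) / ‖q.2‖) ^ 2 with hD
  have hDle : D ≤ ‖v.2‖ ^ 2 := by
    rw [hD, div_pow, div_le_iff₀ (by positivity)]; linarith
  have hD0 : 0 ≤ D := sq_nonneg _
  have hA2 : 0 < onE3 S.A q.2 ^ 2 := by positivity
  have hB2 : 0 < onE3 S.B q.2 ^ 2 := by positivity
  have h1 : 0 ≤ onE3 S.B q.2 ^ 2 * (‖v.2‖ ^ 2 - D) := mul_nonneg hB2.le (by linarith)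
  have h2 : 0 ≤ onE3 S.A q.2 ^ 2 * D := mul_nonneg hA2.le hD0
  have h3 : onE3 S.A q.2 ^ 2 * D = 0 := by nlinarith
  have h4 : D = 0 := by rcases mul_eq_zero.1 h3 with h | h; exacts [absurd h hA2.ne', h]
  have h5 : onE3 S.B q.2 ^ 2 * ‖v.2‖ ^ 2 = 0 := by rw [h4] at hc; linarith
  have h6 : ‖v.2‖ ^ 2 = 0 := by rcases mul_eq_zero.1 h5 with h | h; exacts [absurd h hB2.ne', h]
  have h7 : v.2 = 0 := by simpa using h6
  exact Prod.ext ht h7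

end CircularBlackHole

end Metric

/-! ### Coordinates adapted to the observers of zero angular momentum. -/

section Corotating

variable {M : Type*} [TopologicalSpace M] [ChartedSpace E4 M] [IsManifold (𝓡 4) ∞ M]

lemma contDiff_rotZ : ContDiff ℝ ∞ (fun p : ℝ × E3 => rotZ p.1 p.2) := by
  have h (i : Fin 3) : ContDiff ℝ ∞ (fun p : ℝ × E3 => p.2 i) :=
    (EuclideanSpace.proj (𝕜 := ℝ) i).contDiff.comp contDiff_snd
  have h0 := h 0
  have h1 := h 1
  have h2 := h 2
  rw [contDiff_euclidean]
  intro i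
  fin_cases i
  · simp only [Fin.zero_eta, rotZ_zero]; fun_prop
  · simp only [Fin.mk_one, rotZ_one]; fun_prop
  · simp only [Fin.reduceFinMk, rotZ_two]; fun_prop

/-- The map `(t, y) ↦ (t, R(s ω t) y)`, where `R(α)` is the rotation by `α` about the axis. For
`s = 1` it passes from coordinates that corotate with the frames of zero angular momentum to
asymptotically nonrotating ones; for `s = -1` it is the inverse. -/
def corot (w : ℝ → ℝ → ℝ) (s : ℝ) (q : ℝ × E3) : ℝ × E3 :=
  (q.1, rotZ (s * (onE3 w q.2 * q.1)) q.2)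

lemma norm_corot (w : ℝ → ℝ → ℝ) (s : ℝ) (q : ℝ × E3) : ‖(corot w s q).2‖ = ‖q.2‖ := norm_rotZ _ _

lemma onE3_corot (f w : ℝ → ℝ → ℝ) (s : ℝ) (q : ℝ × E3) :
    onE3 f (corot w s q).2 = onE3 f q.2 := onE3_rotZ _ _ _

lemma corot_mem {rH : ℝ} (w : ℝ → ℝ → ℝ) (s : ℝ) {q : ℝ × E3} (hq : q ∈ exterior rH) :
    corot w s q ∈ exterior rH := by
  change rH < ‖(corot w s q).2‖
  rwa [norm_corot]

lemma corot_corot (w : ℝ → ℝ → ℝ) (s s' : ℝ) (q : ℝ × E3) :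
    corot w s (corot w s' q) = corot w (s + s') q := by
  refine Prod.ext rfl ?_
  change rotZ (s * (onE3 w (corot w s' q).2 * q.1)) (rotZ (s' * (onE3 w q.2 * q.1)) q.2) = _
  rw [onE3_corot, rotZ_rotZ, corot, add_mul]

lemma corot_zero (w : ℝ → ℝ → ℝ) (q : ℝ × E3) : corot w 0 q = q := by
  rw [corot, zero_mul, rotZ_zero_angle]

lemma contDiffOn_onE3 {rH : ℝ} {f : ℝ → ℝ → ℝ} (hf : SmoothExterior rH f) :
    ContDiffOn ℝ ∞ (onE3 f) (outside rH) := hf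

lemma contDiffOn_corot {rH : ℝ} {w : ℝ → ℝ → ℝ} (hw : SmoothExterior rH w) (s : ℝ) :
    ContDiffOn ℝ ∞ (corot w s) (exterior rH) := by
  have h1 : ContDiffOn ℝ ∞ (fun q : ℝ × E3 => onE3 w q.2) (exterior rH) :=
    (contDiffOn_onE3 hw).comp contDiff_snd.contDiffOn (fun _ hq => hq)
  have h2 : ContDiffOn ℝ ∞ (fun q : ℝ × E3 => s * (onE3 w q.2 * q.1)) (exterior rH) :=
    contDiffOn_const.mul (h1.mul contDiff_fst.contDiffOn)
  have h4 : ContDiffOn ℝ ∞ (fun q : ℝ × E3 => (s * (onE3 w q.2 * q.1), q.2)) (exterior rH) :=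
    h2.prodMk contDiff_snd.contDiffOn
  have h3 : ContDiffOn ℝ ∞ (fun q : ℝ × E3 => rotZ (s * (onE3 w q.2 * q.1)) q.2) (exterior rH) :=
    (contDiff_rotZ.comp_contDiffOn h4).congr (fun q _ => rfl)
  exact contDiff_fst.contDiffOn.prodMk h3

lemma differentiableAt_corot {rH : ℝ} {w : ℝ → ℝ → ℝ} (hw : SmoothExterior rH w) (s : ℝ)
    {q : ℝ × E3} (hq : q ∈ exterior rH) : DifferentiableAt ℝ (corot w s) q :=
  ((contDiffOn_corot hw s).contDiffAt ((isOpen_exterior rH).mem_nhds hq)).differentiableAt (by simp)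

/-- Rotations preserve r and θ, hence ω, so rotating back by the same angle is an inverse; the chain
rule does the rest. -/
lemma fderiv_corot_injective {rH : ℝ} {w : ℝ → ℝ → ℝ} (hw : SmoothExterior rH w)
    {q : ℝ × E3} (hq : q ∈ exterior rH) {v : ℝ × E3} (hv : fderiv ℝ (corot w 1) q v = 0) :
    v = 0 := by
  have h : corot w (-1) ∘ corot w 1 = id := by
    funext q; simp [corot_corot, corot_zero]
  have h1 := fderiv_comp q (differentiableAt_corot hw (-1) (corot_mem w 1 hq))
    (differentiableAt_corot hw 1 hq)
  rw [h, fderiv_id] at h1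
  have := DFunLike.congr_fun h1 v
  simpa [hv] using this

/-- In corotating coordinates the time lines are the worldlines with velocity ∂_t + ω ∂_φ. -/
lemma fderiv_corot_time {rH : ℝ} {w : ℝ → ℝ → ℝ} (hw : SmoothExterior rH w)
    {q : ℝ × E3} (hq : q ∈ exterior rH) :
    fderiv ℝ (corot w 1) q (1, 0) = (1, onE3 w q.2 • rotGen (corot w 1 q).2) := by
  obtain ⟨t, y⟩ := q
  have hc : HasDerivAt (fun s : ℝ => ((s, y) : ℝ × E3)) (1, 0) t :=
    (hasDerivAt_id t).prodMk (hasDerivAt_const t y)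
  have h1 : HasDerivAt (fun s : ℝ => corot w 1 (s, y)) (fderiv ℝ (corot w 1) (t, y) (1, 0)) t :=
    HasFDerivAt.comp_hasDerivAt (l := corot w 1) (f := fun s : ℝ => ((s, y) : ℝ × E3)) t
      (differentiableAt_corot hw 1 hq).hasFDerivAt hc
  have ha : HasDerivAt (fun s : ℝ => 1 * (onE3 w y * s)) (onE3 w y) t := by
    simpa using (hasDerivAt_id t).const_mul (onE3 w y)
  apply Prod.ext
  · have h2 := (ContinuousLinearMap.fst ℝ ℝ E3).hasFDerivAt.comp_hasDerivAt t h1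
    exact h2.unique (hasDerivAt_id t)
  · have h2 (i : Fin 3) := (EuclideanSpace.proj (𝕜 := ℝ) i).hasFDerivAt.comp_hasDerivAt t
      ((ContinuousLinearMap.snd ℝ ℝ E3).hasFDerivAt.comp_hasDerivAt t h1)
    apply E3_ext
    · refine (h2 0).unique ((((ha.cos).mul_const (y 0)).sub (ha.sin.mul_const (y 1))).congr_deriv ?_)
      simp [corot]; ring
    · refine (h2 1).unique ((((ha.sin).mul_const (y 0)).add (ha.cos.mul_const (y 1))).congr_deriv ?_)
      simp [corot]; ring
    · refine (h2 2).unique ((hasDerivAt_const t (y 2)).congr_deriv ?_)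
      simp

/-- The dragging term cancels the spatial velocity exactly, so only the lapse contributes and the
direction is timelike even inside an ergoregion. -/
lemma cartForm_time (N A B w : ℝ → ℝ → ℝ) (q : ℝ × E3) (s : ℝ) :
    cartForm N A B w q (s • (1, onE3 w q.2 • rotGen q.2)) = -(onE3 N q.2 * s) ^ 2 := by
  have : (s • ((1 : ℝ), onE3 w q.2 • rotGen q.2)).2 -
      ((s • ((1 : ℝ), onE3 w q.2 • rotGen q.2)).1 * onE3 w q.2) • rotGen q.2 = 0 := by
    simp; module
  rw [cartForm, this]
  simp

namespace CircularBlackHole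

variable (S : CircularBlackHole M)

/-- Corotating coordinates on the exterior. -/
def Ψc (q : ℝ × E3) : M := S.Ψ (corot S.w 1 q)

lemma Ψc_contMDiffAt {q : ℝ × E3} (hq : q ∈ exterior S.rH) :
    ContMDiffAt 𝓘(ℝ, ℝ × E3) (𝓡 4) ∞ S.Ψc q :=
  (S.Ψ_contMDiffAt (corot_mem S.w 1 hq)).comp q
    (((contDiffOn_corot S.w_smooth 1).contDiffAt ((isOpen_exterior _).mem_nhds hq)).contMDiffAt)

lemma Ψc_injOn : InjOn S.Ψc (exterior S.rH) := by
  intro p hp q hq h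
  have h1 := S.Ψ_inj (corot_mem S.w 1 hp) (corot_mem S.w 1 hq) h
  have h2 := congrArg (corot S.w (-1)) h1
  simpa [corot_corot, corot_zero] using h2

lemma Ψ_eq_Ψc (q : ℝ × E3) : S.Ψ q = S.Ψc (corot S.w (-1) q) := by
  simp [Ψc, corot_corot, corot_zero]

lemma image_Ψc : S.Ψc '' exterior S.rH = S.Ψ '' exterior S.rH := by
  apply Subset.antisymm
  · rintro _ ⟨q, hq, rfl⟩; exact ⟨_, corot_mem S.w 1 hq, rfl⟩
  · rintro _ ⟨q, hq, rfl⟩; exact ⟨_, corot_mem S.w (-1) hq, (S.Ψ_eq_Ψc q).symm⟩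

lemma mfderiv_Ψc {q : ℝ × E3} (hq : q ∈ exterior S.rH) (v : ℝ × E3) :
    mfderiv 𝓘(ℝ, ℝ × E3) (𝓡 4) S.Ψc q v
      = mfderiv 𝓘(ℝ, ℝ × E3) (𝓡 4) S.Ψ (corot S.w 1 q) (fderiv ℝ (corot S.w 1) q v) := by
  have h1 : MDifferentiableAt 𝓘(ℝ, ℝ × E3) (𝓡 4) S.Ψ (corot S.w 1 q) :=
    (S.Ψ_contMDiffAt (corot_mem S.w 1 hq)).mdifferentiableAt (by simp)
  have h2 := (differentiableAt_corot S.w_smooth 1 hq).mdifferentiableAt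
  have h3 : mfderiv 𝓘(ℝ, ℝ × E3) (𝓡 4) S.Ψc q = _ := mfderiv_comp q h1 h2
  rw [h3, mfderiv_eq_fderiv]
  rfl

lemma mfderiv_Ψc_injective {q : ℝ × E3} (hq : q ∈ exterior S.rH) {v : ℝ × E3}
    (hv : (mfderiv 𝓘(ℝ, ℝ × E3) (𝓡 4) S.Ψc q v : E4) = 0) : v = 0 := by
  rw [S.mfderiv_Ψc hq] at hv
  exact fderiv_corot_injective S.w_smooth hq (S.mfderiv_Ψ_injective (corot_mem S.w 1 hq) hv)

/-- The observers of zero angular momentum are timelike. -/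
lemma inner_time {q : ℝ × E3} (hq : q ∈ exterior S.rH) (s : ℝ) :
    S.g.inner (S.Ψc q) (mfderiv 𝓘(ℝ, ℝ × E3) (𝓡 4) S.Ψc q (s, (0 : E3)))
      (mfderiv 𝓘(ℝ, ℝ × E3) (𝓡 4) S.Ψc q (s, (0 : E3))) = -(onE3 S.N q.2 * s) ^ 2 := by
  have h0 : ((s, (0 : E3)) : ℝ × E3) = s • ((1 : ℝ), (0 : E3)) := by simp
  have h := S.inner_mfderiv_Ψ (corot_mem S.w 1 hq) (fderiv ℝ (corot S.w 1) q (s, (0 : E3)))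
  rw [S.mfderiv_Ψc hq, Ψc, h, h0, map_smul, fderiv_corot_time S.w_smooth hq]
  have := cartForm_time S.N S.A S.B S.w (corot S.w 1 q) s
  rwa [onE3_corot, onE3_corot] at this

lemma N_onE3_pos {y : E3} (hy : S.rH < ‖y‖) : 0 < onE3 S.N y := S.N_pos _ hy _ (polarAngle_mem _)

/-- The inverse of the corotating coordinates is smooth. -/
lemma contDiffAt_of_Ψc_comp {E : Type*} [NormedAddCommGroup E] [NormedSpace ℝ E] {σ : E → M}
    {x₀ : E} (hσ : ContMDiffAt 𝓘(ℝ, E) (𝓡 4) ∞ σ x₀) {f : E → ℝ × E3}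
    (hf : ∀ᶠ x in 𝓝 x₀, f x ∈ exterior S.rH ∧ S.Ψc (f x) = σ x) : ContDiffAt ℝ ∞ f x₀ := by
  obtain ⟨hq, hq'⟩ := hf.self_of_nhds
  set q₀ := f x₀
  set p := σ x₀ with hp
  set h : ℝ × E3 → E4 := fun q => extChartAt (𝓡 4) p (S.Ψc q) with hh
  have hsrc : (extChartAt (𝓡 4) p).source ∈ 𝓝 p := extChartAt_source_mem_nhds p
  have hsrc' : (extChartAt (𝓡 4) p).source ∈ 𝓝 (S.Ψc q₀) := by rwa [hq']
  have hch : ContMDiffAt (𝓡 4) 𝓘(ℝ, E4) ∞ (extChartAt (𝓡 4) p) (S.Ψc q₀) := by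
    rw [hq']; exact contMDiffAt_extChartAt
  have hhs : ContDiffAt ℝ ∞ h q₀ := (hch.comp q₀ (S.Ψc_contMDiffAt hq)).contDiffAt
  -- In a chart of the spacetime the coordinates are a map between four-dimensional spaces with
  -- injective differential, so the inverse function theorem applies.
  have hinj : Function.Injective (fderiv ℝ h q₀) := by
    rw [← LinearMap.coe_coe, ← LinearMap.ker_eq_bot, LinearMap.ker_eq_bot']
    intro v hv
    have h1 : mfderiv 𝓘(ℝ, ℝ × E3) 𝓘(ℝ, E4) h q₀ = _ := mfderiv_comp q₀
      (hch.mdifferentiableAt (by simp)) ((S.Ψc_contMDiffAt hq).mdifferentiableAt (by simp))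
    rw [mfderiv_eq_fderiv] at h1
    have h2 := isInvertible_mfderiv_extChartAt (I := 𝓡 4) (x := p) (y := S.Ψc q₀)
      (mem_of_mem_nhds hsrc')
    obtain ⟨e, he⟩ := h2
    have h3 : fderiv ℝ h q₀ v = e (mfderiv 𝓘(ℝ, ℝ × E3) (𝓡 4) S.Ψc q₀ v) := by
      rw [h1, ← he]; rfl
    have h4 : e (mfderiv 𝓘(ℝ, ℝ × E3) (𝓡 4) S.Ψc q₀ v) = 0 := h3.symm.trans hv
    exact S.mfderiv_Ψc_injective hq ((map_eq_zero_iff e e.injective).1 h4)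
  have hdim : Module.finrank ℝ (ℝ × E3) = Module.finrank ℝ E4 := by simp
  let L : (ℝ × E3) ≃L[ℝ] E4 :=
    (LinearEquiv.ofInjectiveOfFinrankEq (fderiv ℝ h q₀ : (ℝ × E3) →ₗ[ℝ] E4) hinj
      hdim).toContinuousLinearEquiv
  have hL : HasFDerivAt h (L : (ℝ × E3) →L[ℝ] E4) q₀ := by
    have : (L : (ℝ × E3) →L[ℝ] E4) = fderiv ℝ h q₀ := by ext v <;> rfl
    rw [this]; exact (hhs.differentiableAt (by simp)).hasFDerivAt
  set e := hhs.toOpenPartialHomeomorph h hL (by simp) with he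
  have hinv : ContDiffAt ℝ ∞ (hhs.localInverse hL (by simp)) (h q₀) := hhs.to_localInverse hL (by simp)
  have hinv' : ContDiffAt ℝ ∞ e.symm (h q₀) := hinv
  have hq₀ : q₀ ∈ e.source := hhs.mem_toOpenPartialHomeomorph_source hL (by simp)
  have he' : ∀ q, e q = h q := fun q => rfl
  have hσ' : ContDiffAt ℝ ∞ (fun x => extChartAt (𝓡 4) p (σ x)) x₀ :=
    ((contMDiffAt_extChartAt (I := 𝓡 4) (x := p)).comp x₀ hσ).contDiffAt
  have hval : extChartAt (𝓡 4) p (σ x₀) = h q₀ := by rw [hh]; simp only [hq']; rfl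
  have hcomp : ContDiffAt ℝ ∞ (fun x => e.symm (extChartAt (𝓡 4) p (σ x))) x₀ :=
    ContDiffAt.comp (g := e.symm) x₀ (by rw [hval]; exact hinv') hσ'
  refine hcomp.congr_of_eventuallyEq ?_
  have hfin : e.symm (extChartAt (𝓡 4) p (σ x₀)) = q₀ := by
    rw [hval, ← he', e.left_inv hq₀]
  have c1 : ∀ᶠ x in 𝓝 x₀, extChartAt (𝓡 4) p (σ x) ∈ e.target :=
    hσ'.continuousAt.eventually_mem (by
      rw [hval, ← he']; exact e.open_target.mem_nhds (e.map_source hq₀))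
  have c2 : ∀ᶠ x in 𝓝 x₀, e.symm (extChartAt (𝓡 4) p (σ x)) ∈ exterior S.rH :=
    hcomp.continuousAt.eventually_mem (by rw [hfin]; exact (isOpen_exterior _).mem_nhds hq)
  have c3 : ∀ᶠ x in 𝓝 x₀, S.Ψc (e.symm (extChartAt (𝓡 4) p (σ x))) ∈ (extChartAt (𝓡 4) p).source := by
    have hc : ContinuousAt (fun x => S.Ψc (e.symm (extChartAt (𝓡 4) p (σ x)))) x₀ :=
      ContinuousAt.comp (g := S.Ψc) (by rw [hfin]; exact (S.Ψc_contMDiffAt hq).continuousAt)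
        hcomp.continuousAt
    exact hc.eventually_mem (by rw [hfin]; exact hsrc')
  have c4 : ∀ᶠ x in 𝓝 x₀, σ x ∈ (extChartAt (𝓡 4) p).source := hσ.continuousAt.eventually_mem hsrc
  -- No continuity of `f` was assumed: global injectivity of `Ψc` alone identifies it with the
  -- smooth local inverse near `x₀`.
  filter_upwards [c1, c2, c3, c4, hf] with x h1 h2 h3 h4 h5
  refine S.Ψc_injOn h5.1 h2 ?_
  rw [h5.2]
  refine (extChartAt (𝓡 4) p).injOn h4 h3 ?_
  exact (e.right_inv h1).symm

end CircularBlackHole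

end Corotating

/-! ### The surface as a graph over the exterior of a ball. -/

section Projection

/-- The inverse function theorem gives a smooth local inverse with values in `U`; injectivity on `U`
forces the chosen global inverse to agree with it near `f x`. -/
lemma contDiffAt_invFunOn {E : Type*} [NormedAddCommGroup E] [NormedSpace ℝ E]
    [FiniteDimensional ℝ E] {f : E → E} {U : Set E} (hU : IsOpen U)
    (hf : ContDiffOn ℝ ∞ f U) (hinj : InjOn f U) {x : E} (hx : x ∈ U)
    (hker : ∀ v, fderiv ℝ f x v = 0 → v = 0) :
    ContDiffAt ℝ ∞ (Function.invFunOn f U) (f x) ∧ f '' U ∈ 𝓝 (f x) := by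
  have : CompleteSpace E := FiniteDimensional.complete ℝ E
  have hfx : ContDiffAt ℝ ∞ f x := hf.contDiffAt (hU.mem_nhds hx)
  have hi : Function.Injective (fderiv ℝ f x : E →ₗ[ℝ] E) :=
    LinearMap.ker_eq_bot.1 (LinearMap.ker_eq_bot'.2 hker)
  let L : E ≃L[ℝ] E :=
    (LinearEquiv.ofInjectiveOfFinrankEq (fderiv ℝ f x : E →ₗ[ℝ] E) hi rfl).toContinuousLinearEquiv
  have hL : HasFDerivAt f (L : E →L[ℝ] E) x := by
    have : (L : E →L[ℝ] E) = fderiv ℝ f x := by ext v; rfl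
    rw [this]; exact (hfx.differentiableAt (by simp)).hasFDerivAt
  set e := hfx.toOpenPartialHomeomorph f hL (by simp) with he
  have he' : ∀ q, e q = f q := fun q => rfl
  have hxe : x ∈ e.source := hfx.mem_toOpenPartialHomeomorph_source hL (by simp)
  have hinv : ContDiffAt ℝ ∞ e.symm (f x) := hfx.to_localInverse hL (by simp)
  have hfin : e.symm (f x) = x := by rw [← he', e.left_inv hxe]
  have c1 : ∀ᶠ y in 𝓝 (f x), y ∈ e.target := by
    rw [← he']; exact e.open_target.mem_nhds (e.map_source hxe)
  have c2 : ∀ᶠ y in 𝓝 (f x), e.symm y ∈ U :=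
    hinv.continuousAt.eventually_mem (by rw [hfin]; exact hU.mem_nhds hx)
  refine ⟨hinv.congr_of_eventuallyEq ?_, ?_⟩
  · filter_upwards [c1, c2] with y h1 h2
    have h3 : f (e.symm y) = y := e.right_inv h1
    have h4 : ∃ a ∈ U, f a = y := ⟨_, h2, h3⟩
    exact hinj (Function.invFunOn_mem h4) h2 ((Function.invFunOn_eq h4).trans h3.symm)
  · filter_upwards [c1, c2] with y h1 h2
    exact ⟨_, h2, e.right_inv h1⟩

lemma isPreconnected_outside {R : ℝ} (hR : 0 ≤ R) : IsPreconnected (outside R) := by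
  have h : outside R = (fun p : ℝ × E3 => p.1 • p.2) '' (Ioi R ×ˢ Metric.sphere 0 1) := by
    ext y
    constructor
    · intro hy
      have hy' : R < ‖y‖ := hy
      have h0 : 0 < ‖y‖ := hR.trans_lt hy'
      refine ⟨(‖y‖, ‖y‖⁻¹ • y), ⟨hy', ?_⟩, ?_⟩
      · simp [norm_smul, h0.ne']
      · simp [smul_smul, h0.ne']
    · rintro ⟨⟨r, n⟩, ⟨hr, hn⟩, rfl⟩
      have hr' : R < r := hr
      have : ‖n‖ = 1 := by simpa using hn
      change R < ‖r • n‖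
      rw [norm_smul, this, mul_one, Real.norm_of_nonneg (hR.trans hr'.le)]
      exact hr'
  rw [h]
  refine (isPreconnected_Ioi.prod (isPreconnected_sphere ?_ 0 1)).image _ (by fun_prop)
  rw [← Module.finrank_eq_rank]
  simp

variable {M : Type*} [TopologicalSpace M] [ChartedSpace E4 M] [IsManifold (𝓡 4) ∞ M]

namespace PartialCauchySurface

variable {S : CircularBlackHole M} (Sig : PartialCauchySurface S)

/-- The corotating coordinates of the points of a partial Cauchy surface. -/
def coord (x : E3) : ℝ × E3 := Function.invFunOn S.Ψc (exterior S.rH) (Sig.σ x)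

lemma mem_image_Ψc {x : E3} (hx : x ∈ outside 1) :
    ∃ q ∈ exterior S.rH, S.Ψc q = Sig.σ x := by
  have h := Sig.interior x hx
  rwa [← S.image_Ψc] at h

lemma coord_mem {x : E3} (hx : x ∈ outside 1) : Sig.coord x ∈ exterior S.rH :=
  Function.invFunOn_mem (Sig.mem_image_Ψc hx)

lemma Ψc_coord {x : E3} (hx : x ∈ outside 1) : S.Ψc (Sig.coord x) = Sig.σ x :=
  Function.invFunOn_eq (Sig.mem_image_Ψc hx)

lemma outside_subset : outside 1 ⊆ outerRegion :=
  fun x (hx : 1 < ‖x‖) => (hx.le : 1 ≤ ‖x‖)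

lemma contDiffOn_coord : ContDiffOn ℝ ∞ Sig.coord (outside 1) := by
  intro x hx
  refine (S.contDiffAt_of_Ψc_comp (Sig.smooth x (outside_subset hx)) ?_).contDiffWithinAt
  filter_upwards [(isOpen_outside 1).mem_nhds hx] with y hy
  exact ⟨Sig.coord_mem hy, Sig.Ψc_coord hy⟩

lemma differentiableAt_coord {x : E3} (hx : x ∈ outside 1) : DifferentiableAt ℝ Sig.coord x :=
  (Sig.contDiffOn_coord.contDiffAt ((isOpen_outside 1).mem_nhds hx)).differentiableAt (by simp)

lemma mfderiv_σ {x : E3} (hx : x ∈ outside 1) (ξ : E3) :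
    (mfderiv (𝓡 3) (𝓡 4) Sig.σ x ξ : E4)
      = mfderiv 𝓘(ℝ, ℝ × E3) (𝓡 4) S.Ψc (Sig.coord x) (fderiv ℝ Sig.coord x ξ) := by
  have h1 : Sig.σ =ᶠ[𝓝 x] S.Ψc ∘ Sig.coord := by
    filter_upwards [(isOpen_outside 1).mem_nhds hx] with y hy
    exact (Sig.Ψc_coord hy).symm
  have h2 : mfderiv 𝓘(ℝ, E3) (𝓡 4) (S.Ψc ∘ Sig.coord) x = _ := mfderiv_comp x
    ((S.Ψc_contMDiffAt (Sig.coord_mem hx)).mdifferentiableAt (by simp))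
    (Sig.differentiableAt_coord hx).mdifferentiableAt
  have h3 := h1.mfderiv_eq (I := 𝓘(ℝ, E3)) (I' := 𝓡 4)
  have h4 := congrArg (fun l : E3 →L[ℝ] E4 => l ξ) h3
  have h5 := congrArg (fun l : E3 →L[ℝ] E4 => l ξ) h2
  refine h4.trans (h5.trans ?_)
  rw [mfderiv_eq_fderiv]
  rfl

/-- The projection of a partial Cauchy surface along the observers of zero angular momentum. -/
def proj (x : E3) : E3 := (Sig.coord x).2

/-- The time coordinate on a partial Cauchy surface. -/
def time (x : E3) : ℝ := (Sig.coord x).1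

lemma coord_eq (x : E3) : Sig.coord x = (Sig.time x, Sig.proj x) := rfl

lemma proj_mem {x : E3} (hx : x ∈ outside 1) : Sig.proj x ∈ outside S.rH := Sig.coord_mem hx

lemma contDiffOn_proj : ContDiffOn ℝ ∞ Sig.proj (outside 1) :=
  contDiff_snd.comp_contDiffOn Sig.contDiffOn_coord

lemma contDiffOn_time : ContDiffOn ℝ ∞ Sig.time (outside 1) :=
  contDiff_fst.comp_contDiffOn Sig.contDiffOn_coord

/-- Corotation preserves the radius, so the asymptotic clause for the surface carries over to the
projection. Together with `proj_boundary` this is the properness used in `image_proj`. -/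
lemma proj_infinity (R : ℝ) : ∃ L : ℝ, ∀ x ∈ outside 1, L < ‖x‖ → R < ‖Sig.proj x‖ := by
  obtain ⟨L, hL⟩ := Sig.infinity R
  refine ⟨L, fun x hx hxL => ?_⟩
  have h := hL x hxL (corot S.w 1 (Sig.coord x)) (corot_mem _ _ (Sig.coord_mem hx)) (Sig.Ψc_coord hx)
  rwa [norm_corot] at h

lemma proj_boundary {x₀ : E3} (hx₀ : ‖x₀‖ = 1) {r : ℝ} (hr : S.rH < r) :
    ∀ᶠ x in 𝓝 x₀, x ∈ outside 1 → ‖Sig.proj x‖ < r := by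
  have hc : ContinuousAt Sig.σ x₀ := (Sig.smooth x₀ hx₀.ge).continuousAt
  filter_upwards [hc.eventually (S.H_radius _ (Sig.boundary x₀ hx₀) r hr)] with x h hx
  have h' := h (corot S.w 1 (Sig.coord x)) (corot_mem _ _ (Sig.coord_mem hx)) (Sig.Ψc_coord hx)
  rwa [norm_corot] at h'

/-- An achronal surface meets each observer of zero angular momentum once. -/
lemma injOn_proj : InjOn Sig.proj (outside 1) := by
  have key : ∀ x ∈ outside 1, ∀ y ∈ outside 1, Sig.proj x = Sig.proj y →
      ¬ Sig.time x < Sig.time y := by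
    intro x hx y hy h hlt
    have hmem (s : ℝ) : ((s, Sig.proj x) : ℝ × E3) ∈ exterior S.rH := Sig.proj_mem hx
    -- Two points with the same projection and different times would be joined by a segment of an
    -- observer's worldline, which is timelike.
    refine Sig.achronal (fun s => S.Ψc (s, Sig.proj x)) (Sig.time x) (Sig.time y) hlt
      (fun s _ => ⟨?_, ?_⟩) ⟨⟨x, outside_subset hx, ?_⟩, ⟨y, outside_subset hy, ?_⟩⟩
    · exact ContMDiffAt.comp (g := S.Ψc) (f := fun s : ℝ => ((s, Sig.proj x) : ℝ × E3)) s
        (S.Ψc_contMDiffAt (hmem s))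
        (contDiff_id.prodMk contDiff_const : ContDiff ℝ ∞ _).contDiffAt.contMDiffAt
    · have hd : HasFDerivAt (fun s : ℝ => ((s, Sig.proj x) : ℝ × E3))
          ((ContinuousLinearMap.id ℝ ℝ).prod 0) s :=
        (hasFDerivAt_id s).prodMk (hasFDerivAt_const _ s)
      have h2 : mfderiv 𝓘(ℝ, ℝ) (𝓡 4) (S.Ψc ∘ fun s : ℝ => ((s, Sig.proj x) : ℝ × E3)) s = _ :=
        mfderiv_comp s ((S.Ψc_contMDiffAt (hmem s)).mdifferentiableAt (by simp))
          hd.differentiableAt.mdifferentiableAt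
      have h5 := congrArg (fun l : ℝ →L[ℝ] E4 => l (1 : ℝ)) h2
      have h6 : (mfderiv 𝓘(ℝ, ℝ) (𝓡 4) (fun s : ℝ => S.Ψc (s, Sig.proj x)) s (1 : ℝ) : E4)
          = mfderiv 𝓘(ℝ, ℝ × E3) (𝓡 4) S.Ψc (s, Sig.proj x) ((1 : ℝ), (0 : E3)) := by
        refine h5.trans ?_
        rw [mfderiv_eq_fderiv, hd.fderiv]
        rfl
      have h7 := S.inner_time (hmem s) 1
      have hN := S.N_onE3_pos (Sig.proj_mem hx)
      have h8 : S.g.inner (S.Ψc (s, Sig.proj x))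
        (mfderiv 𝓘(ℝ, ℝ) (𝓡 4) (fun s : ℝ => S.Ψc (s, Sig.proj x)) s (1 : ℝ))
        (mfderiv 𝓘(ℝ, ℝ) (𝓡 4) (fun s : ℝ => S.Ψc (s, Sig.proj x)) s (1 : ℝ)) =
        S.g.inner (S.Ψc (s, Sig.proj x))
        (mfderiv 𝓘(ℝ, ℝ × E3) (𝓡 4) S.Ψc (s, Sig.proj x) ((1 : ℝ), (0 : E3)))
        (mfderiv 𝓘(ℝ, ℝ × E3) (𝓡 4) S.Ψc (s, Sig.proj x) ((1 : ℝ), (0 : E3))) :=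
        congrArg (fun e : E4 => S.g.inner (S.Ψc (s, Sig.proj x)) e e) h6
      refine (h8.trans h7).trans_lt ?_
      simpa using pow_pos hN 2
    · exact (Sig.Ψc_coord hx).symm
    · rw [h]; exact (Sig.Ψc_coord hy).symm
  intro x hx y hy h
  have ht : Sig.time x = Sig.time y :=
    le_antisymm (not_lt.1 (key y hy x hx h.symm)) (not_lt.1 (key x hx y hy h))
  refine Sig.inj (outside_subset hx) (outside_subset hy) ?_
  rw [← Sig.Ψc_coord hx, ← Sig.Ψc_coord hy, Sig.coord_eq, Sig.coord_eq, ht, h]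

/-- A tangent vector killed by the projection points along an observer's worldline, so its norm is
at most zero, against spacelikeness. -/
lemma fderiv_proj_injective {x : E3} (hx : x ∈ outside 1) {ξ : E3}
    (h : fderiv ℝ Sig.proj x ξ = 0) : ξ = 0 := by
  by_contra hξ
  have h1 := Sig.spacelike x (outside_subset hx) ξ hξ
  have h2 : fderiv ℝ Sig.proj x = (ContinuousLinearMap.snd ℝ ℝ E3).comp (fderiv ℝ Sig.coord x) :=
    ((ContinuousLinearMap.snd ℝ ℝ E3).hasFDerivAt.comp x
      (Sig.differentiableAt_coord hx).hasFDerivAt).fderiv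
  have h3 : fderiv ℝ Sig.coord x ξ = ((fderiv ℝ Sig.coord x ξ).1, (0 : E3)) := by
    refine Prod.ext rfl ?_
    rw [h2] at h; exact h
  have h4 := S.inner_time (Sig.coord_mem hx) (fderiv ℝ Sig.coord x ξ).1
  rw [← h3] at h4
  have h5 := Sig.mfderiv_σ hx ξ
  have h6 : S.g.inner (Sig.σ x) (mfderiv (𝓡 3) (𝓡 4) Sig.σ x ξ) (mfderiv (𝓡 3) (𝓡 4) Sig.σ x ξ)
      = S.g.inner (S.Ψc (Sig.coord x))
        (mfderiv 𝓘(ℝ, ℝ × E3) (𝓡 4) S.Ψc (Sig.coord x) (fderiv ℝ Sig.coord x ξ))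
        (mfderiv 𝓘(ℝ, ℝ × E3) (𝓡 4) S.Ψc (Sig.coord x) (fderiv ℝ Sig.coord x ξ)) := by
    have e1 := congrArg (fun e : E4 => S.g.inner (Sig.σ x) e e) h5
    refine e1.trans ?_
    have : ∀ p : M, p = Sig.σ x → ∀ e : E4, S.g.inner (Sig.σ x) e e = S.g.inner p e e := by
      rintro _ rfl e; rfl
    exact this _ (Sig.Ψc_coord hx) _
  rw [h6, h4] at h1
  nlinarith [sq_nonneg (onE3 S.N (Sig.coord x).2 * (fderiv ℝ Sig.coord x ξ).1)]

/-- The projection of a partial Cauchy surface covers the exterior region. -/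
lemma image_proj : Sig.proj '' outside 1 = outside S.rH := by
  have hsub : Sig.proj '' outside 1 ⊆ outside S.rH := by
    rintro _ ⟨x, hx, rfl⟩; exact Sig.proj_mem hx
  have hopen : IsOpen (Sig.proj '' outside 1) := by
    rw [isOpen_iff_mem_nhds]
    rintro _ ⟨x, hx, rfl⟩
    exact (contDiffAt_invFunOn (isOpen_outside 1) Sig.contDiffOn_proj Sig.injOn_proj hx
      (fun v hv => Sig.fderiv_proj_injective hx hv)).2
  refine Subset.antisymm hsub ?_
  have hne : (outside 1).Nonempty :=
    ⟨EuclideanSpace.single 0 2, by change (1 : ℝ) < ‖EuclideanSpace.single (0 : Fin 3) (2 : ℝ)‖; simp⟩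
  -- The image is open and nonempty; being also relatively closed, it fills the connected target.
  refine (isPreconnected_outside S.rH_nonneg).subset_of_closure_inter_subset hopen ?_ ?_
  · obtain ⟨x, hx⟩ := hne
    exact ⟨Sig.proj x, Sig.proj_mem hx, mem_image_of_mem _ hx⟩
  · rintro y ⟨hy, hyH⟩
    obtain ⟨u, hu, hlim⟩ := mem_closure_iff_seq_limit.1 hy
    choose x hx hxu using hu
    have hyH' : S.rH < ‖y‖ := hyH
    have hn : Tendsto (fun n => ‖Sig.proj (x n)‖) atTop (𝓝 ‖y‖) := by simpa [hxu] using hlim.norm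
    obtain ⟨L, hL⟩ := Sig.proj_infinity (‖y‖ + 1)
    have hb : ∀ᶠ n in atTop, x n ∈ Metric.closedBall (0 : E3) L := by
      filter_upwards [hn.eventually_lt_const (lt_add_one ‖y‖)] with n h
      rw [mem_closedBall_zero_iff]
      by_contra hcon
      exact absurd (hL _ (hx n) (not_le.1 hcon)) (not_lt.2 h.le)
    -- The radii of the images stay bounded, so the parameters stay in a ball and subconverge.
    obtain ⟨a, -, φ, hφ, ha⟩ := (isCompact_closedBall (0 : E3) L).tendsto_subseq' hb.frequently
    have hnφ := hn.comp hφ.tendsto_atTop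
    have ha1 : 1 ≤ ‖a‖ := ge_of_tendsto' ha.norm (fun n => le_of_lt (hx (φ n)))
    -- A limit on the unit sphere would push the radii below any r > r_H, although they converge to
    -- ‖y‖ > r_H.
    rcases ha1.eq_or_lt with h1 | h1
    · exfalso
      obtain ⟨r, hr1, hr2⟩ := exists_between hyH'
      have e1 := ha.eventually (Sig.proj_boundary h1.symm hr1)
      have e2 := hnφ.eventually_const_lt hr2
      obtain ⟨n, h3, h4⟩ := (e1.and e2).exists
      exact absurd (h3 (hx _)) (not_lt.2 (le_of_lt h4))
    · refine ⟨a, h1, ?_⟩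
      have hc : ContinuousAt Sig.proj a :=
        (Sig.contDiffOn_proj.contDiffAt ((isOpen_outside 1).mem_nhds h1)).continuousAt
      have e1 := hc.tendsto.comp ha
      have e2 : Tendsto (Sig.proj ∘ x ∘ φ) atTop (𝓝 y) := by
        have := hlim.comp hφ.tendsto_atTop
        simpa [Function.comp_def, hxu] using this
      exact tendsto_nhds_unique e1 e2

/-- The inverse of the projection. -/
def lift (y : E3) : E3 := Function.invFunOn Sig.proj (outside 1) y

lemma exists_proj {y : E3} (hy : y ∈ outside S.rH) : ∃ x ∈ outside 1, Sig.proj x = y := by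
  rw [← Sig.image_proj] at hy; exact hy

lemma lift_mem {y : E3} (hy : y ∈ outside S.rH) : Sig.lift y ∈ outside 1 :=
  Function.invFunOn_mem (Sig.exists_proj hy)

lemma proj_lift {y : E3} (hy : y ∈ outside S.rH) : Sig.proj (Sig.lift y) = y :=
  Function.invFunOn_eq (Sig.exists_proj hy)

lemma lift_proj {x : E3} (hx : x ∈ outside 1) : Sig.lift (Sig.proj x) = x :=
  Sig.injOn_proj (Sig.lift_mem (Sig.proj_mem hx)) hx (Sig.proj_lift (Sig.proj_mem hx))

lemma contDiffOn_lift : ContDiffOn ℝ ∞ Sig.lift (outside S.rH) := by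
  intro y hy
  obtain ⟨x, hx, rfl⟩ := Sig.exists_proj hy
  exact (contDiffAt_invFunOn (isOpen_outside 1) Sig.contDiffOn_proj Sig.injOn_proj hx
    (fun v hv => Sig.fderiv_proj_injective hx hv)).1.contDiffWithinAt

end PartialCauchySurface

end Projection

/-! ### Gram determinants and fluxes through hyperplanes. -/

section LinearAlgebra

/-- The bilinear form of a matrix. -/
def bil (G : Matrix (Fin 4) (Fin 4) ℝ) (u v : Fin 4 → ℝ) : ℝ := u ⬝ᵥ (G *ᵥ v)

/-- The matrix with rows `Y, e₀, e₁, e₂`. -/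
def frame (Y : Fin 4 → ℝ) (e : Fin 3 → Fin 4 → ℝ) : Matrix (Fin 4) (Fin 4) ℝ :=
  Matrix.of (Fin.cons Y e : Fin 4 → Fin 4 → ℝ)

/-- The Gram matrix of three vectors. -/
def gram3 (G : Matrix (Fin 4) (Fin 4) ℝ) (e : Fin 3 → Fin 4 → ℝ) : Matrix (Fin 3) (Fin 3) ℝ :=
  Matrix.of fun i j => bil G (e i) (e j)

lemma frame_mul_mul_apply (G : Matrix (Fin 4) (Fin 4) ℝ) (Y ν : Fin 4 → ℝ) (e : Fin 3 → Fin 4 → ℝ)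
    (i j : Fin 4) : (frame Y e * G * (frame ν e)ᵀ) i j
      = bil G ((Fin.cons Y e : Fin 4 → Fin 4 → ℝ) i) ((Fin.cons ν e : Fin 4 → Fin 4 → ℝ) j) := by
  rw [Matrix.mul_assoc, Matrix.mul_apply]
  simp only [bil, dotProduct, Matrix.mulVec, Matrix.mul_apply, frame, Matrix.transpose_apply,
    Matrix.of_apply]

/-- Gram determinants with respect to a unit normal `ν` of the vectors `e`. -/
lemma det_frame_mul (G : Matrix (Fin 4) (Fin 4) ℝ) (Y ν : Fin 4 → ℝ) (e : Fin 3 → Fin 4 → ℝ)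
    (hν : ∀ i, bil G (e i) ν = 0) :
    (frame Y e).det * G.det * (frame ν e).det = bil G Y ν * (gram3 G e).det := by
  have h : (frame Y e * G * (frame ν e)ᵀ).det = bil G Y ν * (gram3 G e).det := by
    -- Since `ν` is normal to the `e i`, the first column of the product is G(Y, ν), 0, 0, 0, and
    -- the complementary minor is the Gram matrix.
    rw [Matrix.det_succ_column_zero, Fin.sum_univ_succ, Finset.sum_eq_zero]
    · rw [frame_mul_mul_apply]
      simp only [Fin.val_zero, pow_zero, one_mul, Fin.cons_zero, add_zero]
      congr 2
      ext i j
      rw [Matrix.submatrix_apply, frame_mul_mul_apply]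
      simp [gram3]
    · intro i _
      rw [frame_mul_mul_apply]
      simp [hν]
  rw [← h, Matrix.det_mul, Matrix.det_mul, Matrix.det_transpose]

/-- This is `det_frame_mul` applied to three vectors. With `ν` itself it gives the Gram determinant
as (D d)², where d is the frame determinant of `ν`. The reference vector `u` fixes the sign d > 0,
so the root is D d. With `Y` it then gives the flux. It is `u` that encodes the future orientation
of the normal. -/
lemma density_of_frame {G : Matrix (Fin 4) (Fin 4) ℝ} {u ν : Fin 4 → ℝ} {e : Fin 3 → Fin 4 → ℝ}
    {D : ℝ} (hD : 0 < D) (hG : G.det = -D ^ 2) (hν : ∀ i, bil G (e i) ν = 0)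
    (hνν : bil G ν ν = -1) (hu : (frame u e).det = 1) (huν : bil G u ν < 0)
    (hpos : 0 < (gram3 G e).det) (Y : Fin 4 → ℝ) :
    -bil G Y ν * √(gram3 G e).det = D * (frame Y e).det := by
  have h1 := det_frame_mul G Y ν e hν
  have h2 := det_frame_mul G u ν e hν
  have h3 := det_frame_mul G ν ν e hν
  rw [hu, hG] at h2
  rw [hνν, hG] at h3
  rw [hG] at h1
  set d := (frame ν e).det
  set H := (gram3 G e).det
  set c := bil G u ν
  have hd : d ≠ 0 := by rintro h; rw [h] at h3; simp at h3; exact hpos.ne' h3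
  have hD2 : D ^ 2 ≠ 0 := by positivity
  have hcd : c * d = -1 := by
    have : D ^ 2 * d * (c * d + 1) = 0 := by linear_combination -c * h3 - h2
    rcases mul_eq_zero.1 this with h | h
    · exact absurd h (mul_ne_zero hD2 hd)
    · linarith
  have hH : H = (D * d) ^ 2 := by linear_combination h3
  have hd0 : 0 < d := by nlinarith
  have hs : √H = D * d := by rw [hH]; exact Real.sqrt_sq (by positivity)
  have hy : bil G Y ν * (D * d) = -(D * (frame Y e).det) := by
    have h5 : D * d * (bil G Y ν * (D * d) + D * (frame Y e).det) = 0 := by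
      rw [hH] at h1; linear_combination -h1
    rcases mul_eq_zero.1 h5 with h | h
    · exact absurd h (mul_ne_zero hD.ne' hd)
    · linarith
  rw [hs]; linarith

lemma bil_comm {G : Matrix (Fin 4) (Fin 4) ℝ} (hG : Gᵀ = G) (u v : Fin 4 → ℝ) :
    bil G u v = bil G v u := by
  rw [bil, bil, Matrix.dotProduct_mulVec, ← Matrix.mulVec_transpose, hG, dotProduct_comm]

/-- The volume density `√|det g|` of the Hartle–Thorne line element. -/
def htDensity (N A B : ℝ → ℝ → ℝ) (x : Fin 4 → ℝ) : ℝ :=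
  N (x 1) (x 2) * A (x 1) (x 2) * (x 1 * B (x 1) (x 2)) ^ 2 * Real.sin (x 2)

lemma hartleThorne_transpose (N A B w : ℝ → ℝ → ℝ) (x : Fin 4 → ℝ) :
    (hartleThorne N A B w x)ᵀ = hartleThorne N A B w x := by
  ext i j; fin_cases i <;> fin_cases j <;> simp [hartleThorne]

lemma hartleThorne_det (N A B w : ℝ → ℝ → ℝ) (x : Fin 4 → ℝ) :
    (hartleThorne N A B w x).det = -htDensity N A B x ^ 2 := by
  simp [hartleThorne, htDensity, Matrix.det_succ_row_zero, Fin.sum_univ_succ, Fin.succAbove]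
  ring

lemma bil_hartleThorne (N A B w : ℝ → ℝ → ℝ) (x u v : Fin 4 → ℝ) :
    bil (hartleThorne N A B w x) u v = -N (x 1) (x 2) ^ 2 * u 0 * v 0
      + A (x 1) (x 2) ^ 2 * u 1 * v 1 + (x 1 * B (x 1) (x 2)) ^ 2 * u 2 * v 2
      + (x 1 * B (x 1) (x 2) * Real.sin (x 2)) ^ 2 * (u 3 - w (x 1) (x 2) * u 0)
        * (v 3 - w (x 1) (x 2) * v 0) := by
  simp [bil, hartleThorne, Matrix.mulVec, dotProduct, Fin.sum_univ_four]
  ring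

lemma det_frame_graph (Y a b c : Fin 4 → ℝ) (ha1 : a 1 = 1) (ha2 : a 2 = 0) (hb1 : b 1 = 0)
    (hb2 : b 2 = 1) (hc1 : c 1 = 0) (hc2 : c 2 = 0) :
    (frame Y ![a, b, c]).det = (Y 0 - Y 1 * a 0 - Y 2 * b 0) * c 3
      - (Y 3 - Y 1 * a 3 - Y 2 * b 3) * c 0 := by
  have : frame Y ![a, b, c] = !![Y 0, Y 1, Y 2, Y 3; a 0, 1, 0, a 3; b 0, 0, 1, b 3;
      c 0, 0, 0, c 3] := by
    ext i j
    fin_cases i <;> fin_cases j <;> simp [frame, *]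
  rw [this]
  simp [Matrix.det_succ_row_zero, Fin.sum_univ_succ, Fin.succAbove]
  ring

end LinearAlgebra

/-! ### Spherical coordinates on the surface. -/

section SphericalChart

/-- The coordinate partial derivative `∂_i f` on coordinate three-space. -/
def pd (i : Fin 3) (f : (Fin 3 → ℝ) → ℝ) (z : Fin 3 → ℝ) : ℝ := fderiv ℝ f z (Pi.single i 1)

/-- The domain of the coordinates `(r, θ, φ)`; the angles are arbitrary real numbers. -/
def zdom (rH : ℝ) : Set (Fin 3 → ℝ) := {z | rH < z 0}

lemma isOpen_zdom (rH : ℝ) : IsOpen (zdom rH) := isOpen_lt continuous_const (continuous_apply 0)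

/-- Spherical coordinates. -/
def sphz (z : Fin 3 → ℝ) : E3 := sph (z 0) (z 1) (z 2)

/-- A function of `(r, θ)`, extended to arbitrary real `θ`. -/
def hat (f : ℝ → ℝ → ℝ) (z : Fin 3 → ℝ) : ℝ := onE3 f (sphz z)

lemma contDiff_sphz : ContDiff ℝ ∞ sphz := by
  have h : ContDiff ℝ ∞ (fun z : Fin 3 → ℝ => (z 0, z 1, z 2)) := by fun_prop
  exact contDiffOn_univ.1 ((contDiff_sph.comp_contDiffOn h.contDiffOn).congr fun z _ => rfl)

lemma sphz_mem {rH : ℝ} (h0 : 0 ≤ rH) {z : Fin 3 → ℝ} (hz : z ∈ zdom rH) : sphz z ∈ outside rH := by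
  have hz' : rH < z 0 := hz
  change rH < ‖sph _ _ _‖
  rwa [norm_sph (h0.trans hz'.le)]

lemma contDiffOn_hat {rH : ℝ} (h0 : 0 ≤ rH) {f : ℝ → ℝ → ℝ} (hf : SmoothExterior rH f) :
    ContDiffOn ℝ ∞ (hat f) (zdom rH) :=
  (contDiffOn_onE3 hf).comp contDiff_sphz.contDiffOn (fun _ hz => sphz_mem h0 hz)

lemma hat_eq (f : ℝ → ℝ → ℝ) {z : Fin 3 → ℝ} (h0 : 0 < z 0) (h1 : z 1 ∈ Icc 0 Real.pi) :
    hat f z = f (z 0) (z 1) := onE3_sph f h0 h1 _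

lemma sphz_add (z : Fin 3 → ℝ) (c : ℝ) : sphz (z + c • Pi.single 2 1) = rotZ c (sphz z) := by
  rw [sphz, sphz, rotZ_sph]; simp

lemma hat_add (f : ℝ → ℝ → ℝ) (z : Fin 3 → ℝ) (c : ℝ) :
    hat f (z + c • Pi.single 2 1) = hat f z := by
  rw [hat, hat, sphz_add, onE3_rotZ]

lemma pd_two_of_invariant {f : (Fin 3 → ℝ) → ℝ} {z : Fin 3 → ℝ}
    (hinv : ∀ (z : Fin 3 → ℝ) (c : ℝ), f (z + c • Pi.single 2 1) = f z)
    (hf : DifferentiableAt ℝ f z) : pd 2 f z = 0 := by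
  have h := hf.hasFDerivAt.hasLineDerivAt (Pi.single (2 : Fin 3) (1 : ℝ))
  have h2 : HasDerivAt (fun t : ℝ => f (z + t • Pi.single 2 1)) 0 0 := by
    simp only [hinv]; exact hasDerivAt_const _ _
  exact HasDerivAt.unique h h2

lemma pd_two_hat {f : ℝ → ℝ → ℝ} {z : Fin 3 → ℝ} (hf : DifferentiableAt ℝ (hat f) z) :
    pd 2 (hat f) z = 0 := pd_two_of_invariant (hat_add f) hf

variable {M : Type*} [TopologicalSpace M] [ChartedSpace E4 M] [IsManifold (𝓡 4) ∞ M]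

/-- The metric as a bilinear form on the model space. -/
def LorentzMetric.form (g : LorentzMetric M) (p : M) : E4 →L[ℝ] E4 →L[ℝ] ℝ := g.inner p

lemma LorentzMetric.form_symm (g : LorentzMetric M) (p : M) (a b : E4) :
    g.form p a b = g.form p b a := g.symm p a b

/-- The differential of a function on a spacetime as a covector on the model space. -/
def dE (Φ : M → ℝ) (p : M) : E4 →L[ℝ] ℝ := mfderiv (𝓡 4) 𝓘(ℝ, ℝ) Φ p

/-- The horizon generator with values in the model space. -/
def CircularBlackHole.XE (S : CircularBlackHole M) (p : M) : E4 := S.X p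

/-- The differential of the coordinates `(t, r, θ, φ)`. -/
def CircularBlackHole.L (S : CircularBlackHole M) (x : Fin 4 → ℝ) : (Fin 4 → ℝ) →L[ℝ] E4 :=
  mfderiv 𝓘(ℝ, Fin 4 → ℝ) (𝓡 4) (fun z => S.Ψ (polar z)) x

lemma CircularBlackHole.form_L (S : CircularBlackHole M) {x : Fin 4 → ℝ}
    (hx : x ∈ polarExterior S.rH) (u v : Fin 4 → ℝ) :
    S.g.form (S.Ψ (polar x)) (S.L x u) (S.L x v) = bil (hartleThorne S.N S.A S.B S.w x) u v :=
  S.Ψ_metric x hx u v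

lemma CircularBlackHole.XE_eq (S : CircularBlackHole M) {x : Fin 4 → ℝ}
    (hx : x ∈ polarExterior S.rH) : S.XE (S.Ψ (polar x)) = S.L x ![1, 0, 0, S.Ω] := by
  have h : (![1, 0, 0, S.Ω] : Fin 4 → ℝ) = Pi.single 0 1 + S.Ω • Pi.single 3 1 := by
    ext i; fin_cases i <;> simp
  rw [h, map_add, map_smul]
  have h1 : (S.killT (S.Ψ (polar x)) : E4) = S.L x (Pi.single 0 1) := (S.killT_eq x hx).symm
  have h2 : (S.killφ (S.Ψ (polar x)) : E4) = S.L x (Pi.single 3 1) := (S.killφ_eq x hx).symm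
  rw [← h1, ← h2]
  rfl

lemma CircularBlackHole.Ψpolar_mdifferentiableAt (S : CircularBlackHole M) {x : Fin 4 → ℝ}
    (hx : S.rH < x 1) :
    MDifferentiableAt 𝓘(ℝ, Fin 4 → ℝ) (𝓡 4) (fun z => S.Ψ (polar z)) x :=
  MDifferentiableAt.comp (g := S.Ψ) x
    ((S.Ψ_contMDiffAt (S.polar_mem_exterior hx)).mdifferentiableAt (by simp))
    (contDiff_polar.differentiable (by simp) x).mdifferentiableAt

lemma isOpen_polarExterior (rH : ℝ) : IsOpen (polarExterior rH) :=
  (isOpen_lt continuous_const (continuous_apply 1)).inter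
    (isOpen_Ioo.preimage (continuous_apply 2))

lemma CircularBlackHole.dE_L (S : CircularBlackHole M) {Φ : M → ℝ}
    (hΦ : ContMDiff (𝓡 4) 𝓘(ℝ, ℝ) ∞ Φ) {Φc : ℝ → ℝ → ℝ}
    (hΦc : ∀ x : Fin 4 → ℝ, S.rH < x 1 → x 2 ∈ Icc 0 Real.pi →
      Φ (S.Ψ (polar x)) = Φc (x 1) (x 2)) {x : Fin 4 → ℝ}
    (hx : x ∈ polarExterior S.rH) (v : Fin 4 → ℝ) :
    dE Φ (S.Ψ (polar x)) (S.L x v) = fderiv ℝ (fun z => Φc (z 1) (z 2)) x v := by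
  have h1 : (fun z : Fin 4 → ℝ => Φc (z 1) (z 2)) =ᶠ[𝓝 x] Φ ∘ fun z => S.Ψ (polar z) := by
    filter_upwards [(isOpen_polarExterior S.rH).mem_nhds hx] with z hz
    exact (hΦc z hz.1 ⟨hz.2.1.le, hz.2.2.le⟩).symm
  rw [h1.fderiv_eq, ← mfderiv_eq_fderiv]
  have h2 := mfderiv_comp x (hΦ.mdifferentiable (by simp) (S.Ψ (polar x)))
    (S.Ψpolar_mdifferentiableAt hx.1)
  exact (congrArg (fun l : (Fin 4 → ℝ) →L[ℝ] ℝ => l v) h2).symm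

namespace PartialCauchySurface

variable {S : CircularBlackHole M} (Sig : PartialCauchySurface S)

/-- Spherical coordinates on a partial Cauchy surface that corotate with the observers of zero
angular momentum. -/
def K (z : Fin 3 → ℝ) : E3 := Sig.lift (sphz z)

/-- The time coordinate on a partial Cauchy surface as a function of spherical coordinates. -/
def T (z : Fin 3 → ℝ) : ℝ := Sig.time (Sig.K z)

/-- The Hartle–Thorne coordinates on a partial Cauchy surface. -/
def chart (z : Fin 3 → ℝ) : Fin 4 → ℝ := ![Sig.T z, z 0, z 1, z 2 + hat S.w z * Sig.T z]

lemma K_mem {z : Fin 3 → ℝ} (hz : z ∈ zdom S.rH) : Sig.K z ∈ outside 1 :=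
  Sig.lift_mem (sphz_mem S.rH_nonneg hz)

lemma proj_K {z : Fin 3 → ℝ} (hz : z ∈ zdom S.rH) : Sig.proj (Sig.K z) = sphz z :=
  Sig.proj_lift (sphz_mem S.rH_nonneg hz)

lemma contDiffOn_K : ContDiffOn ℝ ∞ Sig.K (zdom S.rH) :=
  Sig.contDiffOn_lift.comp contDiff_sphz.contDiffOn (fun _ hz => sphz_mem S.rH_nonneg hz)

lemma contDiffOn_T : ContDiffOn ℝ ∞ Sig.T (zdom S.rH) :=
  Sig.contDiffOn_time.comp Sig.contDiffOn_K (fun _ hz => Sig.K_mem hz)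

lemma differentiableAt_K {z : Fin 3 → ℝ} (hz : z ∈ zdom S.rH) : DifferentiableAt ℝ Sig.K z :=
  (Sig.contDiffOn_K.contDiffAt ((isOpen_zdom _).mem_nhds hz)).differentiableAt (by simp)

lemma differentiableAt_T {z : Fin 3 → ℝ} (hz : z ∈ zdom S.rH) : DifferentiableAt ℝ Sig.T z :=
  (Sig.contDiffOn_T.contDiffAt ((isOpen_zdom _).mem_nhds hz)).differentiableAt (by simp)

lemma σ_K {z : Fin 3 → ℝ} (hz : z ∈ zdom S.rH) : Sig.σ (Sig.K z) = S.Ψ (polar (Sig.chart z)) := by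
  rw [← Sig.Ψc_coord (Sig.K_mem hz), CircularBlackHole.Ψc, corot, Sig.coord_eq, Sig.proj_K hz]
  congr 1
  refine Prod.ext rfl ?_
  change rotZ (1 * (onE3 S.w (sphz z) * Sig.T z)) (sphz z) = sph _ _ _
  -- Returning from corotating coordinates shifts the azimuth by ω T, which is the last entry of
  -- `chart`.
  rw [sphz, rotZ_sph]
  simp [chart, hat, sphz]

lemma chart_mem {z : Fin 3 → ℝ} (hz : z ∈ zdom S.rH) (h1 : z 1 ∈ Ioo 0 Real.pi) :
    Sig.chart z ∈ polarExterior S.rH := ⟨hz, h1⟩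

/-- The coordinate vector fields on a partial Cauchy surface. -/
def tangent (z : Fin 3 → ℝ) (i : Fin 3) : Fin 4 → ℝ :=
  ![pd i Sig.T z, (Pi.single i 1 : Fin 3 → ℝ) 0, (Pi.single i 1 : Fin 3 → ℝ) 1,
    (Pi.single i 1 : Fin 3 → ℝ) 2 + (hat S.w z * pd i Sig.T z + Sig.T z * pd i (hat S.w) z)]

lemma differentiableAt_hat {f : ℝ → ℝ → ℝ} (hf : SmoothExterior S.rH f) {z : Fin 3 → ℝ}
    (hz : z ∈ zdom S.rH) : DifferentiableAt ℝ (hat f) z :=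
  ((contDiffOn_hat S.rH_nonneg hf).contDiffAt
    ((isOpen_zdom _).mem_nhds hz)).differentiableAt (by simp)

lemma hasFDerivAt_chart {z : Fin 3 → ℝ} (hz : z ∈ zdom S.rH) :
    ∃ D : (Fin 3 → ℝ) →L[ℝ] (Fin 4 → ℝ), HasFDerivAt Sig.chart D z ∧
      ∀ i, D (Pi.single i 1) = Sig.tangent z i := by
  have hT := (Sig.differentiableAt_T hz).hasFDerivAt
  have hw := (differentiableAt_hat S.w_smooth hz).hasFDerivAt
  have hp (i : Fin 3) : HasFDerivAt (fun x : Fin 3 → ℝ => x i)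
      (ContinuousLinearMap.proj (R := ℝ) (φ := fun _ : Fin 3 => ℝ) i) z :=
    (ContinuousLinearMap.proj (R := ℝ) (φ := fun _ : Fin 3 => ℝ) i).hasFDerivAt
  refine ⟨ContinuousLinearMap.pi ![fderiv ℝ Sig.T z,
    ContinuousLinearMap.proj (R := ℝ) (φ := fun _ : Fin 3 => ℝ) 0,
    ContinuousLinearMap.proj (R := ℝ) (φ := fun _ : Fin 3 => ℝ) 1,
    ContinuousLinearMap.proj (R := ℝ) (φ := fun _ : Fin 3 => ℝ) 2
      + (hat S.w z • fderiv ℝ Sig.T z + Sig.T z • fderiv ℝ (hat S.w) z)], ?_, ?_⟩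
  · rw [hasFDerivAt_pi]
    intro i
    fin_cases i
    · exact hT
    · exact hp 0
    · exact hp 1
    · exact (hp 2).add (hw.mul hT)
  · intro i
    ext j
    fin_cases j <;> simp [tangent, pd]

/-- The differential of the embedding with values in the model space. -/
def dσ (x : E3) : E3 →L[ℝ] E4 := mfderiv (𝓡 3) (𝓡 4) Sig.σ x

/-- The unit normal with values in the model space. -/
def nE (x : E3) : E4 := Sig.n x

/-- The parametrised surface and its Hartle–Thorne description are one map factored in two ways; the
chain rule along both factorisations gives the identity. -/
lemma dσ_K {z : Fin 3 → ℝ} (hz : z ∈ zdom S.rH) (i : Fin 3) :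
    Sig.dσ (Sig.K z) (fderiv ℝ Sig.K z (Pi.single i 1)) = S.L (Sig.chart z) (Sig.tangent z i) := by
  obtain ⟨D, hD, hDi⟩ := Sig.hasFDerivAt_chart hz
  have h0 : Sig.σ ∘ Sig.K =ᶠ[𝓝 z] (fun x => S.Ψ (polar x)) ∘ Sig.chart := by
    filter_upwards [(isOpen_zdom _).mem_nhds hz] with y hy
    exact Sig.σ_K hy
  have h1 := mfderiv_comp z (g := Sig.σ) (f := Sig.K) (I := 𝓘(ℝ, Fin 3 → ℝ)) (I' := 𝓡 3) (I'' := 𝓡 4)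
    ((Sig.smooth _ (outside_subset (Sig.K_mem hz))).mdifferentiableAt (by simp))
    (Sig.differentiableAt_K hz).mdifferentiableAt
  have h2 := mfderiv_comp z (g := fun x => S.Ψ (polar x)) (f := Sig.chart)
    (I := 𝓘(ℝ, Fin 3 → ℝ)) (I' := 𝓘(ℝ, Fin 4 → ℝ)) (I'' := 𝓡 4)
    (S.Ψpolar_mdifferentiableAt (show S.rH < Sig.chart z 1 from hz))
    hD.differentiableAt.mdifferentiableAt
  have h3 := h0.mfderiv_eq (I := 𝓘(ℝ, Fin 3 → ℝ)) (I' := 𝓡 4)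
  have k := fun (l l' : (Fin 3 → ℝ) →L[ℝ] E4) (h : l = l') =>
    congrArg (fun l : (Fin 3 → ℝ) →L[ℝ] E4 => l (Pi.single i 1)) h
  have k1 := k _ _ h1
  have k2 := k _ _ h2
  have k3 := k _ _ h3
  rw [← hDi, ← hD.fderiv]
  refine Eq.trans ?_ (k1.symm.trans (k3.trans (k2.trans ?_)))
  · rw [mfderiv_eq_fderiv]; rfl
  · rw [mfderiv_eq_fderiv]; rfl

/-- The orientation of the normal is given at some preimage of the point. Injectivity of `Ψ`
identifies this with the chart point, and off the axis every vector has polar components, with the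
time component unchanged. -/
lemma exists_normal {z : Fin 3 → ℝ} (hz : z ∈ zdom S.rH) (h1 : z 1 ∈ Ioo 0 Real.pi) :
    ∃ ν : Fin 4 → ℝ, 0 < ν 0 ∧ Sig.nE (Sig.K z) = S.L (Sig.chart z) ν := by
  obtain ⟨q, hq, w, hqσ, hw, hn⟩ := Sig.n_future (Sig.K z) (Sig.K_mem hz)
  have hx := Sig.chart_mem hz h1
  have hr : 0 < Sig.chart z 1 := S.rH_nonneg.trans_lt hx.1
  have hq' : q = polar (Sig.chart z) :=
    S.Ψ_inj hq (S.polar_mem_exterior hx.1) (hqσ.trans (Sig.σ_K hz))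
  obtain ⟨ν, rfl⟩ := polarD_surjective hr.ne' (Real.sin_pos_of_mem_Ioo hx.2).ne' w
  refine ⟨ν, hw, ?_⟩
  have h3 := S.mfderiv_Ψ_polar hx.1 ν
  refine hn.symm.trans (Eq.trans ?_ h3.symm)
  subst hq'
  rfl

end PartialCauchySurface

end SphericalChart

/-! ### Volume and flux densities of the surface. -/

section Density

lemma fderiv_comp_polar {h : (Fin 3 → ℝ) → ℝ} {z : Fin 3 → ℝ} {x : Fin 4 → ℝ} (hz0 : z 0 = x 1) (hz1 : z 1 = x 2)
    (hd : DifferentiableAt ℝ h z) (v : Fin 4 → ℝ) :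
    fderiv ℝ (fun y : Fin 4 → ℝ => h ![y 1, y 2, z 2]) x v = v 1 * pd 0 h z + v 2 * pd 1 h z := by
  set D : (Fin 4 → ℝ) →L[ℝ] (Fin 3 → ℝ) := ContinuousLinearMap.pi
    ![ContinuousLinearMap.proj (R := ℝ) (φ := fun _ : Fin 4 => ℝ) 1,
      ContinuousLinearMap.proj (R := ℝ) (φ := fun _ : Fin 4 => ℝ) 2, 0] with hDdef
  have hD : HasFDerivAt (fun y : Fin 4 → ℝ => (![y 1, y 2, z 2] : Fin 3 → ℝ)) D x := by
    rw [hasFDerivAt_pi]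
    intro i
    fin_cases i
    · exact (ContinuousLinearMap.proj (R := ℝ) (φ := fun _ : Fin 4 => ℝ) 1).hasFDerivAt
    · exact (ContinuousLinearMap.proj (R := ℝ) (φ := fun _ : Fin 4 => ℝ) 2).hasFDerivAt
    · exact hasFDerivAt_const _ _
  have hzx : z = ![x 1, x 2, z 2] := by
    ext i; fin_cases i
    · exact hz0
    · exact hz1
    · rfl
  have hc : HasFDerivAt (h ∘ fun y : Fin 4 → ℝ => (![y 1, y 2, z 2] : Fin 3 → ℝ))
      ((fderiv ℝ h z).comp D) x :=
    HasFDerivAt.comp x (by rw [← hzx]; exact hd.hasFDerivAt) hD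
  have hv : D v = v 1 • Pi.single 0 1 + v 2 • Pi.single 1 1 := by
    ext i; fin_cases i <;> simp [hDdef]
  have hc' : fderiv ℝ (fun y : Fin 4 → ℝ => h ![y 1, y 2, z 2]) x = (fderiv ℝ h z).comp D := hc.fderiv
  rw [hc', ContinuousLinearMap.comp_apply, hv]
  simp [pd]

lemma pd_hat_of_polar {rH : ℝ} (h0 : 0 ≤ rH) {f : ℝ → ℝ → ℝ} (hf : SmoothExterior rH f)
    {x : Fin 4 → ℝ} (hx : x ∈ polarExterior rH) (z : Fin 3 → ℝ) (hz0 : z 0 = x 1) (hz1 : z 1 = x 2)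
    (v : Fin 4 → ℝ) : fderiv ℝ (fun y : Fin 4 → ℝ => f (y 1) (y 2)) x v
      = v 1 * pd 0 (hat f) z + v 2 * pd 1 (hat f) z := by
  have hz : z ∈ zdom rH := by change rH < z 0; rw [hz0]; exact hx.1
  have hd : DifferentiableAt ℝ (hat f) z := ((contDiffOn_hat h0 hf).contDiffAt
    ((isOpen_zdom _).mem_nhds hz)).differentiableAt (by simp)
  have he : (fun y : Fin 4 → ℝ => f (y 1) (y 2)) =ᶠ[𝓝 x] fun y => hat f ![y 1, y 2, z 2] := by
    filter_upwards [(isOpen_polarExterior rH).mem_nhds hx] with y hy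
    exact (hat_eq f (z := ![y 1, y 2, z 2]) (h0.trans_lt hy.1) ⟨hy.2.1.le, hy.2.2.le⟩).symm
  rw [he.fderiv_eq, fderiv_comp_polar hz0 hz1 hd]

variable {M : Type*} [TopologicalSpace M] [ChartedSpace E4 M] [IsManifold (𝓡 4) ∞ M]

namespace PartialCauchySurface

variable {S : CircularBlackHole M} (Sig : PartialCauchySurface S)

lemma induced_apply (x : E3) (i j : Fin 3) : Sig.induced x i j = S.g.form (Sig.σ x)
    (Sig.dσ x (EuclideanSpace.single i 1)) (Sig.dσ x (EuclideanSpace.single j 1)) := rfl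

lemma E3_eq_sum (ξ : E3) : ξ = ∑ i, ξ i • EuclideanSpace.single i (1 : ℝ) := by
  apply E3_ext <;> simp [Fin.sum_univ_three]

lemma form_dσ (x ξ η : E3) : S.g.form (Sig.σ x) (Sig.dσ x ξ) (Sig.dσ x η)
    = (ξ : Fin 3 → ℝ) ⬝ᵥ (Sig.induced x *ᵥ η) := by
  conv_lhs => rw [E3_eq_sum ξ, E3_eq_sum η]
  simp only [map_sum, map_smul, FunLike.coe_sum, FunLike.coe_smul,
    Finset.sum_apply, Pi.smul_apply, smul_eq_mul, dotProduct, Matrix.mulVec, induced_apply,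
    Finset.mul_sum]
  rw [Finset.sum_comm]
  exact Finset.sum_congr rfl fun i _ => Finset.sum_congr rfl fun j _ => by ring

lemma induced_posDef {x : E3} (hx : x ∈ outerRegion) : (Sig.induced x).PosDef := by
  rw [Matrix.posDef_iff_dotProduct_mulVec]
  constructor
  · ext i j
    rw [Matrix.conjTranspose_apply, star_trivial, induced_apply, induced_apply,
      LorentzMetric.form_symm]
  · intro v hv
    have h := Sig.spacelike x hx (WithLp.toLp 2 v) (fun h => hv ((WithLp.toLp_eq_zero 2).1 h))
    have h2 := Sig.form_dσ x (WithLp.toLp 2 v) (WithLp.toLp 2 v)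
    rw [star_trivial]
    exact h.trans_eq h2

/-- The Jacobian matrix of the spherical coordinates. -/
def jac (z : Fin 3 → ℝ) : Matrix (Fin 3) (Fin 3) ℝ :=
  Matrix.of fun a i => fderiv ℝ Sig.K z (Pi.single i 1) a

/-- The metric components at a point of the surface. -/
def htMetric (z : Fin 3 → ℝ) : Matrix (Fin 4) (Fin 4) ℝ :=
  hartleThorne S.N S.A S.B S.w (Sig.chart z)

variable {z : Fin 3 → ℝ}

lemma form_tangent (hz : z ∈ zdom S.rH) (h1 : z 1 ∈ Ioo 0 Real.pi) (u v : Fin 4 → ℝ) :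
    S.g.form (Sig.σ (Sig.K z)) (S.L (Sig.chart z) u) (S.L (Sig.chart z) v)
      = bil (Sig.htMetric z) u v := by
  rw [Sig.σ_K hz]; exact S.form_L (Sig.chart_mem hz h1) u v

lemma gram3_eq (hz : z ∈ zdom S.rH) (h1 : z 1 ∈ Ioo 0 Real.pi) :
    gram3 (Sig.htMetric z) (Sig.tangent z)
      = (Sig.jac z)ᵀ * Sig.induced (Sig.K z) * Sig.jac z := by
  ext i j
  rw [gram3, Matrix.of_apply, ← Sig.form_tangent hz h1, ← Sig.dσ_K hz, ← Sig.dσ_K hz, form_dσ,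
    Matrix.mul_assoc, Matrix.mul_apply]
  simp only [dotProduct, Matrix.mulVec, Matrix.mul_apply, jac, Matrix.transpose_apply,
    Matrix.of_apply]

lemma htDensity_pos (hz : z ∈ zdom S.rH) (h1 : z 1 ∈ Ioo 0 Real.pi) :
    0 < htDensity S.N S.A S.B (Sig.chart z) := by
  have hθ : z 1 ∈ Icc 0 Real.pi := ⟨h1.1.le, h1.2.le⟩
  have hr : 0 < z 0 := S.rH_nonneg.trans_lt hz
  have hN := S.N_pos _ hz _ hθ
  have hA := S.A_pos _ hz _ hθ
  have hB := S.B_pos _ hz _ hθ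
  have hs := Real.sin_pos_of_mem_Ioo h1
  change 0 < S.N (z 0) (z 1) * S.A (z 0) (z 1) * (z 0 * S.B (z 0) (z 1)) ^ 2 * Real.sin (z 1)
  positivity

/-- The Hartle–Thorne metric is nondegenerate off the axis. -/
lemma bil_nondegenerate (hz : z ∈ zdom S.rH) (h1 : z 1 ∈ Ioo 0 Real.pi) {v : Fin 4 → ℝ}
    (h : ∀ u, bil (Sig.htMetric z) u v = 0) : v = 0 := by
  have hdet : (Sig.htMetric z).det ≠ 0 := by
    rw [htMetric, hartleThorne_det]
    have := Sig.htDensity_pos hz h1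
    exact neg_ne_zero.2 (by positivity)
  refine Matrix.eq_zero_of_mulVec_eq_zero hdet ?_
  ext i
  have := h (Pi.single i 1)
  rwa [bil, single_dotProduct, one_mul] at this

lemma sum_tangent_one (v : Fin 3 → ℝ) : (∑ i, v i • Sig.tangent z i) 1 = v 0 := by
  simp [tangent, Fin.sum_univ_three]

lemma sum_tangent_two (v : Fin 3 → ℝ) : (∑ i, v i • Sig.tangent z i) 2 = v 1 := by
  simp [tangent, Fin.sum_univ_three]

lemma tangent_eq : Sig.tangent z = ![Sig.tangent z 0, Sig.tangent z 1, Sig.tangent z 2] := by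
  ext i j; fin_cases i <;> rfl

lemma pd_two_w (hz : z ∈ zdom S.rH) : pd 2 (hat S.w) z = 0 :=
  pd_two_hat (differentiableAt_hat S.w_smooth hz)

lemma det_frame_tangent (hz : z ∈ zdom S.rH) (Y : Fin 4 → ℝ) :
    (frame Y (Sig.tangent z)).det
      = (Y 0 - Y 1 * pd 0 Sig.T z - Y 2 * pd 1 Sig.T z) * (1 + hat S.w z * pd 2 Sig.T z)
      - (Y 3 - Y 1 * (hat S.w z * pd 0 Sig.T z + Sig.T z * pd 0 (hat S.w) z)
          - Y 2 * (hat S.w z * pd 1 Sig.T z + Sig.T z * pd 1 (hat S.w) z)) * pd 2 Sig.T z := by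
  rw [tangent_eq, det_frame_graph]
  · simp [tangent, pd_two_w hz]
  all_goals simp [tangent]

lemma jac_mulVec (v : Fin 3 → ℝ) : Sig.jac z *ᵥ v = (fderiv ℝ Sig.K z v : E3) := by
  have hv : v = ∑ i, v i • Pi.single i (1 : ℝ) := by
    ext j; simp [Finset.sum_apply, Pi.single_apply]
  ext a
  conv_rhs => rw [hv]
  simp [jac, Matrix.mulVec, dotProduct, map_sum, mul_comm]

/-- A kernel vector gives a linear relation among the coordinate tangent vectors. Their r and θ
entries remove the first two coefficients. -/
lemma det_jac_ne_zero (hz : z ∈ zdom S.rH) (h1 : z 1 ∈ Ioo 0 Real.pi) : (Sig.jac z).det ≠ 0 := by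
  intro h
  obtain ⟨v, hv, hv0⟩ := Matrix.exists_mulVec_eq_zero_iff.2 h
  have h2 : ∀ u, bil (Sig.htMetric z) u (∑ i, v i • Sig.tangent z i) = 0 := by
    intro u
    rw [← Sig.form_tangent hz h1, map_sum]
    have : ∑ i, S.L (Sig.chart z) (v i • Sig.tangent z i) = Sig.dσ (Sig.K z) (fderiv ℝ Sig.K z v) := by
      have hv' : v = ∑ i, v i • Pi.single i (1 : ℝ) := by
        ext j; simp [Finset.sum_apply, Pi.single_apply]
      conv_rhs => rw [hv']
      simp only [map_sum, map_smul, Sig.dσ_K hz]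
    have h0 : fderiv ℝ Sig.K z v = 0 := by
      rw [jac_mulVec] at hv0
      ext a; exact congrFun hv0 a
    rw [this, h0]; simp
  have h3 := Sig.bil_nondegenerate hz h1 h2
  have e0 : v 0 = 0 := (Sig.sum_tangent_one v).symm.trans (congrFun h3 1)
  have e1 : v 1 = 0 := (Sig.sum_tangent_two v).symm.trans (congrFun h3 2)
  have c0 := congrFun h3 0
  have c3 := congrFun h3 3
  simp [Fin.sum_univ_three, e0, e1, tangent, pd_two_w hz] at c0 c3
  -- The t and φ entries are now v₂ ∂_φ T and v₂ (1 + ω ∂_φ T), which vanish together only if v₂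
  -- does.
  have e2 : v 2 = 0 := by
    rcases c0 with h | h
    · exact h
    · simpa [h] using c3
  apply hv
  ext i; fin_cases i
  · exact e0
  · exact e1
  · exact e2

/-- The volume element of the surface in spherical coordinates. -/
lemma abs_det_jac_mul_sqrt (hz : z ∈ zdom S.rH) (h1 : z 1 ∈ Ioo 0 Real.pi) :
    0 < (gram3 (Sig.htMetric z) (Sig.tangent z)).det ∧
    |(Sig.jac z).det| * √(Sig.induced (Sig.K z)).det
      = √(gram3 (Sig.htMetric z) (Sig.tangent z)).det := by
  have hd := (Sig.induced_posDef (outside_subset (Sig.K_mem hz))).det_pos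
  have h : (gram3 (Sig.htMetric z) (Sig.tangent z)).det
      = (Sig.jac z).det ^ 2 * (Sig.induced (Sig.K z)).det := by
    rw [Sig.gram3_eq hz h1, Matrix.det_mul, Matrix.det_mul, Matrix.det_transpose]; ring
  have hj := Sig.det_jac_ne_zero hz h1
  refine ⟨by rw [h]; positivity, ?_⟩
  rw [h, Real.sqrt_mul (sq_nonneg _), Real.sqrt_sq_eq_abs]

/-- The flux density of a vector field through the surface in spherical coordinates. -/
lemma flux_density (hz : z ∈ zdom S.rH) (h1 : z 1 ∈ Ioo 0 Real.pi) (Y : Fin 4 → ℝ) :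
    |(Sig.jac z).det| * (-S.g.form (Sig.σ (Sig.K z)) (Sig.nE (Sig.K z)) (S.L (Sig.chart z) Y)
        * √(Sig.induced (Sig.K z)).det)
      = htDensity S.N S.A S.B (Sig.chart z) * (frame Y (Sig.tangent z)).det := by
  obtain ⟨ν, hν0, hν⟩ := Sig.exists_normal hz h1
  have hx := Sig.K_mem hz
  have hθ : z 1 ∈ Icc 0 Real.pi := ⟨h1.1.le, h1.2.le⟩
  have hr : 0 < z 0 := S.rH_nonneg.trans_lt hz
  have hN := S.N_pos _ hz _ hθ
  have hw : hat S.w z = S.w (z 0) (z 1) := hat_eq _ hr hθ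
  obtain ⟨hpos, hsq⟩ := Sig.abs_det_jac_mul_sqrt hz h1
  -- The reference vector is the zero-angular-momentum direction: its frame determinant is exactly 1
  -- on every graph, and its product with a normal having ν₀ > 0 is −N² ν₀ < 0.
  have key := density_of_frame (G := Sig.htMetric z) (u := ![1, 0, 0, hat S.w z]) (ν := ν)
    (e := Sig.tangent z) (Sig.htDensity_pos hz h1) (hartleThorne_det _ _ _ _ _) ?_ ?_ ?_ ?_ hpos Y
  · rw [hν, Sig.form_tangent hz h1, bil_comm (G := Sig.htMetric z) (hartleThorne_transpose _ _ _ _ _), ← key, ← hsq]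
    ring
  · intro i
    rw [← Sig.form_tangent hz h1, ← hν, ← Sig.dσ_K hz, LorentzMetric.form_symm]
    exact Sig.n_normal _ (outside_subset hx) _
  · rw [← Sig.form_tangent hz h1, ← hν]
    exact Sig.n_unit _ (outside_subset hx)
  · rw [Sig.det_frame_tangent hz]; simp
  · rw [htMetric, bil_hartleThorne]
    simp only [chart, Matrix.cons_val]
    rw [hw]
    simp
    positivity

/-- The factor by which the flux density of the horizon generator through the surface differs from
the flux density through a surface of constant time. -/
def lapseFactor (z : Fin 3 → ℝ) : ℝ := 1 - (S.Ω - hat S.w z) * pd 2 Sig.T z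

lemma XE_K (hz : z ∈ zdom S.rH) (h1 : z 1 ∈ Ioo 0 Real.pi) :
    S.XE (Sig.σ (Sig.K z)) = S.L (Sig.chart z) ![1, 0, 0, S.Ω] := by
  rw [Sig.σ_K hz]; exact S.XE_eq (Sig.chart_mem hz h1)

lemma det_frame_X (hz : z ∈ zdom S.rH) :
    (frame ![1, 0, 0, S.Ω] (Sig.tangent z)).det = Sig.lapseFactor z := by
  rw [Sig.det_frame_tangent hz, lapseFactor]; simp; ring

lemma surfaceDensity_K (hz : z ∈ zdom S.rH) (h1 : z 1 ∈ Ioo 0 Real.pi) :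
    |(Sig.jac z).det| * Sig.surfaceDensity S.X (Sig.K z)
      = htDensity S.N S.A S.B (Sig.chart z) * Sig.lapseFactor z := by
  rw [← Sig.det_frame_X hz, ← Sig.flux_density hz h1, ← Sig.XE_K hz h1]
  rfl

/-- The graph function of a spacelike surface has a bounded azimuthal derivative. -/
lemma abs_pd_two_T_le (hz : z ∈ zdom S.rH) (h1 : z 1 ∈ Ioo 0 Real.pi) :
    S.N (z 0) (z 1) * |pd 2 Sig.T z| ≤ z 0 * S.B (z 0) (z 1) := by
  have hθ : z 1 ∈ Icc 0 Real.pi := ⟨h1.1.le, h1.2.le⟩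
  have hr : 0 < z 0 := S.rH_nonneg.trans_lt hz
  have hw : hat S.w z = S.w (z 0) (z 1) := hat_eq _ hr hθ
  have hN := S.N_pos _ hz _ hθ
  have hB := S.B_pos _ hz _ hθ
  have hne : fderiv ℝ Sig.K z (Pi.single 2 1) ≠ 0 := by
    intro h
    apply Sig.det_jac_ne_zero hz h1
    refine Matrix.exists_mulVec_eq_zero_iff.1 ⟨Pi.single 2 1, by simp, ?_⟩
    rw [jac_mulVec, h]; rfl
  have h2 : 0 < S.g.form (Sig.σ (Sig.K z)) (Sig.dσ (Sig.K z) (fderiv ℝ Sig.K z (Pi.single 2 1)))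
    (Sig.dσ (Sig.K z) (fderiv ℝ Sig.K z (Pi.single 2 1))) :=
    Sig.spacelike _ (outside_subset (Sig.K_mem hz)) _ hne
  -- The azimuthal tangent vector has norm (r B sin θ)² − N² (∂_φ T)²: in the corotating azimuth its
  -- φ component minus ω times its t component is 1.
  rw [Sig.dσ_K hz, Sig.form_tangent hz h1, htMetric, bil_hartleThorne] at h2
  simp [tangent, chart, pd_two_w hz, hw] at h2
  have h3 : (S.N (z 0) (z 1) * |pd 2 Sig.T z|) ^ 2 ≤ (z 0 * S.B (z 0) (z 1)) ^ 2 := by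
    rw [mul_pow, sq_abs]
    have h4 : (z 0 * S.B (z 0) (z 1) * Real.sin (z 1)) ^ 2 ≤ (z 0 * S.B (z 0) (z 1)) ^ 2 := by
      rw [mul_pow]
      exact mul_le_of_le_one_right (sq_nonneg _) (Real.sin_sq_le_one _)
    nlinarith
  exact abs_le_of_sq_le_sq' h3 (by positivity) |>.2

end PartialCauchySurface

end Density

/-! ### The conserved current in the parameters of the surface and in spherical coordinates. -/

section Current

variable {M : Type*} [TopologicalSpace M] [ChartedSpace E4 M] [IsManifold (𝓡 4) ∞ M]

/-- A smooth function on spacetime that depends on `(r, θ)` only is smooth in these variables. -/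
lemma CircularBlackHole.smoothExterior_of_invariant (S : CircularBlackHole M) {Φ : M → ℝ}
    (hΦ : ContMDiff (𝓡 4) 𝓘(ℝ, ℝ) ∞ Φ) {Φc : ℝ → ℝ → ℝ}
    (hΦc : ∀ x : Fin 4 → ℝ, S.rH < x 1 → x 2 ∈ Icc 0 Real.pi →
      Φ (S.Ψ (polar x)) = Φc (x 1) (x 2)) : SmoothExterior S.rH Φc := by
  intro y hy
  have hy' : S.rH < ‖y‖ := hy
  have h1 : ContMDiffAt 𝓘(ℝ, E3) 𝓘(ℝ, ℝ) ∞ (fun y : E3 => Φ (S.Ψ (0, y))) y :=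
    (hΦ.contMDiffAt.comp y (ContMDiffAt.comp (g := S.Ψ) (f := fun y : E3 => ((0 : ℝ), y)) y
      (S.Ψ_contMDiffAt (show ((0 : ℝ), y) ∈ exterior S.rH from hy'))
      (contDiff_const.prodMk contDiff_id : ContDiff ℝ ∞ _).contDiffAt.contMDiffAt))
  refine (h1.contDiffAt.contDiffWithinAt).congr_of_mem (fun y hy => ?_) hy
  have hy' : S.rH < ‖y‖ := hy
  have h0 : y ≠ 0 := norm_pos_iff.1 (S.rH_nonneg.trans_lt hy')
  have := hΦc ![0, ‖y‖, polarAngle y, azimuth y] hy' (polarAngle_mem y)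
  simp [polar_eq, sph_polarAngle_azimuth h0] at this
  exact this.symm

lemma CircularBlackHole.continuousOn_of_invariant (S : CircularBlackHole M) {F : M → ℝ}
    (hF : Continuous F) {Fc : ℝ → ℝ → ℝ}
    (hFc : ∀ x : Fin 4 → ℝ, S.rH < x 1 → x 2 ∈ Icc 0 Real.pi →
      F (S.Ψ (polar x)) = Fc (x 1) (x 2)) : ContinuousOn (hat Fc) (zdom S.rH) := by
  have h1 : ContinuousOn (fun z => F (S.Ψ (0, sphz z))) (zdom S.rH) :=
    hF.comp_continuousOn (S.Ψ_smooth.continuousOn.comp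
      (continuous_const.prodMk contDiff_sphz.continuous).continuousOn
      (fun z hz => sphz_mem S.rH_nonneg hz))
  refine h1.congr (fun z hz => ?_)
  have hy' : S.rH < ‖sphz z‖ := sphz_mem S.rH_nonneg hz
  have h0 : sphz z ≠ 0 := norm_pos_iff.1 (S.rH_nonneg.trans_lt hy')
  have := hFc ![0, ‖sphz z‖, polarAngle (sphz z), azimuth (sphz z)] hy' (polarAngle_mem _)
  simp [polar_eq, sph_polarAngle_azimuth h0] at this
  exact this.symm

/-- The radial flux density `√|det g| ∂^r Φ`. -/
def radialFlux (S : CircularBlackHole M) (Φc : ℝ → ℝ → ℝ) (z : Fin 3 → ℝ) : ℝ :=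
  hat S.N z * (z 0 * hat S.B z) ^ 2 / hat S.A z * Real.sin (z 1) * pd 0 (hat Φc) z

/-- The polar flux density `√|det g| ∂^θ Φ`. -/
def polarFlux (S : CircularBlackHole M) (Φc : ℝ → ℝ → ℝ) (z : Fin 3 → ℝ) : ℝ :=
  hat S.N z * hat S.A z * Real.sin (z 1) * pd 1 (hat Φc) z

namespace PartialCauchySurface

variable {S : CircularBlackHole M} (Sig : PartialCauchySurface S)

/-- The conserved current, as a vector density on the surface. -/
def current (Φ : M → ℝ) (x : E3) : Fin 3 → ℝ :=
  √(Sig.induced x).det • ((Sig.induced x)⁻¹ *ᵥ fun j =>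
    -S.g.form (Sig.σ x) (Sig.nE x) (S.XE (Sig.σ x))
        * dE Φ (Sig.σ x) (Sig.dσ x (EuclideanSpace.single j 1))
      + dE Φ (Sig.σ x) (Sig.nE x)
        * S.g.form (Sig.σ x) (S.XE (Sig.σ x)) (Sig.dσ x (EuclideanSpace.single j 1)))

/-- The conserved current in spherical coordinates. -/
def currentPolar (Φc : ℝ → ℝ → ℝ) (z : Fin 3 → ℝ) : Fin 3 → ℝ :=
  ![radialFlux S Φc z * Sig.lapseFactor z, polarFlux S Φc z * Sig.lapseFactor z,
    (S.Ω - hat S.w z) * (radialFlux S Φc z * pd 0 Sig.T z + polarFlux S Φc z * pd 1 Sig.T z)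
      - (radialFlux S Φc z * pd 0 (hat S.w) z + polarFlux S Φc z * pd 1 (hat S.w) z) * Sig.T z]

variable {z : Fin 3 → ℝ}

lemma bil_sum_right (G : Matrix (Fin 4) (Fin 4) ℝ) (u : Fin 4 → ℝ) (v : Fin 3 → ℝ)
    (e : Fin 3 → Fin 4 → ℝ) : bil G u (∑ i, v i • e i) = ∑ i, v i * bil G u (e i) := by
  simp [bil, Matrix.mulVec_sum, Matrix.mulVec_smul, dotProduct_sum, dotProduct_smul]

/-- The gradient of a function of `(r, θ)` in Hartle–Thorne coordinates. -/
def gradPolar (S : CircularBlackHole M) (Φc : ℝ → ℝ → ℝ) (z : Fin 3 → ℝ) : Fin 4 → ℝ :=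
  ![0, pd 0 (hat Φc) z / hat S.A z ^ 2, pd 1 (hat Φc) z / (z 0 * hat S.B z) ^ 2, 0]

lemma bil_gradPolar {Φ : M → ℝ}
    (hΦ : ContMDiff (𝓡 4) 𝓘(ℝ, ℝ) ∞ Φ) {Φc : ℝ → ℝ → ℝ}
    (hΦc : ∀ x : Fin 4 → ℝ, S.rH < x 1 → x 2 ∈ Icc 0 Real.pi →
      Φ (S.Ψ (polar x)) = Φc (x 1) (x 2)) (hz : z ∈ zdom S.rH) (h1 : z 1 ∈ Ioo 0 Real.pi)
    (v : Fin 4 → ℝ) :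
    dE Φ (Sig.σ (Sig.K z)) (S.L (Sig.chart z) v) = bil (Sig.htMetric z) (gradPolar S Φc z) v := by
  have hx := Sig.chart_mem hz h1
  have hθ : z 1 ∈ Icc 0 Real.pi := ⟨h1.1.le, h1.2.le⟩
  have hr : 0 < z 0 := S.rH_nonneg.trans_lt hz
  have hA := S.A_pos _ hz _ hθ
  have hB := S.B_pos _ hz _ hθ
  rw [Sig.σ_K hz, S.dE_L hΦ hΦc hx, pd_hat_of_polar S.rH_nonneg
    (S.smoothExterior_of_invariant hΦ hΦc) hx z rfl rfl, htMetric, bil_hartleThorne]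
  simp only [gradPolar, chart, Matrix.cons_val, hat_eq S.A hr hθ, hat_eq S.B hr hθ]
  field_simp
  ring

/-- Weighting ∇Φ by the flux of X and X by the flux of ∇Φ makes the total flux of the difference
cancel, so it is tangent to the surface. The components of `currentPolar` are its coefficients in
the coordinate frame. -/
lemma sum_currentPolar (Φc : ℝ → ℝ → ℝ) (hz : z ∈ zdom S.rH) (h1 : z 1 ∈ Ioo 0 Real.pi) :
    ∑ i, Sig.currentPolar Φc z i • Sig.tangent z i
      = (htDensity S.N S.A S.B (Sig.chart z) * (frame ![1, 0, 0, S.Ω] (Sig.tangent z)).det)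
          • gradPolar S Φc z
        - (htDensity S.N S.A S.B (Sig.chart z) * (frame (gradPolar S Φc z) (Sig.tangent z)).det)
          • ![1, 0, 0, S.Ω] := by
  have hθ : z 1 ∈ Icc 0 Real.pi := ⟨h1.1.le, h1.2.le⟩
  have hr : 0 < z 0 := S.rH_nonneg.trans_lt hz
  have hA := S.A_pos _ hz _ hθ
  have hB := S.B_pos _ hz _ hθ
  have hA' : hat S.A z = S.A (z 0) (z 1) := hat_eq _ hr hθ
  have hB' : hat S.B z = S.B (z 0) (z 1) := hat_eq _ hr hθ
  have hN' : hat S.N z = S.N (z 0) (z 1) := hat_eq _ hr hθ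
  rw [Sig.det_frame_X hz, Sig.det_frame_tangent hz]
  have hD : htDensity S.N S.A S.B (Sig.chart z)
      = hat S.N z * hat S.A z * (z 0 * hat S.B z) ^ 2 * Real.sin (z 1) := by
    rw [hA', hB', hN']; rfl
  have ha : radialFlux S Φc z = htDensity S.N S.A S.B (Sig.chart z) * gradPolar S Φc z 1 := by
    rw [hD, radialFlux, gradPolar, hA', hB', hN']; simp; field_simp
  have hb : polarFlux S Φc z = htDensity S.N S.A S.B (Sig.chart z) * gradPolar S Φc z 2 := by
    rw [hD, polarFlux, gradPolar, hA', hB', hN']; simp; field_simp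
  have g0 : gradPolar S Φc z 0 = 0 := rfl
  have g3 : gradPolar S Φc z 3 = 0 := rfl
  ext j
  fin_cases j
  · simp [Fin.sum_univ_three, currentPolar, tangent, ha, hb, g0, g3, lapseFactor]; ring
  · simp [Fin.sum_univ_three, currentPolar, tangent, ha]; ring
  · simp [Fin.sum_univ_three, currentPolar, tangent, hb]; ring
  · simp [Fin.sum_univ_three, currentPolar, tangent, ha, hb, g0, g3, lapseFactor, pd_two_w hz]; ring

/-- The current transforms as a vector density. -/
lemma current_K {Φ : M → ℝ}
    (hΦ : ContMDiff (𝓡 4) 𝓘(ℝ, ℝ) ∞ Φ) {Φc : ℝ → ℝ → ℝ}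
    (hΦc : ∀ x : Fin 4 → ℝ, S.rH < x 1 → x 2 ∈ Icc 0 Real.pi →
      Φ (S.Ψ (polar x)) = Φc (x 1) (x 2)) (hz : z ∈ zdom S.rH) (h1 : z 1 ∈ Ioo 0 Real.pi) :
    |(Sig.jac z).det| • Sig.current Φ (Sig.K z) = Sig.jac z *ᵥ Sig.currentPolar Φc z := by
  obtain ⟨ν, -, hν⟩ := Sig.exists_normal hz h1
  have hpd := Sig.induced_posDef (outside_subset (Sig.K_mem hz))
  have hdet : IsUnit (Sig.induced (Sig.K z)).det := hpd.det_pos.ne'.isUnit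
  have hj : IsUnit (Sig.jac z)ᵀ.det := by
    rw [Matrix.det_transpose]; exact (Sig.det_jac_ne_zero hz h1).isUnit
  have hunit : IsUnit ((Sig.jac z)ᵀ * Sig.induced (Sig.K z)).det := by
    rw [Matrix.det_mul]; exact hj.mul hdet
  -- Lowering the index on both sides removes the inverse of the induced metric; what remains is an
  -- identity of covectors, checked on the coordinate tangent vectors.
  refine Matrix.mulVec_injective_of_isUnit ((Matrix.isUnit_iff_isUnit_det _).2 hunit) ?_
  change ((Sig.jac z)ᵀ * Sig.induced (Sig.K z)) *ᵥ _ = ((Sig.jac z)ᵀ * Sig.induced (Sig.K z)) *ᵥ _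
  have hX := Sig.flux_density hz h1 ![1, 0, 0, S.Ω]
  have hV := Sig.flux_density hz h1 (gradPolar S Φc z)
  have hsum := Sig.sum_currentPolar Φc hz h1
  rw [← hX, ← hV] at hsum
  rw [Matrix.mulVec_mulVec, ← Sig.gram3_eq hz h1]
  have hL : ((Sig.jac z)ᵀ * Sig.induced (Sig.K z)) *ᵥ (|(Sig.jac z).det| • Sig.current Φ (Sig.K z))
      = (|(Sig.jac z).det| * √(Sig.induced (Sig.K z)).det) • ((Sig.jac z)ᵀ *ᵥ fun j =>
      -S.g.form (Sig.σ (Sig.K z)) (Sig.nE (Sig.K z)) (S.XE (Sig.σ (Sig.K z)))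
        * dE Φ (Sig.σ (Sig.K z)) (Sig.dσ (Sig.K z) (EuclideanSpace.single j 1))
      + dE Φ (Sig.σ (Sig.K z)) (Sig.nE (Sig.K z))
        * S.g.form (Sig.σ (Sig.K z)) (S.XE (Sig.σ (Sig.K z)))
          (Sig.dσ (Sig.K z) (EuclideanSpace.single j 1))) := by
    rw [current, Matrix.mulVec_smul, Matrix.mulVec_smul, smul_smul, Matrix.mulVec_mulVec,
      Matrix.mul_assoc, Matrix.mul_nonsing_inv _ hdet, Matrix.mul_one]
  rw [hL]
  ext j
  have hlin (l : E4 →L[ℝ] ℝ) : ∑ a, (Sig.jac z) a j * l (Sig.dσ (Sig.K z) (EuclideanSpace.single a 1))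
      = l (S.L (Sig.chart z) (Sig.tangent z j)) := by
    rw [← Sig.dσ_K hz]
    conv_rhs => rw [E3_eq_sum (fderiv ℝ Sig.K z (Pi.single j 1))]
    simp [map_sum, jac]
  have h2 : ((Sig.jac z)ᵀ *ᵥ fun j =>
      -S.g.form (Sig.σ (Sig.K z)) (Sig.nE (Sig.K z)) (S.XE (Sig.σ (Sig.K z)))
        * dE Φ (Sig.σ (Sig.K z)) (Sig.dσ (Sig.K z) (EuclideanSpace.single j 1))
      + dE Φ (Sig.σ (Sig.K z)) (Sig.nE (Sig.K z))
        * S.g.form (Sig.σ (Sig.K z)) (S.XE (Sig.σ (Sig.K z)))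
          (Sig.dσ (Sig.K z) (EuclideanSpace.single j 1))) j
      = -S.g.form (Sig.σ (Sig.K z)) (Sig.nE (Sig.K z)) (S.XE (Sig.σ (Sig.K z)))
        * dE Φ (Sig.σ (Sig.K z)) (S.L (Sig.chart z) (Sig.tangent z j))
      + dE Φ (Sig.σ (Sig.K z)) (Sig.nE (Sig.K z))
        * S.g.form (Sig.σ (Sig.K z)) (S.XE (Sig.σ (Sig.K z)))
          (S.L (Sig.chart z) (Sig.tangent z j)) := by
    rw [← hlin, ← hlin]
    simp only [Matrix.mulVec, dotProduct, Matrix.transpose_apply, mul_add, Finset.sum_add_distrib,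
      Finset.mul_sum]
    congr 1 <;> exact Finset.sum_congr rfl fun a _ => by ring
  have h3 : (gram3 (Sig.htMetric z) (Sig.tangent z) *ᵥ Sig.currentPolar Φc z) j
      = bil (Sig.htMetric z) (Sig.tangent z j)
        (∑ i, Sig.currentPolar Φc z i • Sig.tangent z i) := by
    rw [bil_sum_right]
    simp [Matrix.mulVec, dotProduct, gram3, mul_comm]
  have hsub (u a b : Fin 4 → ℝ) (c d : ℝ) : bil (Sig.htMetric z) u (c • a - d • b)
      = c * bil (Sig.htMetric z) u a - d * bil (Sig.htMetric z) u b := by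
    simp [bil, Matrix.mulVec_sub, Matrix.mulVec_smul, dotProduct_sub, dotProduct_smul]
  have hsym := bil_comm (G := Sig.htMetric z) (hartleThorne_transpose _ _ _ _ _)
  rw [h3, hsum, hsub, Pi.smul_apply, h2, Sig.XE_K hz h1, hν, Sig.bil_gradPolar hΦ hΦc hz h1,
    Sig.bil_gradPolar hΦ hΦc hz h1, Sig.form_tangent hz h1, Sig.form_tangent hz h1,
    Sig.form_tangent hz h1, hsym (Sig.tangent z j), hsym (Sig.tangent z j), hsym (gradPolar S Φc z) ν,
    smul_eq_mul]
  ring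

end PartialCauchySurface

end Current

/-! ### Vanishing of the flux through the horizon. -/

section Horizon

variable {M : Type*} [TopologicalSpace M] [ChartedSpace E4 M] [IsManifold (𝓡 4) ∞ M]

lemma outerRegion_subset_closure : outerRegion ⊆ closure (outside 1) := by
  have h : outside 1 = (Metric.closedBall (0 : E3) 1)ᶜ := by
    ext x; simp [outside]
  rw [h, closure_compl, interior_closedBall _ one_ne_zero]
  intro x hx
  simpa [outerRegion] using hx

namespace PartialCauchySurface

variable {S : CircularBlackHole M} (Sig : PartialCauchySurface S)

lemma continuousOn_σ : ContinuousOn Sig.σ outerRegion :=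
  fun x hx => (Sig.smooth x hx).continuousAt.continuousWithinAt

lemma continuousOn_dσ (v : E3) :
    ContinuousOn (fun x => (⟨Sig.σ x, Sig.dσ x v⟩ : TangentBundle (𝓡 4) M)) outerRegion :=
  continuousOn_mfderiv_apply (E := E3) (fun x hx => Sig.smooth x hx) v

lemma continuousOn_XE :
    ContinuousOn (fun x => (⟨Sig.σ x, S.XE (Sig.σ x)⟩ : TangentBundle (𝓡 4) M)) outerRegion :=
  S.X_smooth.continuousOn_along Sig.continuousOn_σ

lemma continuousOn_nE :
    ContinuousOn (fun x => (⟨Sig.σ x, Sig.nE x⟩ : TangentBundle (𝓡 4) M)) outerRegion :=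
  Sig.n_continuous

lemma continuousOn_induced : ContinuousOn Sig.induced outerRegion := by
  refine continuousOn_pi.2 fun i => continuousOn_pi.2 fun j => ?_
  exact S.g.continuousOn_inner (Sig.continuousOn_dσ _) (Sig.continuousOn_dσ _)

lemma continuousOn_sqrt_det : ContinuousOn (fun x => √(Sig.induced x).det) outerRegion :=
  (Continuous.matrix_det continuous_id).sqrt.comp_continuousOn Sig.continuousOn_induced

lemma continuousOn_surfaceDensity : ContinuousOn (Sig.surfaceDensity S.X) outerRegion :=
  (S.g.continuousOn_inner Sig.continuousOn_nE Sig.continuousOn_XE).neg.mul Sig.continuousOn_sqrt_det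

lemma continuousOn_inv_induced : ContinuousOn (fun x => (Sig.induced x)⁻¹) outerRegion := by
  have h : ∀ x, (Sig.induced x)⁻¹ = ((Sig.induced x).det)⁻¹ • (Sig.induced x).adjugate := by
    intro x; rw [Matrix.inv_def, Ring.inverse_eq_inv']
  simp only [h]
  have hd : Continuous fun B : Matrix (Fin 3) (Fin 3) ℝ => B.det := continuous_id.matrix_det
  have ha : Continuous fun B : Matrix (Fin 3) (Fin 3) ℝ => B.adjugate :=
    continuous_id.matrix_adjugate
  have h1 : ContinuousOn (fun x => ((Sig.induced x).det)⁻¹) outerRegion :=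
    (hd.comp_continuousOn Sig.continuousOn_induced).inv₀
      fun x hx => (Sig.induced_posDef hx).det_pos.ne'
  exact h1.smul (ha.comp_continuousOn Sig.continuousOn_induced)

/-- The current is built from objects that are regular across the horizon, so it is continuous up to
the boundary sphere even though the exterior coordinates degenerate there. -/
lemma continuousOn_current {Φ : M → ℝ} (hΦ : ContMDiff (𝓡 4) 𝓘(ℝ, ℝ) ∞ Φ) :
    ContinuousOn (Sig.current Φ) outerRegion := by
  refine Sig.continuousOn_sqrt_det.smul ?_
  rw [continuousOn_pi]
  intro i
  have hXn : ContinuousOn (fun x => -S.g.form (Sig.σ x) (Sig.nE x) (S.XE (Sig.σ x))) outerRegion :=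
    (S.g.continuousOn_inner Sig.continuousOn_nE Sig.continuousOn_XE).neg
  have hVn : ContinuousOn (fun x => dE Φ (Sig.σ x) (Sig.nE x)) outerRegion :=
    continuousOn_mfderiv_section hΦ Sig.continuousOn_nE
  have hΦj (v : E3) : ContinuousOn (fun x => dE Φ (Sig.σ x) (Sig.dσ x v)) outerRegion :=
    continuousOn_mfderiv_section hΦ (Sig.continuousOn_dσ v)
  have hXj (v : E3) : ContinuousOn (fun x => S.g.form (Sig.σ x) (S.XE (Sig.σ x)) (Sig.dσ x v))
      outerRegion := S.g.continuousOn_inner Sig.continuousOn_XE (Sig.continuousOn_dσ v)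
  have hinv (i j : Fin 3) : ContinuousOn (fun x => (Sig.induced x)⁻¹ i j) outerRegion :=
    continuousOn_pi.1 (continuousOn_pi.1 Sig.continuousOn_inv_induced i) j
  simp only [Matrix.mulVec, dotProduct]
  exact continuousOn_finsetSum _ fun j _ =>
    (hinv i j).mul ((hXn.mul (hΦj _)).add (hVn.mul (hXj _)))

/-- Invariant functions are constant along the horizon generator, up to the horizon. -/
lemma dE_XE {Φ : M → ℝ} (hΦ : ContMDiff (𝓡 4) 𝓘(ℝ, ℝ) ∞ Φ) {Φc : ℝ → ℝ → ℝ}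
    (hΦc : ∀ x : Fin 4 → ℝ, S.rH < x 1 → x 2 ∈ Icc 0 Real.pi →
      Φ (S.Ψ (polar x)) = Φc (x 1) (x 2)) {x : E3} (hx : x ∈ outerRegion) :
    dE Φ (Sig.σ x) (S.XE (Sig.σ x)) = 0 := by
  have h1 : EqOn (fun q => dE Φ (S.Ψ q) (S.XE (S.Ψ q))) (fun _ => 0) (exterior S.rH) := by
    refine eqOn_exterior_of_polar ?_ continuousOn_const ?_
    · exact continuousOn_mfderiv_section hΦ (S.X_smooth.continuousOn_along S.Ψ_smooth.continuousOn)
    · intro y hy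
      rw [S.XE_eq hy, S.dE_L hΦ hΦc hy, pd_hat_of_polar S.rH_nonneg
        (S.smoothExterior_of_invariant hΦ hΦc) hy ![y 1, y 2, 0] rfl rfl]
      simp
  have h2 : ContinuousOn (fun x => dE Φ (Sig.σ x) (S.XE (Sig.σ x))) outerRegion :=
    continuousOn_mfderiv_section hΦ Sig.continuousOn_XE
  have h3 : EqOn (fun x => dE Φ (Sig.σ x) (S.XE (Sig.σ x))) (fun _ => 0) (outside 1) := by
    intro y hy
    obtain ⟨q, hq, hqy⟩ := Sig.interior y hy
    have := h1 hq
    simp only [hqy] at this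
    exact this
  exact h3.of_subset_closure h2 continuousOn_const outside_subset outerRegion_subset_closure hx

lemma form_nE_nE {x : E3} (hx : x ∈ outerRegion) :
    S.g.form (Sig.σ x) (Sig.nE x) (Sig.nE x) = -1 := Sig.n_unit x hx

lemma form_nE_dσ {x : E3} (hx : x ∈ outerRegion) (v : E3) :
    S.g.form (Sig.σ x) (Sig.nE x) (Sig.dσ x v) = 0 := Sig.n_normal x hx v

/-- Decomposition of a vector into a normal and a tangential part. -/
lemma exists_decomposition {x : E3} (hx : x ∈ outerRegion) (Y : E4) :
    ∃ η : E3, Y = (-S.g.form (Sig.σ x) (Sig.nE x) Y) • Sig.nE x + Sig.dσ x η := by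
  set l : (ℝ × E3) →L[ℝ] E4 := (ContinuousLinearMap.fst ℝ ℝ E3).smulRight (Sig.nE x)
    + (Sig.dσ x).comp (ContinuousLinearMap.snd ℝ ℝ E3) with hl
  have hlv (p : ℝ × E3) : l p = p.1 • Sig.nE x + Sig.dσ x p.2 := rfl
  have hn (p : ℝ × E3) : S.g.form (Sig.σ x) (Sig.nE x) (l p) = -p.1 := by
    rw [hlv, map_add, map_smul, Sig.form_nE_nE hx, Sig.form_nE_dσ hx]; simp
  -- Pairing with the normal recovers the first component and spacelikeness the second; the
  -- dimensions 1 + 3 = 4 turn injectivity into surjectivity.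
  have hinj : Function.Injective (l : (ℝ × E3) →ₗ[ℝ] E4) := by
    refine LinearMap.ker_eq_bot.1 (LinearMap.ker_eq_bot'.2 fun p hp => ?_)
    have hp' : l p = 0 := hp
    have h1 : p.1 = 0 := by have := hn p; rw [hp', map_zero] at this; linarith
    refine Prod.ext h1 ?_
    by_contra h2
    have h3 : 0 < S.g.form (Sig.σ x) (Sig.dσ x p.2) (Sig.dσ x p.2) := Sig.spacelike x hx p.2 h2
    rw [hlv, h1, zero_smul, zero_add] at hp'
    rw [hp', map_zero] at h3
    exact lt_irrefl _ h3
  obtain ⟨p, hp⟩ := (LinearMap.injective_iff_surjective_of_finrank_eq_finrank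
    (by simp : Module.finrank ℝ (ℝ × E3) = Module.finrank ℝ E4)).1 hinj Y
  have hp' : l p = Y := hp
  refine ⟨p.2, ?_⟩
  rw [← hp', hn, neg_neg]
  exact hlv p

/-- On the horizon the generator is normal to the cross section. -/
lemma exists_form_XE_dσ {x : E3} (hx : ‖x‖ = 1) (hX : S.XE (Sig.σ x) ≠ 0) :
    S.g.form (Sig.σ x) (S.XE (Sig.σ x)) (S.XE (Sig.σ x)) = 0 ∧
    ∃ k : ℝ, ∀ v : E3, S.g.form (Sig.σ x) (S.XE (Sig.σ x)) (Sig.dσ x v) = k * inner ℝ x v := by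
  rcases S.H_null _ (Sig.boundary x hx) with h | ⟨hnull, f, hf, hfH, hdf⟩
  · exact absurd h hX
  refine ⟨hnull, ?_⟩
  have hσ := Sig.smooth x hx.ge
  have hs : ContMDiffAt 𝓘(ℝ, E3) 𝓘(ℝ, ℝ) ∞ (f ∘ Sig.σ) x := hf.comp x hσ
  have hstrict := hs.contDiffAt.hasStrictFDerivAt (by simp)
  have hd (v : E3) : fderiv ℝ (f ∘ Sig.σ) x v
      = S.g.form (Sig.σ x) (S.XE (Sig.σ x)) (Sig.dσ x v) := by
    have h1 : mfderiv 𝓘(ℝ, E3) 𝓘(ℝ, ℝ) (f ∘ Sig.σ) x = _ := mfderiv_comp x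
      (hf.mdifferentiableAt (by simp)) (hσ.mdifferentiableAt (by simp))
    rw [mfderiv_eq_fderiv] at h1
    have h2 := congrArg (fun l : E3 →L[ℝ] ℝ => l v) h1
    exact h2.trans (hdf (Sig.dσ x v))
  -- The defining function of the horizon is zero along the whole unit sphere, hence trivially
  -- extremal under this constraint. Lagrange multipliers then make its differential proportional to
  -- that of ‖y‖².
  have hext : IsLocalExtrOn (f ∘ Sig.σ) {y | ‖y‖ ^ 2 = ‖x‖ ^ 2} x := by
    refine Or.inl ?_
    have h1 : ∀ᶠ y in 𝓝 x, (Sig.σ y ∈ S.H ↔ f (Sig.σ y) = 0) := hσ.continuousAt.eventually hfH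
    have h2 : f (Sig.σ x) = 0 := h1.self_of_nhds.1 (Sig.boundary x hx)
    filter_upwards [nhdsWithin_le_nhds h1, self_mem_nhdsWithin] with y hy hy1
    have hy2 : ‖y‖ = 1 := by
      have : ‖y‖ ^ 2 = ‖x‖ ^ 2 := hy1
      rw [hx, one_pow] at this
      exact (pow_eq_one_iff_of_nonneg (norm_nonneg _) two_ne_zero).1 this
    rw [Function.comp_apply, Function.comp_apply, h2, hy.1 (Sig.boundary y hy2)]
  obtain ⟨a, b, hab, h⟩ := hext.exists_multipliers_of_hasStrictFDerivAt_1d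
    (hasStrictFDerivAt_norm_sq x) hstrict
  have hv (v : E3) : a * (2 * inner ℝ x v) + b * fderiv ℝ (f ∘ Sig.σ) x v = 0 := by
    have := DFunLike.congr_fun h v
    simpa [two_mul, mul_add] using this
  -- If the multiplier of the defining function vanished, the gradient 2x of ‖y‖² would have to
  -- vanish on the unit sphere.
  have hb : b ≠ 0 := by
    rintro rfl
    have h1 := hv x
    rw [real_inner_self_eq_norm_sq, hx] at h1
    apply hab
    have : a = 0 := by linarith
    rw [this]; rfl
  refine ⟨-(2 * a) / b, fun v => ?_⟩
  rw [← hd]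
  have := hv v
  field_simp
  linarith

/-- The conserved current does not flow through the horizon. -/
lemma current_boundary {Φ : M → ℝ} (hΦ : ContMDiff (𝓡 4) 𝓘(ℝ, ℝ) ∞ Φ) {Φc : ℝ → ℝ → ℝ}
    (hΦc : ∀ x : Fin 4 → ℝ, S.rH < x 1 → x 2 ∈ Icc 0 Real.pi →
      Φ (S.Ψ (polar x)) = Φc (x 1) (x 2)) {x : E3} (hx : ‖x‖ = 1) :
    (x : Fin 3 → ℝ) ⬝ᵥ Sig.current Φ x = 0 := by
  -- At a bifurcation point the current vanishes because it is linear in `X`.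
  by_cases hX : S.XE (Sig.σ x) = 0
  · simp [current, hX, Matrix.mulVec, dotProduct]
  have hxo : x ∈ outerRegion := hx.ge
  obtain ⟨hnull, k, hk⟩ := Sig.exists_form_XE_dσ hx hX
  obtain ⟨η, hη⟩ := Sig.exists_decomposition hxo (S.XE (Sig.σ x))
  have hpd := Sig.induced_posDef hxo
  have hdet : IsUnit (Sig.induced x).det := hpd.det_pos.ne'.isUnit
  set X := S.XE (Sig.σ x) with hXdef
  set Xn := -S.g.form (Sig.σ x) (Sig.nE x) X with hXn
  set u : E3 := WithLp.toLp 2 ((Sig.induced x)⁻¹ *ᵥ (x : Fin 3 → ℝ)) with hu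
  have hsymm : ((Sig.induced x)⁻¹)ᵀ = (Sig.induced x)⁻¹ := by
    have := hpd.isHermitian.inv
    rwa [Matrix.IsHermitian, Matrix.conjTranspose_eq_transpose_of_trivial] at this
  have hΦX := Sig.dE_XE hΦ hΦc hxo
  have hsum (l : E4 →L[ℝ] ℝ) : ∑ j, u j * l (Sig.dσ x (EuclideanSpace.single j 1)) = l (Sig.dσ x u) := by
    conv_rhs => rw [E3_eq_sum u]
    simp [map_sum]
  have hform (v : E3) : S.g.form (Sig.σ x) X (Sig.dσ x v)
      = (η : Fin 3 → ℝ) ⬝ᵥ (Sig.induced x *ᵥ v) := by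
    rw [← form_dσ]
    conv_lhs => rw [hη]
    simp [Sig.form_nE_dσ hxo]
  have hinner (v : E3) : inner ℝ x v = (x : Fin 3 → ℝ) ⬝ᵥ (v : Fin 3 → ℝ) := by
    rw [EuclideanSpace.inner_eq_star_dotProduct, star_trivial, dotProduct_comm]
  -- The tangential part of `X` pairs with tangent vectors as k times the conormal x, so it is k
  -- times the raised conormal `u`.
  have hηu : η = k • u := by
    have h1 : Sig.induced x *ᵥ (η : Fin 3 → ℝ) = k • (x : Fin 3 → ℝ) := by
      ext j
      have h2 := hform (EuclideanSpace.single j 1)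
      have h3 : (Sig.induced x)ᵀ = Sig.induced x := by
        have := hpd.isHermitian
        rwa [Matrix.IsHermitian, Matrix.conjTranspose_eq_transpose_of_trivial] at this
      rw [hk, hinner, Matrix.dotProduct_mulVec, ← Matrix.mulVec_transpose, h3] at h2
      simpa using h2.symm
    have h4 : (η : Fin 3 → ℝ) = k • ((Sig.induced x)⁻¹ *ᵥ (x : Fin 3 → ℝ)) := by
      rw [← Matrix.mulVec_smul, ← h1, Matrix.mulVec_mulVec, Matrix.nonsing_inv_mul _ hdet,
        Matrix.one_mulVec]
    ext j
    exact congrFun h4 j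
  have hmain : (x : Fin 3 → ℝ) ⬝ᵥ Sig.current Φ x = √(Sig.induced x).det *
      (Xn * dE Φ (Sig.σ x) (Sig.dσ x u)
        + dE Φ (Sig.σ x) (Sig.nE x) * S.g.form (Sig.σ x) X (Sig.dσ x u)) := by
    rw [current, dotProduct_smul, Matrix.dotProduct_mulVec, ← Matrix.mulVec_transpose, hsymm,
      smul_eq_mul, ← hsum, ← hsum]
    congr 1
    simp only [dotProduct, mul_add, Finset.sum_add_distrib, Finset.mul_sum]
    congr 1 <;> exact Finset.sum_congr rfl fun j _ => by simp only [hu, ← hXdef, ← hXn]; ring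
  have e1 : Xn * dE Φ (Sig.σ x) (Sig.nE x) + k * dE Φ (Sig.σ x) (Sig.dσ x u) = 0 := by
    have h := hΦX
    rw [← hXdef, hη, hηu] at h
    simpa using h
  have e2 : k * S.g.form (Sig.σ x) X (Sig.dσ x u) = Xn ^ 2 := by
    have h : S.g.form (Sig.σ x) X (Xn • Sig.nE x + Sig.dσ x η) = 0 := by rw [← hη]; exact hnull
    rw [hηu, map_add, map_smul, map_smul, map_smul, LorentzMetric.form_symm] at h
    have h5 : S.g.form (Sig.σ x) (Sig.nE x) X = -Xn := by rw [hXn, neg_neg]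
    rw [h5] at h
    simp only [smul_eq_mul] at h
    linarith
  -- If k were zero, nullness would kill the normal part of `X` as well, and `X` would vanish.
  have hk0 : k ≠ 0 := by
    rintro rfl
    have hXn0 : Xn = 0 := by
      rw [zero_mul] at e2; exact pow_eq_zero_iff two_ne_zero |>.1 e2.symm
    apply hX
    rw [hη, hηu, hXn0]
    simp
  rw [hmain]
  -- After multiplication by k, invariance of `Φ` (`e1`) turns the first term into −Xn² dΦ(n), and
  -- nullness (`e2`) turns the second into +Xn² dΦ(n).
  have e3 : k * (Xn * dE Φ (Sig.σ x) (Sig.dσ x u)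
        + dE Φ (Sig.σ x) (Sig.nE x) * S.g.form (Sig.σ x) X (Sig.dσ x u)) = 0 := by
    linear_combination Xn * e1 + dE Φ (Sig.σ x) (Sig.nE x) * e2
  rcases mul_eq_zero.1 e3 with h | h
  · exact absurd h hk0
  · rw [h, mul_zero]

end PartialCauchySurface

end Horizon

/-! ### The local conservation law. -/

section Conservation

variable {z : Fin 3 → ℝ}

lemma pd_mul {f g : (Fin 3 → ℝ) → ℝ} (i : Fin 3) (hf : DifferentiableAt ℝ f z)
    (hg : DifferentiableAt ℝ g z) :
    pd i (fun z => f z * g z) z = pd i f z * g z + f z * pd i g z := by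
  have h : fderiv ℝ (fun z => f z * g z) z = _ := (hf.hasFDerivAt.mul hg.hasFDerivAt).fderiv
  rw [pd, h]; simp [pd]; ring

lemma pd_add {f g : (Fin 3 → ℝ) → ℝ} (i : Fin 3) (hf : DifferentiableAt ℝ f z)
    (hg : DifferentiableAt ℝ g z) :
    pd i (fun z => f z + g z) z = pd i f z + pd i g z := by
  have h : fderiv ℝ (fun z => f z + g z) z = _ := (hf.hasFDerivAt.add hg.hasFDerivAt).fderiv
  rw [pd, h]; simp [pd]

lemma pd_sub {f g : (Fin 3 → ℝ) → ℝ} (i : Fin 3) (hf : DifferentiableAt ℝ f z)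
    (hg : DifferentiableAt ℝ g z) :
    pd i (fun z => f z - g z) z = pd i f z - pd i g z := by
  have h : fderiv ℝ (fun z => f z - g z) z = _ := (hf.hasFDerivAt.sub hg.hasFDerivAt).fderiv
  rw [pd, h]; simp [pd]

lemma pd_const (i : Fin 3) (c : ℝ) : pd i (fun _ => c) z = 0 := by simp [pd]

lemma contDiffOn_pd {U : Set (Fin 3 → ℝ)} (hU : IsOpen U) {f : (Fin 3 → ℝ) → ℝ}
    (hf : ContDiffOn ℝ ∞ f U) (i : Fin 3) : ContDiffOn ℝ ∞ (pd i f) U :=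
  (hf.fderiv_of_isOpen hU (by simp)).clm_apply contDiffOn_const

lemma pd_pd_comm {f : (Fin 3 → ℝ) → ℝ} (hf : ContDiffAt ℝ ∞ f z) (i j : Fin 3) :
    pd i (pd j f) z = pd j (pd i f) z := by
  have hd : DifferentiableAt ℝ (fderiv ℝ f) z :=
    (hf.fderiv_right (m := ∞) (by simp)).differentiableAt (by simp)
  have h (i j : Fin 3) : pd i (pd j f) z = fderiv ℝ (fderiv ℝ f) z (Pi.single i 1) (Pi.single j 1) := by
    have : fderiv ℝ (pd j f) z = _ := (hd.hasFDerivAt.clm_apply (hasFDerivAt_const _ z)).fderiv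
    rw [pd, this]; simp
  rw [h, h]
  exact (hf.isSymmSndFDerivAt (by simpa using WithTop.coe_le_coe.2 (le_top : (2 : ℕ∞) ≤ ⊤))) _ _

lemma pd_invariant {f : (Fin 3 → ℝ) → ℝ} (hinv : ∀ (z : Fin 3 → ℝ) (c : ℝ), f (z + c • Pi.single 2 1) = f z)
    (i : Fin 3) (z : Fin 3 → ℝ) (c : ℝ) : pd i f (z + c • Pi.single 2 1) = pd i f z := by
  have h : (fun y => f (y + c • Pi.single 2 1)) = f := funext fun y => hinv y c
  rw [pd, pd, ← fderiv_comp_add_right, h]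

variable {M : Type*} [TopologicalSpace M] [ChartedSpace E4 M] [IsManifold (𝓡 4) ∞ M]
  (S : CircularBlackHole M)

lemma hat_pos {rH : ℝ} (h0 : 0 ≤ rH) {f : ℝ → ℝ → ℝ}
    (hf : ∀ r > rH, ∀ θ ∈ Icc 0 Real.pi, 0 < f r θ) (hz : z ∈ zdom rH) : 0 < hat f z :=
  hf _ (sphz_mem h0 hz) _ (polarAngle_mem _)

lemma contDiffOn_radialFlux {Φc : ℝ → ℝ → ℝ} (hΦ : SmoothExterior S.rH Φc) :
    ContDiffOn ℝ ∞ (radialFlux S Φc) (zdom S.rH) := by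
  have h0 := S.rH_nonneg
  have hN := contDiffOn_hat h0 S.N_smooth
  have hA := contDiffOn_hat h0 S.A_smooth
  have hB := contDiffOn_hat h0 S.B_smooth
  have hp := contDiffOn_pd (isOpen_zdom S.rH) (contDiffOn_hat h0 hΦ) 0
  have hr : ContDiffOn ℝ ∞ (fun z : Fin 3 → ℝ => z 0) (zdom S.rH) := by fun_prop
  have hs : ContDiffOn ℝ ∞ (fun z : Fin 3 → ℝ => Real.sin (z 1)) (zdom S.rH) := by fun_prop
  exact (((hN.mul ((hr.mul hB).pow 2)).div hA fun z hz => (hat_pos h0 S.A_pos hz).ne').mul hs).mul hp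

lemma contDiffOn_polarFlux {Φc : ℝ → ℝ → ℝ} (hΦ : SmoothExterior S.rH Φc) :
    ContDiffOn ℝ ∞ (polarFlux S Φc) (zdom S.rH) := by
  have h0 := S.rH_nonneg
  have hN := contDiffOn_hat h0 S.N_smooth
  have hA := contDiffOn_hat h0 S.A_smooth
  have hp := contDiffOn_pd (isOpen_zdom S.rH) (contDiffOn_hat h0 hΦ) 1
  have hs : ContDiffOn ℝ ∞ (fun z : Fin 3 → ℝ => Real.sin (z 1)) (zdom S.rH) := by fun_prop
  exact ((hN.mul hA).mul hs).mul hp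

lemma radialFlux_invariant (Φc : ℝ → ℝ → ℝ) (z : Fin 3 → ℝ) (c : ℝ) :
    radialFlux S Φc (z + c • Pi.single 2 1) = radialFlux S Φc z := by
  simp only [radialFlux, hat_add, pd_invariant (hat_add Φc)]
  simp

lemma polarFlux_invariant (Φc : ℝ → ℝ → ℝ) (z : Fin 3 → ℝ) (c : ℝ) :
    polarFlux S Φc (z + c • Pi.single 2 1) = polarFlux S Φc z := by
  simp only [polarFlux, hat_add, pd_invariant (hat_add Φc)]
  simp

/-- The inverse of the Hartle–Thorne metric. -/
def hartleThorneInv (N A B w : ℝ → ℝ → ℝ) (x : Fin 4 → ℝ) : Matrix (Fin 4) (Fin 4) ℝ :=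
  let n := (N (x 1) (x 2) ^ 2)⁻¹
  let W := w (x 1) (x 2)
  let R := x 1 * B (x 1) (x 2)
  !![-n, 0, 0, -(W * n); 0, (A (x 1) (x 2) ^ 2)⁻¹, 0, 0; 0, 0, (R ^ 2)⁻¹, 0;
    -(W * n), 0, 0, ((R * Real.sin (x 2)) ^ 2)⁻¹ - W ^ 2 * n]

lemma inv_hartleThorne {x : Fin 4 → ℝ} (hx : x ∈ polarExterior S.rH) :
    (hartleThorne S.N S.A S.B S.w x)⁻¹ = hartleThorneInv S.N S.A S.B S.w x := by
  have hθ : x 2 ∈ Icc 0 Real.pi := ⟨hx.2.1.le, hx.2.2.le⟩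
  have hr : 0 < x 1 := S.rH_nonneg.trans_lt hx.1
  have hN := S.N_pos _ hx.1 _ hθ
  have hA := S.A_pos _ hx.1 _ hθ
  have hB := S.B_pos _ hx.1 _ hθ
  have hs := Real.sin_pos_of_mem_Ioo hx.2
  apply Matrix.inv_eq_right_inv
  ext i j
  rw [Matrix.mul_apply, Fin.sum_univ_four]
  fin_cases i <;> fin_cases j <;> simp [hartleThorne, hartleThorneInv] <;> field_simp <;> ring

/-- The scalar field equation as a conservation law in spherical coordinates. -/
lemma field_equation {ε : ℝ} {Φc Fc : ℝ → ℝ → ℝ} (hΦ : SmoothExterior S.rH Φc)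
    (hE : ∀ x ∈ polarExterior S.rH,
      dAlembertian (hartleThorne S.N S.A S.B S.w) (fun z => Φc (z 1) (z 2)) x
        + ε * Fc (x 1) (x 2) = 0) (hz : z ∈ zdom S.rH) (h1 : z 1 ∈ Ioo 0 Real.pi) :
    pd 0 (radialFlux S Φc) z + pd 1 (polarFlux S Φc) z
      = -ε * (hat S.N z * hat S.A z * (z 0 * hat S.B z) ^ 2 * Real.sin (z 1)) * Fc (z 0) (z 1) := by
  have hθ : z 1 ∈ Icc 0 Real.pi := ⟨h1.1.le, h1.2.le⟩
  have hr : 0 < z 0 := S.rH_nonneg.trans_lt hz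
  set x : Fin 4 → ℝ := ![0, z 0, z 1, 0] with hxdef
  have hx : x ∈ polarExterior S.rH := ⟨hz, h1⟩
  have hnhds := (isOpen_polarExterior S.rH).mem_nhds hx
  have hU := (isOpen_zdom S.rH).mem_nhds hz
  -- The inverse metric does not mix (r, θ) with (t, φ), so a function of (r, θ) has flux only in
  -- the r and θ directions.
  have hflux : ∀ y ∈ polarExterior S.rH, ∀ μ : Fin 4,
      √|(hartleThorne S.N S.A S.B S.w y).det| * ∑ ν, (hartleThorne S.N S.A S.B S.w y)⁻¹ μ ν
        * pderiv4 ν (fun z => Φc (z 1) (z 2)) y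
      = ![0, radialFlux S Φc ![y 1, y 2, z 2], polarFlux S Φc ![y 1, y 2, z 2], 0] μ := by
    intro y hy μ
    have hyθ : y 2 ∈ Icc 0 Real.pi := ⟨hy.2.1.le, hy.2.2.le⟩
    have hyr : 0 < y 1 := S.rH_nonneg.trans_lt hy.1
    have hN := S.N_pos _ hy.1 _ hyθ
    have hA := S.A_pos _ hy.1 _ hyθ
    have hB := S.B_pos _ hy.1 _ hyθ
    have hs := Real.sin_pos_of_mem_Ioo hy.2
    have hp (v : Fin 4 → ℝ) := pd_hat_of_polar S.rH_nonneg hΦ hy ![y 1, y 2, z 2] rfl rfl v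
    have hD : 0 < htDensity S.N S.A S.B y := by unfold htDensity; positivity
    have hsq : √|(hartleThorne S.N S.A S.B S.w y).det| = htDensity S.N S.A S.B y := by
      rw [hartleThorne_det, abs_neg, abs_of_nonneg (sq_nonneg _), Real.sqrt_sq hD.le]
    have e (f : ℝ → ℝ → ℝ) : hat f ![y 1, y 2, z 2] = f (y 1) (y 2) := hat_eq f hyr hyθ
    rw [hsq, inv_hartleThorne S hy, Fin.sum_univ_four]
    simp only [pderiv4, hp, radialFlux, polarFlux, e]
    fin_cases μ
    · simp [hartleThorneInv]
    · simp [hartleThorneInv, htDensity]; field_simp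
    · simp [hartleThorneInv, htDensity]; field_simp
    · simp [hartleThorneInv]
  have hcongr (μ : Fin 4) : pderiv4 μ (fun y => √|(hartleThorne S.N S.A S.B S.w y).det| * ∑ ν,
      (hartleThorne S.N S.A S.B S.w y)⁻¹ μ ν * pderiv4 ν (fun z => Φc (z 1) (z 2)) y) x
      = pderiv4 μ (fun y =>
        ![0, radialFlux S Φc ![y 1, y 2, z 2], polarFlux S Φc ![y 1, y 2, z 2], 0] μ) x := by
    have : (fun y => √|(hartleThorne S.N S.A S.B S.w y).det| * ∑ ν,
      (hartleThorne S.N S.A S.B S.w y)⁻¹ μ ν * pderiv4 ν (fun z => Φc (z 1) (z 2)) y) =ᶠ[𝓝 x]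
      (fun y => ![0, radialFlux S Φc ![y 1, y 2, z 2], polarFlux S Φc ![y 1, y 2, z 2], 0] μ) := by
      filter_upwards [hnhds] with y hy using hflux y hy μ
    rw [pderiv4, pderiv4, this.fderiv_eq]
  have d1 : DifferentiableAt ℝ (radialFlux S Φc) z :=
    ((contDiffOn_radialFlux S hΦ).contDiffAt hU).differentiableAt (by simp)
  have d2 : DifferentiableAt ℝ (polarFlux S Φc) z :=
    ((contDiffOn_polarFlux S hΦ).contDiffAt hU).differentiableAt (by simp)
  have p1 := fderiv_comp_polar (x := x) rfl rfl d1 (Pi.single 1 1)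
  have p2 := fderiv_comp_polar (x := x) rfl rfl d2 (Pi.single 2 1)
  simp at p1 p2
  have h := hE x hx
  have hN := S.N_pos _ hx.1 _ hθ
  have hA := S.A_pos _ hx.1 _ hθ
  have hB := S.B_pos _ hx.1 _ hθ
  have hs := Real.sin_pos_of_mem_Ioo hx.2
  have hD : 0 < htDensity S.N S.A S.B x := by
    have : 0 < x 1 := hr
    unfold htDensity; positivity
  have hsq : √|(hartleThorne S.N S.A S.B S.w x).det| = htDensity S.N S.A S.B x := by
    rw [hartleThorne_det, abs_neg, abs_of_nonneg (sq_nonneg _), Real.sqrt_sq hD.le]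
  rw [dAlembertian, hsq, Fin.sum_univ_four, hcongr, hcongr, hcongr, hcongr] at h
  simp only [pderiv4, Matrix.cons_val, p1, p2, fderiv_fun_const, Pi.zero_apply,
    zero_apply] at h
  have hDz : hat S.N z * hat S.A z * (z 0 * hat S.B z) ^ 2 * Real.sin (z 1)
      = htDensity S.N S.A S.B x := by
    rw [hat_eq S.N hr hθ, hat_eq S.A hr hθ, hat_eq S.B hr hθ]; rfl
  have hF : Fc (x 1) (x 2) = Fc (z 0) (z 1) := rfl
  rw [hF] at h
  rw [hDz]
  field_simp at h
  linarith

namespace PartialCauchySurface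

variable {S} (Sig : PartialCauchySurface S)

lemma contDiffOn_lapseFactor : ContDiffOn ℝ ∞ Sig.lapseFactor (zdom S.rH) :=
  contDiffOn_const.sub ((contDiffOn_const.sub (contDiffOn_hat S.rH_nonneg S.w_smooth)).mul
    (contDiffOn_pd (isOpen_zdom S.rH) Sig.contDiffOn_T 2))

lemma contDiffOn_currentPolar {Φc : ℝ → ℝ → ℝ} (hΦ : SmoothExterior S.rH Φc) :
    ContDiffOn ℝ ∞ (Sig.currentPolar Φc) (zdom S.rH) := by
  have hU := isOpen_zdom S.rH
  have ha := contDiffOn_radialFlux S hΦ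
  have hb := contDiffOn_polarFlux S hΦ
  have hL := Sig.contDiffOn_lapseFactor
  have hT := Sig.contDiffOn_T
  have hw := contDiffOn_hat S.rH_nonneg S.w_smooth
  rw [contDiffOn_pi]
  intro i
  fin_cases i
  · exact ha.mul hL
  · exact hb.mul hL
  · exact ((contDiffOn_const.sub hw).mul ((ha.mul (contDiffOn_pd hU hT 0)).add
      (hb.mul (contDiffOn_pd hU hT 1)))).sub (((ha.mul (contDiffOn_pd hU hw 0)).add
      (hb.mul (contDiffOn_pd hU hw 1))).mul hT)

/-- The divergence of the conserved current. -/
lemma divergence_currentPolar {Φc : ℝ → ℝ → ℝ} (hΦ : SmoothExterior S.rH Φc)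
    (hz : z ∈ zdom S.rH) :
    ∑ i, pd i (fun z => Sig.currentPolar Φc z i) z
      = (pd 0 (radialFlux S Φc) z + pd 1 (polarFlux S Φc) z) * Sig.lapseFactor z := by
  have hU := isOpen_zdom S.rH
  have hn := hU.mem_nhds hz
  have D {f : (Fin 3 → ℝ) → ℝ} (hf : ContDiffOn ℝ ∞ f (zdom S.rH)) : DifferentiableAt ℝ f z :=
    (hf.contDiffAt hn).differentiableAt (by simp)
  have cw := contDiffOn_hat S.rH_nonneg S.w_smooth
  have ha := D (contDiffOn_radialFlux S hΦ)
  have hb := D (contDiffOn_polarFlux S hΦ)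
  have hL := D Sig.contDiffOn_lapseFactor
  have hT := D Sig.contDiffOn_T
  have hTi (i : Fin 3) := D (contDiffOn_pd hU Sig.contDiffOn_T i)
  have hw := D cw
  have hwi (i : Fin 3) := D (contDiffOn_pd hU cw i)
  have hO : DifferentiableAt ℝ (fun y => S.Ω - hat S.w y) z := hw.const_sub _
  have hOi (i : Fin 3) : pd i (fun y => S.Ω - hat S.w y) z = -pd i (hat S.w) z := by
    rw [pd_sub i (differentiableAt_const _) hw, pd_const]; ring
  have a2 := pd_two_of_invariant (radialFlux_invariant S Φc) ha
  have b2 := pd_two_of_invariant (polarFlux_invariant S Φc) hb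
  have w2 := pd_two_w (S := S) hz
  have w2i (i : Fin 3) := pd_two_of_invariant (pd_invariant (hat_add S.w) i) (hwi i)
  have hLi (i : Fin 3) : pd i Sig.lapseFactor z
      = pd i (hat S.w) z * pd 2 Sig.T z - (S.Ω - hat S.w z) * pd i (pd 2 Sig.T) z := by
    have : Sig.lapseFactor = fun y => 1 - (S.Ω - hat S.w y) * pd 2 Sig.T y := rfl
    rw [this, pd_sub i (differentiableAt_const _) (hO.fun_mul (hTi 2)), pd_const,
      pd_mul i hO (hTi 2), hOi]
    ring
  -- The second derivatives of T coming from the lapse factor cancel against those of the azimuthal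
  -- component by symmetry. The derivatives of ω cancel likewise, which is the purpose of the term
  -- with T in that component.
  have hc (i : Fin 3) : pd 2 (pd i Sig.T) z = pd i (pd 2 Sig.T) z :=
    pd_pd_comm (Sig.contDiffOn_T.contDiffAt hn) _ _
  have e0 : pd 0 (fun z => Sig.currentPolar Φc z 0) z = _ := pd_mul 0 ha hL
  have e1 : pd 1 (fun z => Sig.currentPolar Φc z 1) z = _ := pd_mul 1 hb hL
  have e2 : pd 2 (fun z => Sig.currentPolar Φc z 2) z = _ :=
    pd_sub 2 (hO.fun_mul ((ha.fun_mul (hTi 0)).fun_add (hb.fun_mul (hTi 1))))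
      (((ha.fun_mul (hwi 0)).fun_add (hb.fun_mul (hwi 1))).fun_mul hT)
  rw [pd_mul 2 hO ((ha.fun_mul (hTi 0)).fun_add (hb.fun_mul (hTi 1))),
    pd_add 2 (ha.fun_mul (hTi 0)) (hb.fun_mul (hTi 1)), pd_mul 2 ha (hTi 0), pd_mul 2 hb (hTi 1),
    pd_mul 2 ((ha.fun_mul (hwi 0)).fun_add (hb.fun_mul (hwi 1))) hT,
    pd_add 2 (ha.fun_mul (hwi 0)) (hb.fun_mul (hwi 1)), pd_mul 2 ha (hwi 0), pd_mul 2 hb (hwi 1),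
    hOi, a2, b2, w2, w2i, w2i, hc, hc] at e2
  rw [Fin.sum_univ_three, e0, e1, e2, hLi, hLi]
  ring

end PartialCauchySurface

end Conservation

/-! ### Asymptotic expansions and their derivatives. -/

section Asymptotics

variable {r θ : ℝ}

lemma hasDerivAt_pd_zero {h : (Fin 3 → ℝ) → ℝ} {c : ℝ} (hd : DifferentiableAt ℝ h ![r, θ, c]) :
    HasDerivAt (fun s => h ![s, θ, c]) (pd 0 h ![r, θ, c]) r := by
  have h1 : HasDerivAt (fun s : ℝ => (![s, θ, c] : Fin 3 → ℝ)) (Pi.single 0 1) r := by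
    rw [hasDerivAt_pi]
    intro i
    fin_cases i
    · exact hasDerivAt_id _
    · exact hasDerivAt_const _ _
    · exact hasDerivAt_const _ _
  exact hd.hasFDerivAt.comp_hasDerivAt r h1

lemma hasDerivAt_pd_one {h : (Fin 3 → ℝ) → ℝ} {c : ℝ} (hd : DifferentiableAt ℝ h ![r, θ, c]) :
    HasDerivAt (fun s => h ![r, s, c]) (pd 1 h ![r, θ, c]) θ := by
  have h1 : HasDerivAt (fun s : ℝ => (![r, s, c] : Fin 3 → ℝ)) (Pi.single 1 1) θ := by
    rw [hasDerivAt_pi]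
    intro i
    fin_cases i
    · exact hasDerivAt_const _ _
    · exact hasDerivAt_id _
    · exact hasDerivAt_const _ _
  exact hd.hasFDerivAt.comp_hasDerivAt θ h1

lemma hasDerivAt_pd_two {h : (Fin 3 → ℝ) → ℝ} {c : ℝ} (hd : DifferentiableAt ℝ h ![r, θ, c]) :
    HasDerivAt (fun s => h ![r, θ, s]) (pd 2 h ![r, θ, c]) c := by
  have h1 : HasDerivAt (fun s : ℝ => (![r, θ, s] : Fin 3 → ℝ)) (Pi.single 2 1) c := by
    rw [hasDerivAt_pi]
    intro i
    fin_cases i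
    · exact hasDerivAt_const _ _
    · exact hasDerivAt_const _ _
    · exact hasDerivAt_id _
  exact hd.hasFDerivAt.comp_hasDerivAt c h1

lemma IsBigOInv.tendsto {k : ℕ} {f : ℝ → ℝ → ℝ} (hf : IsBigOInv k f) {i j m : ℕ}
    (hij : i + j ≤ 2) (hm : m < k + i) (hθ : θ ∈ Ioo 0 Real.pi) :
    Tendsto (fun r => r ^ m * pderivPolar i j f r θ) atTop (𝓝 0) := by
  obtain ⟨C, R, h⟩ := hf i j hij
  refine squeeze_zero_norm' (a := fun r => |C| * r⁻¹) ?_ ?_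
  · filter_upwards [eventually_gt_atTop R, eventually_ge_atTop 1] with r hr h1
    have hr0 : 0 < r := by linarith
    rw [Real.norm_eq_abs, abs_mul, abs_of_nonneg (by positivity)]
    calc r ^ m * |pderivPolar i j f r θ| ≤ r ^ m * (|C| / r ^ (m + 1)) := by
          gcongr
          refine (h r hr θ hθ).trans (div_le_div₀ (abs_nonneg C) (le_abs_self C) (by positivity) ?_)
          exact pow_le_pow_right₀ h1 (by omega)
      _ = |C| * r⁻¹ := by field_simp; ring
  · simpa using tendsto_inv_atTop_zero.const_mul |C|

section Derivatives

variable {rH : ℝ} (h0 : 0 ≤ rH) {f : ℝ → ℝ → ℝ} (hf : SmoothExterior rH f)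
include h0 hf

lemma hasDerivAt_radial (hr : rH < r) (hθ : θ ∈ Icc 0 Real.pi) :
    HasDerivAt (fun s => f s θ) (pd 0 (hat f) ![r, θ, 0]) r := by
  have hd : DifferentiableAt ℝ (hat f) ![r, θ, 0] := ((contDiffOn_hat h0 hf).contDiffAt
    ((isOpen_zdom _).mem_nhds hr)).differentiableAt (by simp)
  refine (hasDerivAt_pd_zero hd).congr_of_eventuallyEq ?_
  filter_upwards [lt_mem_nhds hr] with s hs
  exact (hat_eq f (z := ![s, θ, 0]) (h0.trans_lt hs) hθ).symm

lemma hasDerivAt_polar (hr : rH < r) (hθ : θ ∈ Ioo 0 Real.pi) :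
    HasDerivAt (fun s => f r s) (pd 1 (hat f) ![r, θ, 0]) θ := by
  have hd : DifferentiableAt ℝ (hat f) ![r, θ, 0] := ((contDiffOn_hat h0 hf).contDiffAt
    ((isOpen_zdom _).mem_nhds hr)).differentiableAt (by simp)
  refine (hasDerivAt_pd_one hd).congr_of_eventuallyEq ?_
  filter_upwards [isOpen_Ioo.mem_nhds hθ] with s hs
  exact (hat_eq f (z := ![r, s, 0]) (h0.trans_lt hr) ⟨hs.1.le, hs.2.le⟩).symm

lemma hasDerivAt_radial_radial (hr : rH < r) :
    HasDerivAt (fun s => pd 0 (hat f) ![s, θ, 0]) (pd 0 (pd 0 (hat f)) ![r, θ, 0]) r :=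
  hasDerivAt_pd_zero (((contDiffOn_pd (isOpen_zdom rH) (contDiffOn_hat h0 hf) 0).contDiffAt
    ((isOpen_zdom _).mem_nhds hr)).differentiableAt (by simp))

lemma hasDerivAt_polar_polar (hr : rH < r) :
    HasDerivAt (fun s => pd 1 (hat f) ![r, s, 0]) (pd 1 (pd 1 (hat f)) ![r, θ, 0]) θ :=
  hasDerivAt_pd_one (((contDiffOn_pd (isOpen_zdom rH) (contDiffOn_hat h0 hf) 1).contDiffAt
    ((isOpen_zdom _).mem_nhds hr)).differentiableAt (by simp))

lemma tendsto_hat_one (ha : IsBigOInv 1 fun r θ => f r θ - 1) (hθ : θ ∈ Ioo 0 Real.pi) :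
    Tendsto (fun r => hat f ![r, θ, 0]) atTop (𝓝 1) ∧
    Tendsto (fun r => r * pd 0 (hat f) ![r, θ, 0]) atTop (𝓝 0) ∧
    Tendsto (fun r => pd 1 (hat f) ![r, θ, 0]) atTop (𝓝 0) := by
  have hθ' : θ ∈ Icc 0 Real.pi := ⟨hθ.1.le, hθ.2.le⟩
  refine ⟨?_, ?_, ?_⟩
  · have h := (ha.tendsto (i := 0) (j := 0) (m := 0) (by simp) (by simp) hθ).const_add 1
    rw [add_zero] at h
    refine h.congr' ?_
    filter_upwards [eventually_gt_atTop 0] with r hr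
    rw [hat_eq f (z := ![r, θ, 0]) hr hθ']
    simp [pderivPolar]
  · refine (ha.tendsto (i := 1) (j := 0) (m := 1) (by simp) (by simp) hθ).congr' ?_
    filter_upwards [eventually_gt_atTop rH] with r hr
    have := ((hasDerivAt_radial h0 hf hr hθ').sub_const 1).deriv
    simp [pderivPolar, iteratedDeriv_one, this]
  · refine (ha.tendsto (i := 0) (j := 1) (m := 0) (by simp) (by simp) hθ).congr' ?_
    filter_upwards [eventually_gt_atTop rH] with r hr
    have := (hasDerivAt_polar h0 hf hr hθ).deriv
    simp [pderivPolar, iteratedDeriv_one, ← this]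

end Derivatives

section Expansion

variable {rH : ℝ} (h0 : 0 ≤ rH) {Φc : ℝ → ℝ → ℝ} (hΦ : SmoothExterior rH Φc)
  {μ₁ μ₂ : ℝ → ℝ}
include h0 hΦ

/-- This and the next three lemmas express derivatives of the remainder through derivatives of the
smooth extension `hat`, so that the remainder bounds become limits for the derivatives of the field.
-/
lemma pderivPolar_one_zero (hr : rH < r) (hθ : θ ∈ Icc 0 Real.pi) :
    pderivPolar 1 0 (fun r θ => Φc r θ - (μ₁ θ / r + μ₂ θ / r ^ 2)) r θ
      = pd 0 (hat Φc) ![r, θ, 0] + (μ₁ θ / r ^ 2 + 2 * μ₂ θ / r ^ 3) := by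
  have hr0 : r ≠ 0 := (h0.trans_lt hr).ne'
  have h1 : HasDerivAt (fun s : ℝ => μ₁ θ / s + μ₂ θ / s ^ 2)
      (-(μ₁ θ / r ^ 2 + 2 * μ₂ θ / r ^ 3)) r := by
    refine (((hasDerivAt_inv hr0).const_mul (μ₁ θ)).fun_add
      (((hasDerivAt_pow 2 r).fun_inv (pow_ne_zero 2 hr0)).const_mul (μ₂ θ))).congr_deriv ?_
    simp
    field_simp
    ring
  have h2 := ((hasDerivAt_radial h0 hΦ hr hθ).sub h1).deriv
  simp only [pderivPolar, iteratedDeriv_one, iteratedDeriv_zero]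
  exact h2.trans (by ring)

lemma pderivPolar_two_zero (hr : rH < r) (hθ : θ ∈ Icc 0 Real.pi) :
    pderivPolar 2 0 (fun r θ => Φc r θ - (μ₁ θ / r + μ₂ θ / r ^ 2)) r θ
      = pd 0 (pd 0 (hat Φc)) ![r, θ, 0] - (2 * μ₁ θ / r ^ 3 + 6 * μ₂ θ / r ^ 4) := by
  have hr0 : r ≠ 0 := (h0.trans_lt hr).ne'
  have h1 : HasDerivAt (fun s : ℝ => μ₁ θ / s ^ 2 + 2 * μ₂ θ / s ^ 3)
      (-(2 * μ₁ θ / r ^ 3 + 6 * μ₂ θ / r ^ 4)) r := by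
    refine ((((hasDerivAt_pow 2 r).fun_inv (pow_ne_zero 2 hr0)).const_mul (μ₁ θ)).fun_add
      (((hasDerivAt_pow 3 r).fun_inv (pow_ne_zero 3 hr0)).const_mul (2 * μ₂ θ))).congr_deriv ?_
    simp
    field_simp
    ring
  have h2 := ((hasDerivAt_radial_radial h0 hΦ (θ := θ) hr).add h1).deriv
  have h3 : (fun s => pderivPolar 1 0 (fun r θ => Φc r θ - (μ₁ θ / r + μ₂ θ / r ^ 2)) s θ)
      =ᶠ[𝓝 r] fun s => pd 0 (hat Φc) ![s, θ, 0] + (μ₁ θ / s ^ 2 + 2 * μ₂ θ / s ^ 3) := by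
    filter_upwards [lt_mem_nhds hr] with s hs using pderivPolar_one_zero h0 hΦ hs hθ
  have h4 : pderivPolar 2 0 (fun r θ => Φc r θ - (μ₁ θ / r + μ₂ θ / r ^ 2)) r θ
      = deriv (fun s => pderivPolar 1 0 (fun r θ => Φc r θ - (μ₁ θ / r + μ₂ θ / r ^ 2)) s θ) r := by
    simp only [pderivPolar, iteratedDeriv_succ, iteratedDeriv_zero]
  rw [h4, h3.deriv_eq]
  exact h2.trans (by ring)

variable (hμ₁ : ContDiffOn ℝ 2 μ₁ (Icc 0 Real.pi)) (hμ₂ : ContDiffOn ℝ 2 μ₂ (Icc 0 Real.pi))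
include hμ₁ hμ₂

lemma pderivPolar_zero_one (hr : rH < r) (hθ : θ ∈ Ioo 0 Real.pi) :
    pderivPolar 0 1 (fun r θ => Φc r θ - (μ₁ θ / r + μ₂ θ / r ^ 2)) r θ
      = pd 1 (hat Φc) ![r, θ, 0] - (deriv μ₁ θ / r + deriv μ₂ θ / r ^ 2) := by
  have hn := Icc_mem_nhds hθ.1 hθ.2
  have d1 := ((hμ₁.contDiffAt hn).differentiableAt (by simp)).hasDerivAt
  have d2 := ((hμ₂.contDiffAt hn).differentiableAt (by simp)).hasDerivAt
  have h2 := ((hasDerivAt_polar h0 hΦ hr hθ).sub ((d1.div_const r).add (d2.div_const (r ^ 2)))).deriv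
  simp only [pderivPolar, iteratedDeriv_one, iteratedDeriv_zero]
  exact h2

lemma pderivPolar_zero_two (hr : rH < r) (hθ : θ ∈ Ioo 0 Real.pi) :
    pderivPolar 0 2 (fun r θ => Φc r θ - (μ₁ θ / r + μ₂ θ / r ^ 2)) r θ
      = pd 1 (pd 1 (hat Φc)) ![r, θ, 0] - (deriv (deriv μ₁) θ / r + deriv (deriv μ₂) θ / r ^ 2) := by
  have hn := Icc_mem_nhds hθ.1 hθ.2
  have D {μ : ℝ → ℝ} (hμ : ContDiffOn ℝ 2 μ (Icc 0 Real.pi)) :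
      HasDerivAt (deriv μ) (deriv (deriv μ) θ) θ := by
    have h := (hμ.mono Ioo_subset_Icc_self).deriv_of_isOpen (m := 1) isOpen_Ioo (by norm_num)
    exact ((h.contDiffAt (isOpen_Ioo.mem_nhds hθ)).differentiableAt (by simp)).hasDerivAt
  have d1 := D hμ₁
  have d2 := D hμ₂
  have h2 := ((hasDerivAt_polar_polar h0 hΦ (θ := θ) hr).sub
    ((d1.div_const r).add (d2.div_const (r ^ 2)))).deriv
  have h3 : (fun s => pderivPolar 0 1 (fun r θ => Φc r θ - (μ₁ θ / r + μ₂ θ / r ^ 2)) r s)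
      =ᶠ[𝓝 θ] fun s => pd 1 (hat Φc) ![r, s, 0] - (deriv μ₁ s / r + deriv μ₂ s / r ^ 2) := by
    filter_upwards [isOpen_Ioo.mem_nhds hθ] with s hs
      using pderivPolar_zero_one h0 hΦ hμ₁ hμ₂ hr hs
  have h4 : pderivPolar 0 2 (fun r θ => Φc r θ - (μ₁ θ / r + μ₂ θ / r ^ 2)) r θ
      = deriv (fun s => pderivPolar 0 1 (fun r θ => Φc r θ - (μ₁ θ / r + μ₂ θ / r ^ 2)) r s) θ := by
    simp only [pderivPolar, iteratedDeriv_succ, iteratedDeriv_zero]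
  rw [h4, h3.deriv_eq]
  exact h2

end Expansion

end Asymptotics

/-! ### The leading order of the field at infinity. -/

section Monopole

lemma IsBigOInv.exists_abs_le {f : ℝ → ℝ → ℝ} (hf : IsBigOInv 1 f) {δ : ℝ} (hδ : 0 < δ) :
    ∃ R : ℝ, ∀ r > R, ∀ θ ∈ Ioo 0 Real.pi, |f r θ| ≤ δ := by
  obtain ⟨C, R, h⟩ := hf 0 0 (by simp)
  refine ⟨max R (max 0 (C / δ)), fun r hr θ hθ => ?_⟩
  have hr1 : R < r := (le_max_left _ _).trans_lt hr
  have hr2 : 0 < r := ((le_max_left _ _).trans (le_max_right _ _)).trans_lt hr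
  have hr3 : C / δ < r := ((le_max_right _ _).trans (le_max_right _ _)).trans_lt hr
  have h1 := h r hr1 θ hθ
  simp only [pderivPolar, iteratedDeriv_zero, add_zero, pow_one] at h1
  refine h1.trans ?_
  rw [div_le_iff₀ hr2]
  rw [div_lt_iff₀ hδ] at hr3
  linarith

/-- A `C²` solution of Legendre's equation `(sin θ μ')' = 0` which is regular on the axis is
constant. -/
lemma eq_of_legendre {μ : ℝ → ℝ} (hμ : ContDiffOn ℝ 2 μ (Icc 0 Real.pi))
    (h : ∀ θ ∈ Ioo 0 Real.pi, Real.cos θ * deriv μ θ + Real.sin θ * deriv (deriv μ) θ = 0) :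
    ∀ θ ∈ Icc 0 Real.pi, μ θ = μ 0 := by
  have hd : ∀ θ ∈ Ioo 0 Real.pi, HasDerivAt (fun s => Real.sin s * deriv μ s) 0 θ := by
    intro θ hθ
    have h1 := (hμ.mono Ioo_subset_Icc_self).deriv_of_isOpen (m := 1) isOpen_Ioo (by norm_num)
    have h2 := ((h1.contDiffAt (isOpen_Ioo.mem_nhds hθ)).differentiableAt (by simp)).hasDerivAt
    rw [← h θ hθ]
    exact (Real.hasDerivAt_sin θ).mul h2
  set x₀ := Real.pi / 2
  have hx₀ : x₀ ∈ Ioo 0 Real.pi := ⟨by positivity, half_lt_self Real.pi_pos⟩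
  have hc : ∀ θ ∈ Ioo 0 Real.pi, Real.sin θ * deriv μ θ = Real.sin x₀ * deriv μ x₀ := by
    intro θ hθ
    exact isOpen_Ioo.is_const_of_deriv_eq_zero isPreconnected_Ioo
      (fun s hs => (hd s hs).differentiableAt.differentiableWithinAt)
      (fun s hs => (hd s hs).deriv) hθ hx₀
  have hU : UniqueDiffOn ℝ (Icc 0 Real.pi) := uniqueDiffOn_Icc Real.pi_pos
  have hcont : ContinuousOn (fun s => Real.sin s * derivWithin μ (Icc 0 Real.pi) s)
      (Icc 0 Real.pi) :=
    Real.continuous_sin.continuousOn.mul (hμ.continuousOn_derivWithin hU (by norm_num))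
  have heq : EqOn (fun s => Real.sin s * derivWithin μ (Icc 0 Real.pi) s)
      (fun _ => Real.sin x₀ * deriv μ x₀) (Ioo 0 Real.pi) := by
    intro s hs
    have : derivWithin μ (Icc 0 Real.pi) s = deriv μ s :=
      derivWithin_of_mem_nhds (Icc_mem_nhds hs.1 hs.2)
    simp only [this]
    exact hc s hs
  have heq' := heq.of_subset_closure hcont continuousOn_const Ioo_subset_Icc_self
    (by rw [closure_Ioo Real.pi_pos.ne])
  -- The constant is evaluated on the axis, where sin θ vanishes. Regularity up to the endpoints
  -- enters here and excludes logarithmic solutions.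
  have h0 := heq' (left_mem_Icc.2 Real.pi_pos.le)
  simp only [Real.sin_zero, zero_mul] at h0
  have hzero : ∀ θ ∈ Ioo 0 Real.pi, deriv μ θ = 0 := by
    intro θ hθ
    have := hc θ hθ
    rw [← h0] at this
    exact (mul_eq_zero.1 this).resolve_left (Real.sin_pos_of_mem_Ioo hθ).ne'
  intro θ hθ
  rcases hθ.1.eq_or_lt with rfl | hpos
  · rfl
  have hsub : Icc 0 θ ⊆ Icc 0 Real.pi := Icc_subset_Icc_right hθ.2
  obtain ⟨c, hc, hs⟩ := exists_deriv_eq_slope μ hpos (hμ.continuousOn.mono hsub) fun s hs =>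
    ((hμ.contDiffAt (Icc_mem_nhds hs.1 (hs.2.trans_le hθ.2))).differentiableAt
      (by simp)).differentiableWithinAt
  rw [hzero c ⟨hc.1, hc.2.trans_le hθ.2⟩, eq_comm, div_eq_zero_iff] at hs
  rcases hs with hs | hs <;> linarith

variable {M : Type*} [TopologicalSpace M] [ChartedSpace E4 M] [IsManifold (𝓡 4) ∞ M]
  (S : CircularBlackHole M) {Φc : ℝ → ℝ → ℝ} (hΦ : SmoothExterior S.rH Φc)
  {μ₁ μ₂ : ℝ → ℝ} (hμ₁ : ContDiffOn ℝ 2 μ₁ (Icc 0 Real.pi))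
  (hμ₂ : ContDiffOn ℝ 2 μ₂ (Icc 0 Real.pi))
  (hexp : IsBigOInv 3 (fun r θ => Φc r θ - (μ₁ θ / r + μ₂ θ / r ^ 2))) {θ : ℝ}

include hΦ hexp

lemma tendsto_radial (hθ : θ ∈ Ioo 0 Real.pi) :
    Tendsto (fun r => r ^ 2 * pd 0 (hat Φc) ![r, θ, 0]) atTop (𝓝 (-μ₁ θ)) ∧
    Tendsto (fun r => r ^ 3 * pd 0 (pd 0 (hat Φc)) ![r, θ, 0]) atTop (𝓝 (2 * μ₁ θ)) := by
  have hθ' : θ ∈ Icc 0 Real.pi := ⟨hθ.1.le, hθ.2.le⟩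
  have hinv := tendsto_inv_atTop_zero (𝕜 := ℝ)
  constructor
  · have h := (hexp.tendsto (i := 1) (j := 0) (m := 2) (by simp) (by simp) hθ).sub
      ((hinv.const_mul (2 * μ₂ θ)).const_add (μ₁ θ))
    rw [mul_zero, add_zero, zero_sub] at h
    refine h.congr' ?_
    filter_upwards [eventually_gt_atTop S.rH] with r hr
    have hr0 : 0 < r := S.rH_nonneg.trans_lt hr
    rw [pderivPolar_one_zero S.rH_nonneg hΦ hr hθ']
    field_simp; ring
  · have h := (hexp.tendsto (i := 2) (j := 0) (m := 3) (by simp) (by simp) hθ).add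
      ((hinv.const_mul (6 * μ₂ θ)).const_add (2 * μ₁ θ))
    rw [mul_zero, add_zero, zero_add] at h
    refine h.congr' ?_
    filter_upwards [eventually_gt_atTop S.rH] with r hr
    have hr0 : 0 < r := S.rH_nonneg.trans_lt hr
    rw [pderivPolar_two_zero S.rH_nonneg hΦ hr hθ']
    field_simp; ring

include hμ₁ hμ₂ in
lemma tendsto_polar (hθ : θ ∈ Ioo 0 Real.pi) :
    Tendsto (fun r => r * pd 1 (hat Φc) ![r, θ, 0]) atTop (𝓝 (deriv μ₁ θ)) ∧
    Tendsto (fun r => r * pd 1 (pd 1 (hat Φc)) ![r, θ, 0]) atTop (𝓝 (deriv (deriv μ₁) θ)) := by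
  have hinv := tendsto_inv_atTop_zero (𝕜 := ℝ)
  constructor
  · have h := (hexp.tendsto (i := 0) (j := 1) (m := 1) (by simp) (by simp) hθ).add
      ((hinv.const_mul (deriv μ₂ θ)).const_add (deriv μ₁ θ))
    rw [mul_zero, add_zero, zero_add] at h
    refine h.congr' ?_
    filter_upwards [eventually_gt_atTop S.rH] with r hr
    have hr0 : 0 < r := S.rH_nonneg.trans_lt hr
    rw [pderivPolar_zero_one S.rH_nonneg hΦ hμ₁ hμ₂ hr hθ]
    field_simp; ring
  · have h := (hexp.tendsto (i := 0) (j := 2) (m := 1) (by simp) (by simp) hθ).add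
      ((hinv.const_mul (deriv (deriv μ₂) θ)).const_add (deriv (deriv μ₁) θ))
    rw [mul_zero, add_zero, zero_add] at h
    refine h.congr' ?_
    filter_upwards [eventually_gt_atTop S.rH] with r hr
    have hr0 : 0 < r := S.rH_nonneg.trans_lt hr
    rw [pderivPolar_zero_two S.rH_nonneg hΦ hμ₁ hμ₂ hr hθ]
    field_simp; ring

lemma tendsto_radialFlux (hθ : θ ∈ Ioo 0 Real.pi) :
    Tendsto (fun r => radialFlux S Φc ![r, θ, 0]) atTop (𝓝 (-μ₁ θ * Real.sin θ)) := by
  obtain ⟨n0, -, -⟩ := tendsto_hat_one S.rH_nonneg S.N_smooth S.N_asymp hθ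
  obtain ⟨a0, -, -⟩ := tendsto_hat_one S.rH_nonneg S.A_smooth S.A_asymp hθ
  obtain ⟨b0, -, -⟩ := tendsto_hat_one S.rH_nonneg S.B_smooth S.B_asymp hθ
  obtain ⟨p, -⟩ := tendsto_radial S hΦ hexp hθ
  have h := (((n0.mul (b0.pow 2)).div a0 one_ne_zero).mul_const (Real.sin θ)).mul p
  simp only [one_pow, mul_one, div_one, one_mul] at h
  rw [show -μ₁ θ * Real.sin θ = Real.sin θ * -μ₁ θ by ring]
  refine h.congr fun r => ?_
  simp [radialFlux]
  ring

/-- At leading order r² ∂_r (μ₁/r) does not depend on r: the contributions −2 μ₁ from the factor r²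
and +2 μ₁ from the second derivative cancel, and derivatives of the metric functions are of lower
order. -/
lemma tendsto_pd_radialFlux (hθ : θ ∈ Ioo 0 Real.pi) :
    Tendsto (fun r => r * pd 0 (radialFlux S Φc) ![r, θ, 0]) atTop (𝓝 0) := by
  have hr0 := S.rH_nonneg
  obtain ⟨n0, n1, -⟩ := tendsto_hat_one hr0 S.N_smooth S.N_asymp hθ
  obtain ⟨a0, a1, -⟩ := tendsto_hat_one hr0 S.A_smooth S.A_asymp hθ
  obtain ⟨b0, b1, -⟩ := tendsto_hat_one hr0 S.B_smooth S.B_asymp hθ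
  obtain ⟨p, q⟩ := tendsto_radial S hΦ hexp hθ
  have h := (((((n1.mul (b0.pow 2)).add (((n0.mul b0).const_mul 2).mul (b0.add b1))).div a0
    one_ne_zero).sub (((n0.mul (b0.pow 2)).mul a1).div (a0.pow 2) (by simp))).mul_const
    (Real.sin θ)).mul p |>.add ((((n0.mul (b0.pow 2)).div a0 one_ne_zero).mul_const
    (Real.sin θ)).mul q)
  have e : (((0 * 1 ^ 2 + 2 * (1 * 1) * (1 + 0)) / 1 - 1 * 1 ^ 2 * 0 / 1 ^ 2) * Real.sin θ) * -μ₁ θ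
    + 1 * 1 ^ 2 / 1 * Real.sin θ * (2 * μ₁ θ) = 0 := by ring
  rw [e] at h
  refine h.congr' ?_
  filter_upwards [eventually_gt_atTop S.rH] with r hr
  have hr' : 0 < r := hr0.trans_lt hr
  have hz : (![r, θ, 0] : Fin 3 → ℝ) ∈ zdom S.rH := hr
  have D {f : (Fin 3 → ℝ) → ℝ} (hf : ContDiffOn ℝ ∞ f (zdom S.rH)) :
      HasDerivAt (fun s => f ![s, θ, 0]) (pd 0 f ![r, θ, 0]) r :=
    hasDerivAt_pd_zero ((hf.contDiffAt ((isOpen_zdom _).mem_nhds hz)).differentiableAt (by simp))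
  have dN := D (contDiffOn_hat hr0 S.N_smooth)
  have dA := D (contDiffOn_hat hr0 S.A_smooth)
  have dB := D (contDiffOn_hat hr0 S.B_smooth)
  have dP := D (contDiffOn_pd (isOpen_zdom S.rH) (contDiffOn_hat hr0 hΦ) 0)
  have hA := (hat_pos hr0 S.A_pos hz).ne'
  have key := (D (contDiffOn_radialFlux S hΦ)).unique
    ((((dN.mul (((hasDerivAt_id r).mul dB).pow 2)).div dA hA).mul_const (Real.sin θ)).mul dP)
  rw [key]
  simp
  field_simp

include hμ₁ hμ₂ in
lemma tendsto_pd_polarFlux (hθ : θ ∈ Ioo 0 Real.pi) :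
    Tendsto (fun r => r * pd 1 (polarFlux S Φc) ![r, θ, 0]) atTop
      (𝓝 (Real.cos θ * deriv μ₁ θ + Real.sin θ * deriv (deriv μ₁) θ)) := by
  have hr0 := S.rH_nonneg
  obtain ⟨n0, -, n1⟩ := tendsto_hat_one hr0 S.N_smooth S.N_asymp hθ
  obtain ⟨a0, -, a1⟩ := tendsto_hat_one hr0 S.A_smooth S.A_asymp hθ
  obtain ⟨p, q⟩ := tendsto_polar S hΦ hμ₁ hμ₂ hexp hθ
  have h := ((((n1.mul a0).add (n0.mul a1)).mul_const (Real.sin θ)).add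
    ((n0.mul a0).mul_const (Real.cos θ))).mul p |>.add (((n0.mul a0).mul_const (Real.sin θ)).mul q)
  have e : ((0 * 1 + 1 * 0) * Real.sin θ + 1 * 1 * Real.cos θ) * deriv μ₁ θ
    + 1 * 1 * Real.sin θ * deriv (deriv μ₁) θ
    = Real.cos θ * deriv μ₁ θ + Real.sin θ * deriv (deriv μ₁) θ := by ring
  rw [e] at h
  refine h.congr' ?_
  filter_upwards [eventually_gt_atTop S.rH] with r hr
  have hz : (![r, θ, 0] : Fin 3 → ℝ) ∈ zdom S.rH := hr
  have D {f : (Fin 3 → ℝ) → ℝ} (hf : ContDiffOn ℝ ∞ f (zdom S.rH)) :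
      HasDerivAt (fun s => f ![r, s, 0]) (pd 1 f ![r, θ, 0]) θ :=
    hasDerivAt_pd_one ((hf.contDiffAt ((isOpen_zdom _).mem_nhds hz)).differentiableAt (by simp))
  have dN := D (contDiffOn_hat hr0 S.N_smooth)
  have dA := D (contDiffOn_hat hr0 S.A_smooth)
  have dP := D (contDiffOn_pd (isOpen_zdom S.rH) (contDiffOn_hat hr0 hΦ) 1)
  have key := (D (contDiffOn_polarFlux S hΦ)).unique
    (((dN.mul dA).mul (Real.hasDerivAt_sin θ)).mul dP)
  rw [key]
  simp
  ring

include hμ₁ hμ₂ in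
/-- The monopole hair does not depend on the angle. -/
lemma monopole_const {ε : ℝ} {Fc : ℝ → ℝ → ℝ}
    (hE : ∀ x ∈ polarExterior S.rH,
      dAlembertian (hartleThorne S.N S.A S.B S.w) (fun z => Φc (z 1) (z 2)) x
        + ε * Fc (x 1) (x 2) = 0)
    (hdecay : ∃ C R : ℝ, ∀ r > R, ∀ θ ∈ Icc 0 Real.pi, |Fc r θ| ≤ C / r ^ 5) :
    ∀ θ ∈ Icc 0 Real.pi, μ₁ θ = μ₁ 0 := by
  refine eq_of_legendre hμ₁ fun θ hθ => ?_
  have hr0 := S.rH_nonneg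
  have hθ' : θ ∈ Icc 0 Real.pi := ⟨hθ.1.le, hθ.2.le⟩
  obtain ⟨n0, -, -⟩ := tendsto_hat_one hr0 S.N_smooth S.N_asymp hθ
  obtain ⟨a0, -, -⟩ := tendsto_hat_one hr0 S.A_smooth S.A_asymp hθ
  obtain ⟨b0, -, -⟩ := tendsto_hat_one hr0 S.B_smooth S.B_asymp hθ
  have hF : Tendsto (fun r => r ^ 3 * Fc r θ) atTop (𝓝 0) := by
    obtain ⟨C, R, h⟩ := hdecay
    refine squeeze_zero_norm' (a := fun r => |C| * r⁻¹) ?_ ?_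
    · filter_upwards [eventually_gt_atTop R, eventually_ge_atTop 1] with r hr h1
      have hr0 : 0 < r := by linarith
      rw [Real.norm_eq_abs, abs_mul, abs_of_nonneg (by positivity)]
      calc r ^ 3 * |Fc r θ| ≤ r ^ 3 * (|C| / r ^ 4) := by
            gcongr
            refine (h r hr θ hθ').trans
              (div_le_div₀ (abs_nonneg C) (le_abs_self C) (by positivity) ?_)
            exact pow_le_pow_right₀ h1 (by omega)
        _ = |C| * r⁻¹ := by field_simp
    · simpa using tendsto_inv_atTop_zero.const_mul |C|
  -- The field equation in density form is multiplied by r. The source side behaves like r³ F and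
  -- tends to zero, leaving only the angular operator on μ₁.
  have h1 := (tendsto_pd_radialFlux S hΦ hexp hθ).add (tendsto_pd_polarFlux S hΦ hμ₁ hμ₂ hexp hθ)
  have h2 := ((((n0.mul a0).mul (b0.pow 2)).mul_const (Real.sin θ)).const_mul (-ε)).mul hF
  rw [mul_zero] at h2
  rw [zero_add] at h1
  refine tendsto_nhds_unique (h1.congr' ?_) h2
  filter_upwards [eventually_gt_atTop S.rH] with r hr
  have h := field_equation S hΦ hE (z := ![r, θ, 0]) hr hθ
  rw [← mul_add, h]
  simp
  ring

include hμ₂ in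
/-- The flux through large spheres. -/
lemma tendsto_integral_radialFlux (hc : ∀ θ ∈ Icc 0 Real.pi, μ₁ θ = μ₁ 0) :
    Tendsto (fun r => ∫ θ in Ioo 0 Real.pi, radialFlux S Φc ![r, θ, 0]) atTop
      (𝓝 (-2 * μ₁ 0)) := by
  have hr0 := S.rH_nonneg
  have hI : ∫ θ in Ioo 0 Real.pi, -μ₁ 0 * Real.sin θ = -2 * μ₁ 0 := by
    rw [← integral_Ioc_eq_integral_Ioo, ← intervalIntegral.integral_of_le Real.pi_pos.le,
      intervalIntegral.integral_const_mul, integral_sin]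
    simp; ring
  rw [← hI]
  obtain ⟨RN, hN⟩ := S.N_asymp.exists_abs_le one_half_pos
  obtain ⟨RA, hA⟩ := S.A_asymp.exists_abs_le one_half_pos
  obtain ⟨RB, hB⟩ := S.B_asymp.exists_abs_le one_half_pos
  obtain ⟨C, R, hC⟩ := hexp 1 0 (by simp)
  obtain ⟨M₂, hM₂⟩ := isCompact_Icc.exists_bound_of_continuousOn hμ₂.continuousOn
  -- Once N, A and B are within 1/2 of 1, the factor N B²/A is at most 16. The bracket bounds r²
  -- |∂_r Φ| for r ≥ 1.
  refine tendsto_integral_filter_of_dominated_convergence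
    (fun _ => 16 * (|C| + |μ₁ 0| + 2 * |M₂|)) ?_ ?_ ?_ ?_
  · filter_upwards [eventually_gt_atTop S.rH] with r hr
    have hm : Continuous fun θ : ℝ => (![r, θ, 0] : Fin 3 → ℝ) := by fun_prop
    exact ((contDiffOn_radialFlux S hΦ).continuousOn.comp_continuous hm
      fun θ => hr).aestronglyMeasurable
  · filter_upwards [eventually_gt_atTop S.rH, eventually_gt_atTop RN, eventually_gt_atTop RA,
      eventually_gt_atTop RB, eventually_gt_atTop R, eventually_ge_atTop 1]
      with r hr hrN hrA hrB hrR h1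
    filter_upwards [ae_restrict_mem measurableSet_Ioo] with θ hθ
    have hθ' : θ ∈ Icc 0 Real.pi := ⟨hθ.1.le, hθ.2.le⟩
    have hr' : 0 < r := hr0.trans_lt hr
    have e (f : ℝ → ℝ → ℝ) : hat f ![r, θ, 0] = f r θ := hat_eq f (z := ![r, θ, 0]) hr' hθ'
    have eN := abs_le.1 (hN r hrN θ hθ)
    have eA := abs_le.1 (hA r hrA θ hθ)
    have eB := abs_le.1 (hB r hrB θ hθ)
    have hp := hC r hrR θ hθ
    rw [pderivPolar_one_zero hr0 hΦ hr hθ', hc θ hθ'] at hp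
    have hq : |r ^ 2 * pd 0 (hat Φc) ![r, θ, 0]| ≤ |C| + |μ₁ 0| + 2 * |M₂| := by
      have h2 : r ^ 2 * pd 0 (hat Φc) ![r, θ, 0] = r ^ 2 * (pd 0 (hat Φc) ![r, θ, 0]
          + (μ₁ 0 / r ^ 2 + 2 * μ₂ θ / r ^ 3)) - μ₁ 0 - 2 * (μ₂ θ / r) := by
        field_simp; ring
      have h3 : |r ^ 2 * (pd 0 (hat Φc) ![r, θ, 0] + (μ₁ 0 / r ^ 2 + 2 * μ₂ θ / r ^ 3))| ≤ |C| := by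
        rw [abs_mul, abs_of_nonneg (by positivity)]
        calc _ ≤ r ^ 2 * (|C| / r ^ 2) := by
              gcongr
              exact hp.trans (div_le_div₀ (abs_nonneg C) (le_abs_self C) (by positivity)
                (pow_le_pow_right₀ h1 (by omega)))
          _ = |C| := by field_simp
      have h4 : |μ₂ θ / r| ≤ |M₂| := by
        rw [abs_div, abs_of_pos hr']
        exact (div_le_self (abs_nonneg _) h1).trans ((hM₂ θ hθ').trans (le_abs_self _))
      rw [h2]
      have h5 := abs_sub (r ^ 2 * (pd 0 (hat Φc) ![r, θ, 0]
          + (μ₁ 0 / r ^ 2 + 2 * μ₂ θ / r ^ 3)) - μ₁ 0) (2 * (μ₂ θ / r))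
      have h6 := abs_sub (r ^ 2 * (pd 0 (hat Φc) ![r, θ, 0]
          + (μ₁ 0 / r ^ 2 + 2 * μ₂ θ / r ^ 3))) (μ₁ 0)
      rw [abs_mul 2, abs_two] at h5
      linarith
    have hflux : radialFlux S Φc ![r, θ, 0]
        = (S.N r θ * S.B r θ ^ 2 / S.A r θ * Real.sin θ) * (r ^ 2 * pd 0 (hat Φc) ![r, θ, 0]) := by
      simp [radialFlux, e]; ring
    rw [hflux, Real.norm_eq_abs, abs_mul]
    refine mul_le_mul ?_ hq (abs_nonneg _) (by norm_num)
    rw [abs_mul]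
    have hs := Real.abs_sin_le_one θ
    have hApos : 0 < S.A r θ := by linarith
    have h7 : |S.N r θ * S.B r θ ^ 2 / S.A r θ| ≤ 16 := by
      have hNp : 0 < S.N r θ := by linarith
      have hBp : 0 < S.B r θ := by linarith
      rw [abs_of_pos (by positivity), div_le_iff₀ hApos]
      calc S.N r θ * S.B r θ ^ 2 ≤ 2 * 2 ^ 2 := by gcongr <;> linarith
        _ ≤ 16 * S.A r θ := by linarith
    exact (mul_le_mul h7 hs (abs_nonneg _) (by norm_num)).trans_eq (by norm_num)
  · exact integrable_const _
  · filter_upwards [ae_restrict_mem measurableSet_Ioo] with θ hθ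
    have := tendsto_radialFlux S hΦ hexp hθ
    rwa [hc θ ⟨hθ.1.le, hθ.2.le⟩] at this

end Monopole

/-! ### Change of variables between the surface and spherical coordinates. -/

section Integration

/-- Spherical coordinates off a half-plane, with radius in `I`. -/
def sphericalBox (I : Set ℝ) : Set (Fin 3 → ℝ) :=
  univ.pi ![I, Ioo 0 Real.pi, Ioo (-Real.pi) Real.pi]

lemma mem_sphericalBox {I : Set ℝ} {z : Fin 3 → ℝ} : z ∈ sphericalBox I ↔
    z 0 ∈ I ∧ z 1 ∈ Ioo 0 Real.pi ∧ z 2 ∈ Ioo (-Real.pi) Real.pi := by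
  rw [sphericalBox, mem_univ_pi, Fin.forall_fin_succ, Fin.forall_fin_two]
  rfl

lemma measurableSet_sphericalBox {I : Set ℝ} (hI : MeasurableSet I) :
    MeasurableSet (sphericalBox I) := by
  refine MeasurableSet.univ_pi fun i => ?_
  fin_cases i
  · exact hI
  · exact measurableSet_Ioo
  · exact measurableSet_Ioo

lemma azimuth_sph {r θ φ : ℝ} (hr : 0 < r) (hθ : θ ∈ Ioo 0 Real.pi)
    (hφ : φ ∈ Ioc (-Real.pi) Real.pi) : azimuth (sph r θ φ) = φ := by
  have h : 0 < r * Real.sin θ := mul_pos hr (Real.sin_pos_of_mem_Ioo hθ)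
  have e := Complex.arg_mul_cos_add_sin_mul_I h hφ
  rw [azimuth]
  refine (congrArg Complex.arg ?_).trans e
  apply Complex.ext <;> simp [Complex.cos_ofReal_re, Complex.sin_ofReal_re]

lemma injOn_sphz : InjOn sphz (sphericalBox (Ioi 0)) := by
  intro z hz z' hz' h
  rw [mem_sphericalBox] at hz hz'
  have e0 : z 0 = z' 0 := by
    have := congrArg norm h
    rwa [sphz, sphz, norm_sph (le_of_lt hz.1), norm_sph (le_of_lt hz'.1)] at this
  have e1 : z 1 = z' 1 := by
    have := congrArg polarAngle h
    rwa [sphz, sphz, polarAngle_sph hz.1 ⟨hz.2.1.1.le, hz.2.1.2.le⟩,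
      polarAngle_sph hz'.1 ⟨hz'.2.1.1.le, hz'.2.1.2.le⟩] at this
  have e2 : z 2 = z' 2 := by
    have := congrArg azimuth h
    rwa [sphz, sphz, azimuth_sph hz.1 hz.2.1 ⟨hz.2.2.1, hz.2.2.2.le⟩,
      azimuth_sph hz'.1 hz'.2.1 ⟨hz'.2.2.1, hz'.2.2.2.le⟩] at this
  ext i; fin_cases i
  · exact e0
  · exact e1
  · exact e2

/-- Only the axis and the half-plane φ = π are really missed; excluding the whole plane containing
them keeps the exceptional set linear and still null. -/
lemma sphz_surj {y : E3} (hy : y 1 ≠ 0) : ∃ z ∈ sphericalBox {‖y‖}, sphz z = y := by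
  have hy0 : y ≠ 0 := by rintro rfl; simp at hy
  refine ⟨![‖y‖, polarAngle y, azimuth y], ?_, sph_polarAngle_azimuth hy0⟩
  rw [mem_sphericalBox]
  refine ⟨rfl, polarAngle_mem_Ioo (Or.inr hy), (azimuth_mem y).1, (azimuth_mem y).2.lt_of_ne ?_⟩
  intro h
  have h' : azimuth y = Real.pi := h
  have h1 := congrArg (fun x : E3 => x 1) (sph_polarAngle_azimuth hy0)
  simp [h'] at h1
  exact hy h1.symm

lemma integrableOn_sphericalBox_inv_sq {R : ℝ} (hR : 0 < R) :
    IntegrableOn (fun z : Fin 3 → ℝ => (z 0 ^ 2)⁻¹) (sphericalBox (Ioi R)) := by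
  have h := Integrable.fintype_prod (𝕜 := ℝ) (ι := Fin 3) (E := ℝ)
    (f := ![fun r => (r ^ 2)⁻¹, fun _ => 1, fun _ => 1])
    (μ := fun i => (volume : Measure ℝ).restrict
      ((![Ioi R, Ioo 0 Real.pi, Ioo (-Real.pi) Real.pi] : Fin 3 → Set ℝ) i)) (fun i => ?_)
  · rw [← Measure.restrict_pi_pi] at h
    refine Integrable.congr h (Eventually.of_forall fun z => ?_)
    simp [Fin.prod_univ_three]
  · fin_cases i
    · have h2 := integrableOn_Ioi_rpow_of_lt (a := -2) (by norm_num) hR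
      refine h2.congr_fun (fun r hr => ?_) measurableSet_Ioi
      have hr' : 0 < r := hR.trans hr
      simp [Real.rpow_neg hr'.le]
    · exact integrableOn_const (by simp)
    · exact integrableOn_const (by simp)

variable {M : Type*} [TopologicalSpace M] [ChartedSpace E4 M] [IsManifold (𝓡 4) ∞ M]

namespace PartialCauchySurface

variable {S : CircularBlackHole M} (Sig : PartialCauchySurface S) {I : Set ℝ}

lemma mem_zdom_of_mem_sphericalBox (hI : I ⊆ Ioi S.rH) {z : Fin 3 → ℝ}
    (hz : z ∈ sphericalBox I) : z ∈ zdom S.rH := hI (mem_sphericalBox.1 hz).1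

lemma injOn_K (hI : I ⊆ Ioi S.rH) : InjOn Sig.K (sphericalBox I) := by
  intro z hz z' hz' h
  have h1 := congrArg Sig.proj h
  rw [Sig.proj_K (mem_zdom_of_mem_sphericalBox hI hz),
    Sig.proj_K (mem_zdom_of_mem_sphericalBox hI hz')] at h1
  have hsub : sphericalBox I ⊆ sphericalBox (Ioi 0) := fun z hz => by
    rw [mem_sphericalBox] at hz ⊢
    exact ⟨S.rH_nonneg.trans_lt (hI hz.1), hz.2⟩
  exact injOn_sphz (hsub hz) (hsub hz') h1

/-- The spherical coordinates with values in coordinate space, and their differential. -/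
lemma hasFDerivAt_ofLp_K {z : Fin 3 → ℝ} (hz : z ∈ zdom S.rH) :
    HasFDerivAt (fun z => (Sig.K z : Fin 3 → ℝ))
      (LinearMap.toContinuousLinearMap (Matrix.toLin' (Sig.jac z))) z := by
  have h := (PiLp.continuousLinearEquiv 2 ℝ (fun _ : Fin 3 => ℝ)).hasFDerivAt.comp z
    (Sig.differentiableAt_K hz).hasFDerivAt
  refine h.congr_fderiv ?_
  ext1 v
  exact (Sig.jac_mulVec v).symm

lemma det_toLin_jac (z : Fin 3 → ℝ) :
    (LinearMap.toContinuousLinearMap (Matrix.toLin' (Sig.jac z))).det = (Sig.jac z).det := by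
  rw [ContinuousLinearMap.det, LinearMap.coe_toContinuousLinearMap, LinearMap.det_toLin']

lemma preimage_image_K (I : Set ℝ) : (WithLp.toLp 2 : (Fin 3 → ℝ) → E3) ⁻¹' (Sig.K '' sphericalBox I)
    = (fun z => (Sig.K z : Fin 3 → ℝ)) '' sphericalBox I := by
  ext x
  constructor
  · rintro ⟨z, hz, h⟩
    exact ⟨z, hz, by simp [h]⟩
  · rintro ⟨z, hz, rfl⟩
    exact ⟨z, hz, rfl⟩

variable (hm : MeasurableSet I) (hI : I ⊆ Ioi S.rH)
include hm hI

/-- The Jacobian formula is applied to a map of coordinate three-space to itself, after the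
volume-preserving identification with Euclidean space. -/
lemma setIntegral_image_K (g : E3 → ℝ) : ∫ x in Sig.K '' sphericalBox I, g x
    = ∫ z in sphericalBox I, |(Sig.jac z).det| * g (Sig.K z) := by
  have he := (MeasurableEquiv.toLp 2 (Fin 3 → ℝ)).measurableEmbedding
  have h1 := (PiLp.volume_preserving_toLp (Fin 3)).setIntegral_preimage_emb he g
    (Sig.K '' sphericalBox I)
  rw [← h1, preimage_image_K, integral_image_eq_integral_abs_det_fderiv_smul volume
    (measurableSet_sphericalBox hm)
    (fun z hz => (Sig.hasFDerivAt_ofLp_K (mem_zdom_of_mem_sphericalBox hI hz)).hasFDerivWithinAt)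
    (fun z hz z' hz' h => Sig.injOn_K hI hz hz' (WithLp.ofLp_injective 2 h))]
  simp only [det_toLin_jac, smul_eq_mul]

lemma integrableOn_image_K (g : E3 → ℝ) : IntegrableOn g (Sig.K '' sphericalBox I)
    ↔ IntegrableOn (fun z => |(Sig.jac z).det| * g (Sig.K z)) (sphericalBox I) := by
  have he := (MeasurableEquiv.toLp 2 (Fin 3 → ℝ)).measurableEmbedding
  have h1 := (PiLp.volume_preserving_toLp (Fin 3)).integrableOn_comp_preimage he (f := g)
    (s := Sig.K '' sphericalBox I)
  rw [← h1, preimage_image_K, integrableOn_image_iff_integrableOn_abs_det_fderiv_smul volume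
    (measurableSet_sphericalBox hm)
    (fun z hz => (Sig.hasFDerivAt_ofLp_K (mem_zdom_of_mem_sphericalBox hI hz)).hasFDerivWithinAt)
    (fun z hz z' hz' h => Sig.injOn_K hI hz hz' (WithLp.ofLp_injective 2 h))]
  simp only [det_toLin_jac, smul_eq_mul, Function.comp_apply]

omit hm in
/-- The spherical coordinates cover the surface up to a null set. -/
lemma image_K_ae_eq :
    Sig.K '' sphericalBox I =ᵐ[volume] {x | x ∈ outside 1 ∧ ‖Sig.proj x‖ ∈ I} := by
  have hsub : Sig.K '' sphericalBox I ⊆ {x | x ∈ outside 1 ∧ ‖Sig.proj x‖ ∈ I} := by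
    rintro _ ⟨z, hz, rfl⟩
    have hz' := mem_zdom_of_mem_sphericalBox hI hz
    refine ⟨Sig.K_mem hz', ?_⟩
    rw [Sig.proj_K hz', sphz, norm_sph (S.rH_nonneg.trans (le_of_lt hz'))]
    exact (mem_sphericalBox.1 hz).1
  -- The uncovered points are lifts of points in a plane. The plane is null, and the differentiable
  -- map `lift` between spaces of equal dimension preserves null sets.
  set P : Set E3 := {y | y ∈ outside S.rH ∧ y 1 = 0} with hP
  have hdiff : {x | x ∈ outside 1 ∧ ‖Sig.proj x‖ ∈ I} \ (Sig.K '' sphericalBox I)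
      ⊆ Sig.lift '' P := by
    rintro x ⟨⟨hx, hxI⟩, hn⟩
    refine ⟨Sig.proj x, ⟨Sig.proj_mem hx, ?_⟩, Sig.lift_proj hx⟩
    by_contra h
    obtain ⟨z, hz, hzx⟩ := sphz_surj h
    rw [mem_sphericalBox] at hz
    refine hn ⟨z, mem_sphericalBox.2 ⟨?_, hz.2⟩, ?_⟩
    · rw [mem_singleton_iff.1 hz.1]; exact hxI
    · rw [K, hzx, Sig.lift_proj hx]
  have hP0 : volume P = 0 := by
    have hker : volume ((LinearMap.ker (EuclideanSpace.proj (𝕜 := ℝ) (1 : Fin 3)).toLinearMap :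
        Submodule ℝ E3) : Set E3) = 0 := by
      refine Measure.addHaar_submodule _ _ fun h => ?_
      have h1 : (EuclideanSpace.single 1 1 : E3) ∈ (⊤ : Submodule ℝ E3) := trivial
      rw [← h] at h1
      simp at h1
    exact measure_mono_null (fun y hy => hy.2) hker
  have hl : DifferentiableOn ℝ Sig.lift P :=
    (Sig.contDiffOn_lift.differentiableOn (by simp)).mono fun y hy => hy.1
  have h0 := addHaar_image_eq_zero_of_differentiableOn_of_addHaar_eq_zero volume hl hP0
  refine (hsub.eventuallyLE).antisymm ?_
  rw [ae_le_set]
  exact measure_mono_null hdiff h0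

end PartialCauchySurface

end Integration

/-! ### Integrability of the source. -/

section SourceIntegrability

variable {M : Type*} [TopologicalSpace M] [ChartedSpace E4 M] [IsManifold (𝓡 4) ∞ M]

namespace PartialCauchySurface

variable {S : CircularBlackHole M} (Sig : PartialCauchySurface S)

/-- The density of the source in spherical coordinates. -/
def sourcePolar (Fc : ℝ → ℝ → ℝ) (z : Fin 3 → ℝ) : ℝ :=
  hat S.N z * hat S.A z * (z 0 * hat S.B z) ^ 2 * Real.sin (z 1) * Sig.lapseFactor z * hat Fc z

/-- The density of the source on the surface. -/
def source (F : M → ℝ) (x : E3) : ℝ := F (Sig.σ x) * Sig.surfaceDensity S.X x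

variable {F : M → ℝ} (hF : Continuous F) {Fc : ℝ → ℝ → ℝ}
  (hFc : ∀ x : Fin 4 → ℝ, S.rH < x 1 → x 2 ∈ Icc 0 Real.pi →
    F (S.Ψ (polar x)) = Fc (x 1) (x 2))

include hFc in
lemma source_K {z : Fin 3 → ℝ} (hz : z ∈ zdom S.rH) (h1 : z 1 ∈ Ioo 0 Real.pi) :
    |(Sig.jac z).det| * Sig.source F (Sig.K z) = Sig.sourcePolar Fc z := by
  have hθ : z 1 ∈ Icc 0 Real.pi := ⟨h1.1.le, h1.2.le⟩
  have hr : 0 < z 0 := S.rH_nonneg.trans_lt hz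
  have e : F (Sig.σ (Sig.K z)) = hat Fc z := by
    rw [Sig.σ_K hz, hFc _ hz hθ, hat_eq Fc hr hθ]; rfl
  rw [source, e, mul_left_comm, Sig.surfaceDensity_K hz h1, sourcePolar, hat_eq S.N hr hθ,
    hat_eq S.A hr hθ, hat_eq S.B hr hθ, mul_comm]
  rfl

include hF

lemma continuousOn_source : ContinuousOn (Sig.source F) outerRegion :=
  (hF.comp_continuousOn Sig.continuousOn_σ).mul Sig.continuousOn_surfaceDensity

include hFc

lemma continuousOn_sourcePolar : ContinuousOn (Sig.sourcePolar Fc) (zdom S.rH) := by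
  have h0 := S.rH_nonneg
  have hN := (contDiffOn_hat h0 S.N_smooth).continuousOn
  have hA := (contDiffOn_hat h0 S.A_smooth).continuousOn
  have hB := (contDiffOn_hat h0 S.B_smooth).continuousOn
  have hr : ContinuousOn (fun z : Fin 3 → ℝ => z 0) (zdom S.rH) := by fun_prop
  have hs : ContinuousOn (fun z : Fin 3 → ℝ => Real.sin (z 1)) (zdom S.rH) := by fun_prop
  exact (((((hN.mul hA).mul ((hr.mul hB).pow 2)).mul hs).mul
    Sig.contDiffOn_lapseFactor.continuousOn).mul (S.continuousOn_of_invariant hF hFc))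

variable (hdecay : ∃ C R : ℝ, ∀ r > R, ∀ θ ∈ Icc 0 Real.pi, |Fc r θ| ≤ C / r ^ 5)
include hdecay

omit hF hFc in
-- Power counting: the volume density is O(r²), the lapse factor is O(r) because spacelikeness
-- allows ∂_φ T no faster growth, and the curvature scalar is O(r⁻⁵).
lemma exists_abs_sourcePolar_le : ∃ C R : ℝ, 1 ≤ R ∧ S.rH ≤ R ∧
    ∀ z ∈ sphericalBox (Ioi R), |Sig.sourcePolar Fc z| ≤ C * (z 0 ^ 2)⁻¹ := by
  obtain ⟨RN, hN⟩ := S.N_asymp.exists_abs_le one_half_pos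
  obtain ⟨RA, hA⟩ := S.A_asymp.exists_abs_le one_half_pos
  obtain ⟨RB, hB⟩ := S.B_asymp.exists_abs_le one_half_pos
  obtain ⟨Rw, hw⟩ := S.w_asymp.exists_abs_le one_pos
  obtain ⟨C, R, hC⟩ := hdecay
  -- With N, A and B between 1/2 and 2, the volume density is at most 2 · 2 · (2r)² = 16 r² and |∂_φ
  -- T| ≤ r B/N ≤ 4r; moreover |ω| ≤ 1. The bound r ≥ 1 absorbs the constant term of the lapse
  -- factor.
  refine ⟨16 * (1 + 4 * (|S.Ω| + 1)) * |C|, max 1 (max S.rH (max RN (max RA (max RB (max Rw R))))),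
    le_max_left _ _, (le_max_left _ _).trans (le_max_right _ _), fun z hz => ?_⟩
  obtain ⟨hz0, hz1, -⟩ := mem_sphericalBox.1 hz
  simp only [mem_Ioi, max_lt_iff] at hz0
  obtain ⟨h1, hrH, hrN, hrA, hrB, hrw, hrR⟩ := hz0
  have hθ : z 1 ∈ Icc 0 Real.pi := ⟨hz1.1.le, hz1.2.le⟩
  have hr : 0 < z 0 := one_pos.trans h1
  have hzd : z ∈ zdom S.rH := hrH
  have eN := abs_le.1 (hN _ hrN _ hz1)
  have eA := abs_le.1 (hA _ hrA _ hz1)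
  have eB := abs_le.1 (hB _ hrB _ hz1)
  have ew := hw _ hrw _ hz1
  have eF := hC _ hrR _ hθ
  have eT := Sig.abs_pd_two_T_le hzd hz1
  have hT : |pd 2 Sig.T z| ≤ 4 * z 0 := by
    have h2 : (1 / 2) * |pd 2 Sig.T z| ≤ S.N (z 0) (z 1) * |pd 2 Sig.T z| := by
      gcongr; linarith
    have h3 : z 0 * S.B (z 0) (z 1) ≤ z 0 * 2 := by gcongr; linarith
    linarith
  have hL : |Sig.lapseFactor z| ≤ (1 + 4 * (|S.Ω| + 1)) * z 0 := by
    rw [lapseFactor, hat_eq S.w hr hθ]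
    have h2 := abs_sub 1 ((S.Ω - S.w (z 0) (z 1)) * pd 2 Sig.T z)
    have h3 := abs_sub S.Ω (S.w (z 0) (z 1))
    rw [abs_mul, abs_one] at h2
    have h4 : |S.Ω - S.w (z 0) (z 1)| * |pd 2 Sig.T z| ≤ (|S.Ω| + 1) * (4 * z 0) := by
      gcongr; linarith
    nlinarith
  have hD : |hat S.N z * hat S.A z * (z 0 * hat S.B z) ^ 2 * Real.sin (z 1)| ≤ 16 * z 0 ^ 2 := by
    rw [hat_eq S.N hr hθ, hat_eq S.A hr hθ, hat_eq S.B hr hθ, abs_mul]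
    have hs := Real.abs_sin_le_one (z 1)
    have hNp : 0 < S.N (z 0) (z 1) := by linarith
    have hAp : 0 < S.A (z 0) (z 1) := by linarith
    have hBp : 0 < S.B (z 0) (z 1) := by linarith
    have h2 : |S.N (z 0) (z 1) * S.A (z 0) (z 1) * (z 0 * S.B (z 0) (z 1)) ^ 2|
        ≤ 2 * 2 * (z 0 * 2) ^ 2 := by
      rw [abs_of_pos (by positivity)]
      gcongr <;> linarith
    calc _ ≤ 2 * 2 * (z 0 * 2) ^ 2 * 1 := mul_le_mul h2 hs (abs_nonneg _) (by positivity)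
      _ = 16 * z 0 ^ 2 := by ring
  have hFc' : |hat Fc z| ≤ |C| / z 0 ^ 5 := by
    rw [hat_eq Fc hr hθ]
    exact eF.trans (by gcongr; exact le_abs_self C)
  rw [sourcePolar, abs_mul, abs_mul]
  calc _ ≤ 16 * z 0 ^ 2 * ((1 + 4 * (|S.Ω| + 1)) * z 0) * (|C| / z 0 ^ 5) := by gcongr
    _ = 16 * (1 + 4 * (|S.Ω| + 1)) * |C| * (z 0 ^ 2)⁻¹ := by field_simp

/-- The source is integrable on the surface. -/
lemma integrableOn_source : IntegrableOn (Sig.source F) (outside 1) := by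
  obtain ⟨C, R, h1, hrH, hb⟩ := Sig.exists_abs_sourcePolar_le (Fc := Fc) hdecay
  have hI : Ioi R ⊆ Ioi S.rH := Ioi_subset_Ioi hrH
  have hms := measurableSet_sphericalBox (measurableSet_Ioi (a := R))
  have hsub : sphericalBox (Ioi R) ⊆ zdom S.rH := fun z hz => mem_zdom_of_mem_sphericalBox hI hz
  have hfar : IntegrableOn (Sig.source F) {x | x ∈ outside 1 ∧ ‖Sig.proj x‖ ∈ Ioi R} := by
    refine IntegrableOn.congr_set_ae ?_ (Sig.image_K_ae_eq hI).symm
    rw [Sig.integrableOn_image_K measurableSet_Ioi hI]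
    have h2 : IntegrableOn (Sig.sourcePolar Fc) (sphericalBox (Ioi R)) := by
      refine ((integrableOn_sphericalBox_inv_sq (one_pos.trans_le h1)).const_mul C).mono'
        (((Sig.continuousOn_sourcePolar hF hFc).mono hsub).aestronglyMeasurable hms) ?_
      filter_upwards [ae_restrict_mem hms] with z hz
      exact hb z hz
    exact h2.congr_fun (fun z hz => (Sig.source_K hFc (hsub hz) (mem_sphericalBox.1 hz).2.1).symm) hms
  -- The rest of the surface lies in a compact parameter region including the boundary sphere, where
  -- the source is continuous.
  obtain ⟨L, hL⟩ := Sig.proj_infinity R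
  have hK : IsCompact (outerRegion ∩ Metric.closedBall (0 : E3) L) :=
    (isCompact_closedBall 0 L).inter_left (isClosed_le continuous_const continuous_norm)
  have hnear : IntegrableOn (Sig.source F) (outerRegion ∩ Metric.closedBall (0 : E3) L) :=
    ((Sig.continuousOn_source hF).mono inter_subset_left).integrableOn_compact hK
  refine (hnear.union hfar).mono_set fun x hx => ?_
  by_cases hxL : ‖x‖ ≤ L
  · exact Or.inl ⟨outside_subset hx, by simpa using hxL⟩
  · exact Or.inr ⟨hx, hL x hx (not_le.1 hxL)⟩

end PartialCauchySurface

end SourceIntegrability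

/-! ### Gauss's theorem for the cut off current. -/

section Divergence

lemma sphz_periodic (z : Fin 3 → ℝ) : sphz (z + (2 * Real.pi) • Pi.single 2 1) = sphz z := by
  rw [sphz_add]
  apply E3_ext <;> simp

lemma pd_periodic {f : (Fin 3 → ℝ) → ℝ}
    (hf : ∀ z : Fin 3 → ℝ, f (z + (2 * Real.pi) • Pi.single 2 1) = f z) (i : Fin 3) (z : Fin 3 → ℝ) :
    pd i f (z + (2 * Real.pi) • Pi.single 2 1) = pd i f z := by
  have h : (fun y => f (y + (2 * Real.pi) • Pi.single 2 1)) = f := funext hf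
  rw [pd, pd, ← fderiv_comp_add_right, h]

variable {M : Type*} [TopologicalSpace M] [ChartedSpace E4 M] [IsManifold (𝓡 4) ∞ M]

namespace PartialCauchySurface

variable {S : CircularBlackHole M} (Sig : PartialCauchySurface S)

lemma K_periodic (z : Fin 3 → ℝ) : Sig.K (z + (2 * Real.pi) • Pi.single 2 1) = Sig.K z := by
  rw [K, K, sphz_periodic]

lemma T_periodic (z : Fin 3 → ℝ) : Sig.T (z + (2 * Real.pi) • Pi.single 2 1) = Sig.T z := by
  rw [T, T, K_periodic]

lemma currentPolar_periodic (Φc : ℝ → ℝ → ℝ) (z : Fin 3 → ℝ) :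
    Sig.currentPolar Φc (z + (2 * Real.pi) • Pi.single 2 1) = Sig.currentPolar Φc z := by
  simp only [currentPolar, lapseFactor, radialFlux_invariant, polarFlux_invariant, hat_add,
    pd_invariant (hat_add S.w), pd_periodic Sig.T_periodic, T_periodic]

/-- The flux of the conserved current through a sphere. -/
lemma integral_sphere {Φc : ℝ → ℝ → ℝ} (hΦ : SmoothExterior S.rH Φc) {r : ℝ} (hr : S.rH < r) :
    ∫ x in Icc (![0, -Real.pi] : Fin 2 → ℝ) ![Real.pi, Real.pi],
      Sig.currentPolar Φc ![r, x 0, x 1] 0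
      = 2 * Real.pi * ∫ θ in Ioo 0 Real.pi, radialFlux S Φc ![r, θ, 0] := by
  set g : ℝ × ℝ → ℝ := fun p => Sig.currentPolar Φc ![r, p.1, p.2] 0 with hg
  have hcg : Continuous g := by
    have hm : Continuous fun p : ℝ × ℝ => (![r, p.1, p.2] : Fin 3 → ℝ) := by fun_prop
    exact (continuous_apply 0).comp
      ((Sig.contDiffOn_currentPolar hΦ).continuousOn.comp_continuous hm fun p => hr)
  have h1 := (volume_preserving_finTwoArrow ℝ).setIntegral_preimage_emb
    MeasurableEquiv.finTwoArrow.measurableEmbedding g (Icc 0 Real.pi ×ˢ Icc (-Real.pi) Real.pi)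
  have h2 : MeasurableEquiv.finTwoArrow ⁻¹' (Icc 0 Real.pi ×ˢ Icc (-Real.pi) Real.pi)
      = Icc (![0, -Real.pi] : Fin 2 → ℝ) ![Real.pi, Real.pi] := by
    ext x
    simp [MeasurableEquiv.finTwoArrow, Pi.le_def, Fin.forall_fin_two]
  rw [h2] at h1
  refine h1.trans ?_
  rw [Measure.volume_eq_prod, setIntegral_prod _
    (hcg.continuousOn.integrableOn_compact (isCompact_Icc.prod isCompact_Icc)),
    integral_Icc_eq_integral_Ioo, ← integral_const_mul]
  refine setIntegral_congr_fun measurableSet_Ioo fun θ hθ => ?_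
  have e1 (φ : ℝ) : (![r, θ, φ] : Fin 3 → ℝ) = ![r, θ, 0] + φ • Pi.single 2 1 := by
    ext i; fin_cases i <;> simp
  have hg2 (φ : ℝ) : g (θ, φ) = radialFlux S Φc ![r, θ, 0]
      * (1 - (S.Ω - hat S.w ![r, θ, 0]) * pd 2 Sig.T ![r, θ, φ]) := by
    have e2 : radialFlux S Φc ![r, θ, φ] = radialFlux S Φc ![r, θ, 0] := by
      rw [e1, radialFlux_invariant]
    have e3 : hat S.w ![r, θ, φ] = hat S.w ![r, θ, 0] := by
      rw [e1, hat_add]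
    change radialFlux S Φc ![r, θ, φ] * Sig.lapseFactor ![r, θ, φ] = _
    rw [lapseFactor, e2, e3]
  have hz (φ : ℝ) : (![r, θ, φ] : Fin 3 → ℝ) ∈ zdom S.rH := hr
  have hT (φ : ℝ) : HasDerivAt (fun s => Sig.T ![r, θ, s]) (pd 2 Sig.T ![r, θ, φ]) φ :=
    hasDerivAt_pd_two (Sig.differentiableAt_T (hz φ))
  have hTc : Continuous fun φ : ℝ => pd 2 Sig.T ![r, θ, φ] := by
    have hm : Continuous fun φ : ℝ => (![r, θ, φ] : Fin 3 → ℝ) := by fun_prop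
    exact (contDiffOn_pd (isOpen_zdom _) Sig.contDiffOn_T 2).continuousOn.comp_continuous hm hz
  have hper : Sig.T ![r, θ, Real.pi] = Sig.T ![r, θ, -Real.pi] := by
    rw [← Sig.T_periodic ![r, θ, -Real.pi]]
    congr 1
    ext i; fin_cases i <;> simp
    ring
  have hle : -Real.pi ≤ Real.pi := by linarith [Real.pi_pos]
  -- T is periodic in the azimuth, so the shape of the surface drops out of the flux through a
  -- sphere.
  have hI : ∫ φ in -Real.pi..Real.pi, pd 2 Sig.T ![r, θ, φ] = 0 := by
    rw [intervalIntegral.integral_eq_sub_of_hasDerivAt (fun φ _ => hT φ)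
      (hTc.intervalIntegrable _ _), hper, sub_self]
  simp only [hg2]
  rw [integral_Icc_eq_integral_Ioc, ← intervalIntegral.integral_of_le hle,
    intervalIntegral.integral_const_mul, intervalIntegral.integral_sub (by simp)
    ((hTc.const_mul _).intervalIntegrable _ _), intervalIntegral.integral_const_mul, hI]
  simp
  ring

/-- The divergence of the cut off current. -/
def cutoffDivergence (ε : ℝ) (Φ F : M → ℝ) (χ : E3 → ℝ) (x : E3) : ℝ :=
  -ε * (χ x * Sig.source F x) + fderiv ℝ χ x (WithLp.toLp 2 (Sig.current Φ x))

variable {ε : ℝ} {Φ F : M → ℝ} {Φc Fc : ℝ → ℝ → ℝ}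
    (hΦ : ContMDiff (𝓡 4) 𝓘(ℝ, ℝ) ∞ Φ)
    (hΦc : ∀ x : Fin 4 → ℝ, S.rH < x 1 → x 2 ∈ Icc 0 Real.pi →
      Φ (S.Ψ (polar x)) = Φc (x 1) (x 2))
    (hFc : ∀ x : Fin 4 → ℝ, S.rH < x 1 → x 2 ∈ Icc 0 Real.pi →
      F (S.Ψ (polar x)) = Fc (x 1) (x 2))
    (hE : ∀ x ∈ polarExterior S.rH,
      dAlembertian (hartleThorne S.N S.A S.B S.w) (fun z => Φc (z 1) (z 2)) x
        + ε * Fc (x 1) (x 2) = 0)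
include hΦ hΦc hFc hE

/-- The product rule, with the gradient term returned to the parameters of the surface by
`current_K`. Thus the integrand makes sense up to the horizon, beyond the reach of these
coordinates. -/
lemma divergence_cutoff {χ : E3 → ℝ} (hχ : ContDiff ℝ ∞ χ) {z : Fin 3 → ℝ} (hz : z ∈ zdom S.rH)
    (h1 : z 1 ∈ Ioo 0 Real.pi) :
    ∑ i, fderiv ℝ (fun y => χ (Sig.K y) • Sig.currentPolar Φc y) z (Pi.single i 1) i
      = |(Sig.jac z).det| * Sig.cutoffDivergence ε Φ F χ (Sig.K z) := by
  have hΦs := S.smoothExterior_of_invariant hΦ hΦc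
  have hθ : z 1 ∈ Icc 0 Real.pi := ⟨h1.1.le, h1.2.le⟩
  have hr : 0 < z 0 := S.rH_nonneg.trans_lt hz
  have hV : HasFDerivAt (Sig.currentPolar Φc) (fderiv ℝ (Sig.currentPolar Φc) z) z :=
    (((Sig.contDiffOn_currentPolar hΦs).contDiffAt
      ((isOpen_zdom _).mem_nhds hz)).differentiableAt (by simp)).hasFDerivAt
  have hc : HasFDerivAt (fun y => χ (Sig.K y))
      ((fderiv ℝ χ (Sig.K z)).comp (fderiv ℝ Sig.K z)) z :=
    (hχ.differentiable (by simp) (Sig.K z)).hasFDerivAt.comp z (Sig.differentiableAt_K hz).hasFDerivAt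
  have hVi (i : Fin 3) : fderiv ℝ (Sig.currentPolar Φc) z (Pi.single i 1) i
      = pd i (fun y => Sig.currentPolar Φc y i) z := by
    rw [pd, (hasFDerivAt_pi'.1 hV i).fderiv]; rfl
  have hprod : fderiv ℝ (fun y => χ (Sig.K y) • Sig.currentPolar Φc y) z = _ := (hc.smul hV).fderiv
  have hcur := Sig.current_K hΦ hΦc hz h1
  have hdir : fderiv ℝ Sig.K z (Sig.currentPolar Φc z)
      = |(Sig.jac z).det| • (WithLp.toLp 2 (Sig.current Φ (Sig.K z)) : E3) := by
    rw [← WithLp.toLp_smul, hcur, jac_mulVec, WithLp.toLp_ofLp]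
  have hVsum : Sig.currentPolar Φc z = ∑ i, Sig.currentPolar Φc z i • Pi.single i (1 : ℝ) := by
    ext j; simp [Finset.sum_apply, Pi.single_apply]
  have hgrad : ∑ i, fderiv ℝ χ (Sig.K z) (fderiv ℝ Sig.K z (Pi.single i 1))
      * Sig.currentPolar Φc z i = |(Sig.jac z).det|
        * fderiv ℝ χ (Sig.K z) (WithLp.toLp 2 (Sig.current Φ (Sig.K z))) := by
    rw [← smul_eq_mul, ← map_smul, ← hdir]
    conv_rhs => rw [hVsum]
    simp only [map_sum, map_smul, smul_eq_mul, mul_comm]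
  have hsrc := Sig.source_K hFc hz h1
  rw [hprod]
  simp only [FunLike.coe_add, FunLike.coe_smul, Pi.add_apply, Pi.smul_apply,
    ContinuousLinearMap.smulRight_apply, ContinuousLinearMap.comp_apply, smul_eq_mul, hVi,
    Finset.sum_add_distrib, ← Finset.mul_sum]
  rw [sourcePolar, hat_eq Fc hr hθ] at hsrc
  rw [hgrad, Sig.divergence_currentPolar hΦs hz, field_equation S hΦs hE hz h1, cutoffDivergence]
  linear_combination (ε * χ (Sig.K z)) * hsrc

/-- The divergence theorem on the part of the surface between two spheres. -/
lemma setIntegral_cutoffDivergence {χ : E3 → ℝ} (hχ : ContDiff ℝ ∞ χ) {r₁ r₂ : ℝ} (h1 : S.rH < r₁)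
    (h12 : r₁ ≤ r₂) (hχ₁ : ∀ x ∈ outside 1, ‖Sig.proj x‖ = r₁ → χ x = 0)
    (hχ₂ : ∀ x ∈ outside 1, ‖Sig.proj x‖ = r₂ → χ x = 1) :
    ∫ x in Sig.K '' sphericalBox (Ioo r₁ r₂), Sig.cutoffDivergence ε Φ F χ x
      = 2 * Real.pi * ∫ θ in Ioo 0 Real.pi, radialFlux S Φc ![r₂, θ, 0] := by
  have hΦs := S.smoothExterior_of_invariant hΦ hΦc
  have hI : Ioo r₁ r₂ ⊆ Ioi S.rH := fun r hr => h1.trans hr.1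
  set a : Fin 3 → ℝ := ![r₁, 0, -Real.pi] with ha
  set b : Fin 3 → ℝ := ![r₂, Real.pi, Real.pi] with hb
  have hab : a ≤ b := by
    intro i; fin_cases i
    · exact h12
    · exact Real.pi_pos.le
    · exact (neg_lt_self Real.pi_pos).le
  have hbox : sphericalBox (Ioo r₁ r₂) = univ.pi fun i => Ioo (a i) (b i) := by
    ext z
    rw [mem_sphericalBox, mem_univ_pi, Fin.forall_fin_succ, Fin.forall_fin_two]
    rfl
  have hsub : Icc a b ⊆ zdom S.rH := fun z hz => h1.trans_le (hz.1 0)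
  set f : (Fin 3 → ℝ) → Fin 3 → ℝ := fun y => χ (Sig.K y) • Sig.currentPolar Φc y with hf
  have hfs : ContDiffOn ℝ ∞ f (zdom S.rH) :=
    (hχ.comp_contDiffOn Sig.contDiffOn_K).smul (Sig.contDiffOn_currentPolar hΦs)
  have hint : IntegrableOn (fun z => ∑ i, fderiv ℝ f z (Pi.single i 1) i) (Icc a b) := by
    refine ContinuousOn.integrableOn_compact isCompact_Icc ?_
    refine continuousOn_finsetSum _ fun i _ => ?_
    have h := ((hfs.fderiv_of_isOpen (m := ∞) (isOpen_zdom _) (by simp)).continuousOn.mono hsub)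
    exact (continuous_apply i).comp_continuousOn (h.clm_apply continuousOn_const)
  have hdiv := integral_divergence_of_hasFDerivAt_off_countable a b hab f (fderiv ℝ f) ∅
    countable_empty (hfs.continuousOn.mono hsub) (fun z hz => by
      have hz' : z ∈ sphericalBox (Ioo r₁ r₂) := hbox ▸ hz.1
      exact ((hfs.contDiffAt ((isOpen_zdom _).mem_nhds
        (mem_zdom_of_mem_sphericalBox hI hz'))).differentiableAt (by simp)).hasFDerivAt) hint
  rw [Sig.setIntegral_image_K measurableSet_Ioo hI]
  have hL : ∫ z in sphericalBox (Ioo r₁ r₂), |(Sig.jac z).det|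
      * Sig.cutoffDivergence ε Φ F χ (Sig.K z) = ∫ z in Icc a b, ∑ i, fderiv ℝ f z (Pi.single i 1) i := by
    have hae : Icc a b =ᵐ[volume] sphericalBox (Ioo r₁ r₂) := by
      rw [hbox]; exact Measure.univ_pi_Ioo_ae_eq_Icc.symm
    rw [setIntegral_congr_set hae]
    refine setIntegral_congr_fun (measurableSet_sphericalBox measurableSet_Ioo) fun z hz => ?_
    exact (Sig.divergence_cutoff hΦ hΦc hFc hE hχ (mem_zdom_of_mem_sphericalBox hI hz)
      (mem_sphericalBox.1 hz).2.1).symm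
  have hnorm {z : Fin 3 → ℝ} (hz : z ∈ zdom S.rH) : ‖Sig.proj (Sig.K z)‖ = z 0 := by
    rw [Sig.proj_K hz, sphz, norm_sph (S.rH_nonneg.trans (le_of_lt hz))]
  have hins0 (r : ℝ) (x : Fin 2 → ℝ) :
      (Fin.insertNth (0 : Fin 3) r x : Fin 3 → ℝ) = ![r, x 0, x 1] := by
    ext i; fin_cases i <;> rfl
  -- Of the six faces only the outer radial one contributes: the cutoff vanishes on the inner one,
  -- sin θ removes the polar flux on θ = 0 and θ = π, and the azimuthal faces cancel by periodicity.
  have f0 (x : Fin 2 → ℝ) : f (Fin.insertNth (0 : Fin 3) (a 0) x) 0 = 0 := by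
    have hz : (![r₁, x 0, x 1] : Fin 3 → ℝ) ∈ zdom S.rH := h1
    rw [hins0]
    change (χ (Sig.K ![r₁, x 0, x 1]) • Sig.currentPolar Φc ![r₁, x 0, x 1]) 0 = 0
    rw [hχ₁ _ (Sig.K_mem hz) (hnorm hz), zero_smul, Pi.zero_apply]
  have f0' (x : Fin 2 → ℝ) : f (Fin.insertNth (0 : Fin 3) (b 0) x) 0
      = Sig.currentPolar Φc ![r₂, x 0, x 1] 0 := by
    have hz : (![r₂, x 0, x 1] : Fin 3 → ℝ) ∈ zdom S.rH := h1.trans_le h12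
    rw [hins0]
    change (χ (Sig.K ![r₂, x 0, x 1]) • Sig.currentPolar Φc ![r₂, x 0, x 1]) 0 = _
    rw [hχ₂ _ (Sig.K_mem hz) (hnorm hz), one_smul]
  have f1 (s : ℝ) (hs : Real.sin s = 0) (x : Fin 2 → ℝ) :
      f (Fin.insertNth (1 : Fin 3) s x) 1 = 0 := by
    have : (Fin.insertNth (1 : Fin 3) s x : Fin 3 → ℝ) 1 = s := Fin.insertNth_apply_same _ _ _
    have hp : polarFlux S Φc (Fin.insertNth (1 : Fin 3) s x) = 0 := by rw [polarFlux, this, hs]; ring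
    change χ _ * (polarFlux S Φc (Fin.insertNth (1 : Fin 3) s x) * _) = 0
    rw [hp, zero_mul, mul_zero]
  have f2 (x : Fin 2 → ℝ) : f (Fin.insertNth (2 : Fin 3) (b 2) x)
      = f (Fin.insertNth (2 : Fin 3) (a 2) x) := by
    have hins (s : ℝ) : (Fin.insertNth (2 : Fin 3) s x : Fin 3 → ℝ) = ![x 0, x 1, s] := by
      ext i; fin_cases i <;> rfl
    have e : (![x 0, x 1, b 2] : Fin 3 → ℝ)
        = ![x 0, x 1, a 2] + (2 * Real.pi) • Pi.single 2 1 := by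
      ext i; fin_cases i <;> simp [ha, hb]
      ring
    rw [hins, hins, e]
    change χ (Sig.K (![x 0, x 1, a 2] + _)) • Sig.currentPolar Φc (![x 0, x 1, a 2] + _) = _
    rw [K_periodic, currentPolar_periodic]
  rw [hL, hdiv, Fin.sum_univ_three]
  simp only [f0, f0', f2, sub_self, add_zero, integral_zero, sub_zero]
  rw [show b 1 = Real.pi from rfl, show a 1 = 0 from rfl]
  simp only [f1 _ Real.sin_pi, f1 _ Real.sin_zero, integral_zero, sub_zero, add_zero]
  rw [← Sig.integral_sphere hΦs (h1.trans_le h12)]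
  congr 2

end PartialCauchySurface

end Divergence

/-! ### Radial cutoffs in the parameters of the surface. -/

section Cutoff

/-- A smooth function that vanishes for `‖x‖² ≤ 1 + δ` and equals one for `‖x‖² ≥ 1 + 2δ`. -/
def cutoff (δ : ℝ) (x : E3) : ℝ := Real.smoothTransition ((‖x‖ ^ 2 - 1) / δ - 1)

variable {δ : ℝ}

lemma contDiff_cutoff (δ : ℝ) : ContDiff ℝ ∞ (cutoff δ) :=
  Real.smoothTransition.contDiff.comp
    ((((contDiff_norm_sq ℝ).sub contDiff_const).div_const δ).sub contDiff_const)

lemma abs_cutoff_le_one (δ : ℝ) (x : E3) : |cutoff δ x| ≤ 1 :=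
  abs_le.2 ⟨neg_one_lt_zero.le.trans (Real.smoothTransition.nonneg _),
    Real.smoothTransition.le_one _⟩

lemma cutoff_eq_zero (hδ : 0 < δ) {x : E3} (hx : ‖x‖ ^ 2 ≤ 1 + δ) : cutoff δ x = 0 :=
  Real.smoothTransition.zero_of_nonpos (by
    rw [sub_nonpos, div_le_one hδ]; linarith)

lemma cutoff_eq_one (hδ : 0 < δ) {x : E3} (hx : 1 + 2 * δ ≤ ‖x‖ ^ 2) : cutoff δ x = 1 :=
  Real.smoothTransition.one_of_one_le (by
    have : 2 ≤ (‖x‖ ^ 2 - 1) / δ := by rw [le_div_iff₀ hδ]; linarith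
    linarith)

lemma fderiv_cutoff (δ : ℝ) (x v : E3) : fderiv ℝ (cutoff δ) x v
    = deriv Real.smoothTransition ((‖x‖ ^ 2 - 1) / δ - 1) * (2 * inner ℝ x v / δ) := by
  have h1 : HasFDerivAt (fun y : E3 => (‖y‖ ^ 2 - 1) / δ - 1) (δ⁻¹ • (2 • innerSL ℝ x)) x := by
    have h := ((hasStrictFDerivAt_norm_sq x).hasFDerivAt.sub_const 1).const_mul δ⁻¹
    refine (h.sub_const 1).congr_of_eventuallyEq (Eventually.of_forall fun y => ?_)
    simp [div_eq_inv_mul]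
  have h2 : HasDerivAt Real.smoothTransition _ ((‖x‖ ^ 2 - 1) / δ - 1) :=
    ((Real.smoothTransition.contDiff (n := 1)).differentiable (by simp) _).hasDerivAt
  have h3 : HasFDerivAt (cutoff δ) _ x := h2.comp_hasFDerivAt x h1
  rw [h3.fderiv]
  change _ * (δ⁻¹ * ((2 : ℕ) • inner ℝ x v)) = _
  rw [nsmul_eq_mul, Nat.cast_ofNat]
  ring

/-- The function attains its global minimum 0 or maximum 1 at such points. Extremality covers the
endpoints as well, where the function is not locally constant. -/
lemma deriv_smoothTransition_eq_zero {t : ℝ} (ht : t ≤ 0 ∨ 1 ≤ t) :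
    deriv Real.smoothTransition t = 0 := by
  rcases ht with ht | ht
  · refine IsLocalMin.deriv_eq_zero (Eventually.of_forall fun s => ?_)
    rw [Real.smoothTransition.zero_of_nonpos ht]
    exact Real.smoothTransition.nonneg s
  · refine IsLocalMax.deriv_eq_zero (Eventually.of_forall fun s => ?_)
    rw [Real.smoothTransition.one_of_one_le ht]
    exact Real.smoothTransition.le_one s

lemma exists_abs_deriv_smoothTransition_le :
    ∃ C, 0 ≤ C ∧ ∀ t, |deriv Real.smoothTransition t| ≤ C := by
  have hc : Continuous (deriv Real.smoothTransition) :=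
    (Real.smoothTransition.contDiff (n := 1)).continuous_deriv (by simp)
  obtain ⟨C, hC⟩ := (isCompact_Icc (a := (0 : ℝ)) (b := 1)).exists_bound_of_continuousOn
    hc.continuousOn
  have hC0 : 0 ≤ C := (norm_nonneg _).trans (hC 0 (by simp))
  refine ⟨C, hC0, fun t => ?_⟩
  by_cases ht : t ∈ Icc (0 : ℝ) 1
  · exact hC t ht
  · rw [deriv_smoothTransition_eq_zero, abs_zero]
    · exact hC0
    · by_contra! h; exact ht ⟨h.1.le, h.2.le⟩

lemma fderiv_cutoff_eq_zero (hδ : 0 < δ) {x : E3} (hx : ‖x‖ ^ 2 ≤ 1 + δ ∨ 1 + 2 * δ ≤ ‖x‖ ^ 2)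
    (v : E3) : fderiv ℝ (cutoff δ) x v = 0 := by
  rw [fderiv_cutoff, deriv_smoothTransition_eq_zero, zero_mul]
  rcases hx with hx | hx
  · left
    rw [sub_nonpos, div_le_one hδ]; linarith
  · right
    have : 2 ≤ (‖x‖ ^ 2 - 1) / δ := by rw [le_div_iff₀ hδ]; linarith
    linarith

/-- A thin shell around the unit sphere. -/
def thinShell (δ : ℝ) : Set E3 := {x | x ∈ outside 1 ∧ ‖x‖ ^ 2 ≤ 1 + 2 * δ}

lemma measurableSet_thinShell (δ : ℝ) : MeasurableSet (thinShell δ) :=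
  (isOpen_outside 1).measurableSet.inter
    (isClosed_le (continuous_norm.pow 2) continuous_const).measurableSet

/-- The shell is disjoint from the unit ball and lies with it in the ball of radius √(1 + 2δ). The
volume being linear in δ compensates the 1/δ in the gradient of the cutoff. -/
lemma measureReal_thinShell_le (hδ : 0 < δ) (h1 : δ ≤ 1) :
    (volume : Measure E3).real (thinShell δ) ≤ 8 * δ * (volume : Measure E3).real (Metric.ball 0 1)
    ∧ volume (thinShell δ) < ⊤ := by
  set s := √(1 + 2 * δ) with hs
  have hs2 : s ^ 2 = 1 + 2 * δ := Real.sq_sqrt (by linarith)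
  have hs1 : 1 ≤ s := by
    rw [hs, Real.one_le_sqrt]; linarith
  have hsub : thinShell δ ⊆ Metric.closedBall 0 s := by
    intro x hx
    rw [mem_closedBall_zero_iff]
    exact Real.le_sqrt_of_sq_le hx.2
  have hun : Metric.closedBall (0 : E3) 1 ∪ thinShell δ ⊆ Metric.closedBall 0 s :=
    union_subset (Metric.closedBall_subset_closedBall hs1) hsub
  have hfin : volume (Metric.closedBall (0 : E3) s) < ⊤ := measure_closedBall_lt_top
  have hdisj : Disjoint (Metric.closedBall (0 : E3) 1) (thinShell δ) := by
    rw [Set.disjoint_left]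
    intro x hx hx'
    rw [mem_closedBall_zero_iff] at hx
    exact absurd hx'.1 (not_lt.2 hx)
  have hadd := measureReal_union (μ := (volume : Measure E3)) hdisj (measurableSet_thinShell δ)
    measure_closedBall_lt_top.ne ((measure_mono hsub).trans_lt hfin).ne
  have hle := measureReal_mono (μ := (volume : Measure E3)) hun hfin.ne
  rw [hadd, Measure.addHaar_real_closedBall _ _ (zero_le_one.trans hs1),
    Measure.addHaar_real_closedBall _ _ (zero_le_one' ℝ)] at hle
  simp only [finrank_euclideanSpace, Fintype.card_fin, one_pow, one_mul] at hle
  refine ⟨?_, (measure_mono hsub).trans_lt hfin⟩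
  have hV : 0 ≤ (volume : Measure E3).real (Metric.ball 0 1) := measureReal_nonneg
  -- Passing from s³ to s⁴ avoids the square root; (1 + 2δ)² ≤ 1 + 8δ uses δ ≤ 1.
  have h3 : s ^ 3 ≤ 1 + 8 * δ := by
    calc s ^ 3 ≤ s ^ 4 := pow_le_pow_right₀ hs1 (by norm_num)
      _ = (1 + 2 * δ) ^ 2 := by rw [← hs2]; ring
      _ ≤ 1 + 8 * δ := by nlinarith
  nlinarith

end Cutoff

/-! ### The limit of vanishing cutoff width. -/

section Limit

variable {M : Type*} [TopologicalSpace M] [ChartedSpace E4 M] [IsManifold (𝓡 4) ∞ M]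

namespace PartialCauchySurface

variable {S : CircularBlackHole M} (Sig : PartialCauchySurface S)

/-- Away from the boundary, the surface keeps away from the horizon radius. -/
lemma exists_lt_norm_proj {δ : ℝ} (hδ : 0 < δ) :
    ∃ r > S.rH, ∀ x ∈ outside 1, ‖Sig.proj x‖ ≤ r → ‖x‖ ^ 2 ≤ 1 + δ := by
  obtain ⟨L, hL⟩ := Sig.proj_infinity (S.rH + 1)
  set A : Set E3 := {x | 1 + δ ≤ ‖x‖ ^ 2} ∩ Metric.closedBall 0 L with hA
  have hAc : IsCompact A :=
    (isCompact_closedBall 0 L).inter_left (isClosed_le continuous_const (continuous_norm.pow 2))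
  have hAsub : A ⊆ outside 1 := by
    intro x hx
    have h1 : 1 + δ ≤ ‖x‖ ^ 2 := hx.1
    change 1 < ‖x‖
    by_contra! h
    nlinarith [norm_nonneg x]
  have key : ∃ r > S.rH, ∀ x ∈ A, r < ‖Sig.proj x‖ := by
    rcases A.eq_empty_or_nonempty with h | h
    · exact ⟨S.rH + 1, by linarith, by simp [h]⟩
    · obtain ⟨x₀, hx₀, hmin⟩ := hAc.exists_isMinOn h
        (Sig.contDiffOn_proj.continuousOn.mono hAsub).norm
      have h0 : S.rH < ‖Sig.proj x₀‖ := Sig.proj_mem (hAsub hx₀)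
      refine ⟨(S.rH + ‖Sig.proj x₀‖) / 2, by linarith, fun x hx => ?_⟩
      have : ‖Sig.proj x₀‖ ≤ ‖Sig.proj x‖ := hmin hx
      linarith
  obtain ⟨r, hr, hrA⟩ := key
  refine ⟨min r (S.rH + 1), lt_min hr (by linarith), fun x hx hxr => ?_⟩
  by_contra! h
  by_cases hxL : ‖x‖ ≤ L
  · have := hrA x ⟨h.le, by simpa using hxL⟩
    linarith [min_le_left r (S.rH + 1)]
  · have := hL x hx (not_le.1 hxL)
    linarith [min_le_right r (S.rH + 1)]

/-- Near the boundary, the radius is bounded. -/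
lemma exists_norm_proj_lt (δ : ℝ) : ∃ R, ∀ x ∈ thinShell δ, ‖Sig.proj x‖ < R := by
  set A : Set E3 := outerRegion ∩ Metric.closedBall 0 √(1 + 2 * δ) with hA
  have hAc : IsCompact A :=
    (isCompact_closedBall 0 _).inter_left (isClosed_le continuous_const continuous_norm)
  -- The projection carries no information on the boundary sphere itself, so local bounds at its
  -- points are patched together by compactness.
  have key : ∃ R, ∀ x ∈ A, x ∈ outside 1 → ‖Sig.proj x‖ < R := by
    refine hAc.induction_on (p := fun s => ∃ R, ∀ x ∈ s, x ∈ outside 1 → ‖Sig.proj x‖ < R)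
      ⟨0, by simp⟩ ?_ ?_ ?_
    · rintro s t hst ⟨R, hR⟩
      exact ⟨R, fun x hx => hR x (hst hx)⟩
    · rintro s t ⟨R, hR⟩ ⟨R', hR'⟩
      refine ⟨max R R', fun x hx hxo => ?_⟩
      rcases hx with hx | hx
      · exact lt_max_of_lt_left (hR x hx hxo)
      · exact lt_max_of_lt_right (hR' x hx hxo)
    · intro x hx
      have hx1 : 1 ≤ ‖x‖ := hx.1
      rcases hx1.eq_or_lt with h | h
      · exact ⟨_, mem_nhdsWithin_of_mem_nhds (Sig.proj_boundary h.symm (lt_add_one S.rH)),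
          S.rH + 1, fun y hy => hy⟩
      · have hc : ContinuousAt (fun y => ‖Sig.proj y‖) x :=
          (Sig.contDiffOn_proj.continuousOn.continuousAt ((isOpen_outside 1).mem_nhds h)).norm
        exact ⟨_, mem_nhdsWithin_of_mem_nhds (hc.eventually (gt_mem_nhds (lt_add_one _))),
          ‖Sig.proj x‖ + 1, fun y hy _ => hy⟩
  obtain ⟨R, hR⟩ := key
  refine ⟨R, fun x hx => hR x ⟨outside_subset hx.1, ?_⟩ hx.1⟩
  rw [mem_closedBall_zero_iff]
  exact Real.le_sqrt_of_sq_le hx.2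

lemma inner_current (Φ : M → ℝ) (x : E3) : inner ℝ x (WithLp.toLp 2 (Sig.current Φ x) : E3)
    = (x : Fin 3 → ℝ) ⬝ᵥ Sig.current Φ x := by
  simp [PiLp.inner_apply, dotProduct, mul_comm]

section Flux

variable {Φ : M → ℝ} (hΦ : ContMDiff (𝓡 4) 𝓘(ℝ, ℝ) ∞ Φ)
include hΦ

lemma continuousOn_toLp_current :
    ContinuousOn (fun x => (WithLp.toLp 2 (Sig.current Φ x) : E3)) outerRegion :=
  (PiLp.continuous_toLp 2 _).comp_continuousOn (Sig.continuousOn_current hΦ)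

lemma integrableOn_fderiv_cutoff {δ : ℝ} (hδ : 0 < δ) :
    IntegrableOn (fun x => fderiv ℝ (cutoff δ) x (WithLp.toLp 2 (Sig.current Φ x))) (outside 1) := by
  set A : Set E3 := outerRegion ∩ Metric.closedBall 0 √(1 + 2 * δ) with hA
  have hAc : IsCompact A :=
    (isCompact_closedBall 0 _).inter_left (isClosed_le continuous_const continuous_norm)
  have hc : ContinuousOn (fun x => fderiv ℝ (cutoff δ) x (WithLp.toLp 2 (Sig.current Φ x)))
      outerRegion :=
    ((contDiff_cutoff δ).continuous_fderiv (by simp)).continuousOn.clm_apply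
      (Sig.continuousOn_toLp_current hΦ)
  have hi := (hc.mono (inter_subset_left : A ⊆ _)).integrableOn_compact (μ := volume) hAc
  refine hi.of_forall_sdiff_eq_zero (isOpen_outside 1).measurableSet fun x hx => ?_
  refine fderiv_cutoff_eq_zero hδ (Or.inr ?_) _
  by_contra! h
  refine hx.2 ⟨outside_subset hx.1, ?_⟩
  rw [mem_closedBall_zero_iff]
  exact Real.le_sqrt_of_sq_le h.le

variable {Φc : ℝ → ℝ → ℝ} (hΦc : ∀ x : Fin 4 → ℝ, S.rH < x 1 → x 2 ∈ Icc 0 Real.pi →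
      Φ (S.Ψ (polar x)) = Φc (x 1) (x 2))
include hΦc

/-- The current is almost tangential near the horizon. -/
lemma exists_abs_current_le {η : ℝ} (hη : 0 < η) : ∃ δ₀ > 0, ∀ x ∈ outerRegion,
    ‖x‖ ≤ 1 + δ₀ → |(x : Fin 3 → ℝ) ⬝ᵥ Sig.current Φ x| ≤ η := by
  set h : E3 → ℝ := fun x => inner ℝ x (WithLp.toLp 2 (Sig.current Φ x) : E3) with hh
  have hcont : ContinuousOn h outerRegion := continuousOn_id.inner (Sig.continuousOn_toLp_current hΦ)
  have hAc : IsCompact (outerRegion ∩ Metric.closedBall (0 : E3) 2) :=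
    (isCompact_closedBall 0 _).inter_left (isClosed_le continuous_const continuous_norm)
  -- Uniform continuity on a compact shell compares x with its radial projection to the unit sphere,
  -- where the pairing is zero.
  have hu := Metric.uniformContinuousOn_iff.1
    (hAc.uniformContinuousOn_of_continuous (hcont.mono inter_subset_left)) η hη
  obtain ⟨d, hd, hu⟩ := hu
  refine ⟨min (d / 2) 1, by positivity, fun x hx hxd => ?_⟩
  have hx1 : 1 ≤ ‖x‖ := hx
  have hxp : 0 < ‖x‖ := one_pos.trans_le hx1
  set y : E3 := ‖x‖⁻¹ • x with hy
  have hyn : ‖y‖ = 1 := by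
    rw [hy, norm_smul, norm_inv, norm_norm, inv_mul_cancel₀ hxp.ne']
  have hdist : dist x y < d := by
    have e : x - y = (1 - ‖x‖⁻¹) • x := by rw [hy, sub_smul, one_smul]
    rw [dist_eq_norm, e, norm_smul, Real.norm_eq_abs, abs_of_nonneg, sub_mul, one_mul,
      inv_mul_cancel₀ hxp.ne']
    · linarith [min_le_left (d / 2) 1]
    · rw [sub_nonneg]; exact inv_le_one_of_one_le₀ hx1
  have hk := hu x ⟨hx, by rw [mem_closedBall_zero_iff]; linarith [min_le_right (d / 2) 1]⟩ y
    ⟨hyn.ge, by rw [mem_closedBall_zero_iff, hyn]; norm_num⟩ hdist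
  have hy0 : h y = 0 := by
    rw [hh]
    exact (Sig.inner_current Φ y).trans (Sig.current_boundary hΦ hΦc hyn)
  rw [hy0, Real.dist_eq, sub_zero] at hk
  rw [← Sig.inner_current]
  exact hk.le

/-- The flux of the current through the horizon vanishes. -/
lemma tendsto_integral_fderiv_cutoff :
    Tendsto (fun δ => ∫ x in outside 1, fderiv ℝ (cutoff δ) x (WithLp.toLp 2 (Sig.current Φ x)))
      (𝓝[>] 0) (𝓝 0) := by
  obtain ⟨C, hC0, hC⟩ := exists_abs_deriv_smoothTransition_le
  set V := (volume : Measure E3).real (Metric.ball 0 1) with hV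
  have hV0 : 0 ≤ V := measureReal_nonneg
  rw [Metric.tendsto_nhds]
  intro κ hκ
  -- The gradient of the cutoff pairs with the current to at most C · 2η/δ, on a shell of volume at
  -- most 8δV. The product 16 C V η is below κ, and the added 1 covers a vanishing constant.
  set η := κ / (16 * C * V + 1) with hηdef
  have hη : 0 < η := by positivity
  obtain ⟨δ₀, hδ₀, hb⟩ := Sig.exists_abs_current_le hΦ hΦc hη
  have hmem : Ioo 0 (min 1 δ₀) ∈ 𝓝[>] (0 : ℝ) := Ioo_mem_nhdsGT (by positivity)
  filter_upwards [hmem] with δ hδ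
  have hδ1 : δ ≤ 1 := hδ.2.le.trans (min_le_left _ _)
  have hδ2 : δ ≤ δ₀ := hδ.2.le.trans (min_le_right _ _)
  obtain ⟨hvol, hfin⟩ := measureReal_thinShell_le hδ.1 hδ1
  have hrestrict : ∫ x in outside 1, fderiv ℝ (cutoff δ) x (WithLp.toLp 2 (Sig.current Φ x))
      = ∫ x in thinShell δ, fderiv ℝ (cutoff δ) x (WithLp.toLp 2 (Sig.current Φ x)) := by
    refine setIntegral_eq_of_subset_of_forall_sdiff_eq_zero (isOpen_outside 1).measurableSet
      (fun x hx => hx.1) fun x hx => fderiv_cutoff_eq_zero hδ.1 (Or.inr ?_) _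
    by_contra! h
    exact hx.2 ⟨hx.1, h.le⟩
  have hbound := norm_setIntegral_le_of_norm_le_const (f := fun x =>
    fderiv ℝ (cutoff δ) x (WithLp.toLp 2 (Sig.current Φ x))) (C := C * (2 * η / δ)) hfin
    (fun x hx => by
      have hxn : ‖x‖ ≤ 1 + δ₀ := by
        have h1 : ‖x‖ ^ 2 ≤ 1 + 2 * δ := hx.2
        have h2 : ‖x‖ ^ 2 ≤ (1 + δ) ^ 2 := by nlinarith [sq_nonneg δ]
        have h3 := abs_le_of_sq_le_sq' h2 (by linarith [hδ.1])
        linarith [h3.2]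
      rw [fderiv_cutoff, Sig.inner_current, Real.norm_eq_abs, abs_mul, abs_div, abs_mul, abs_two,
        abs_of_pos hδ.1]
      have h4 := hb x (outside_subset hx.1) hxn
      have h5 := hC ((‖x‖ ^ 2 - 1) / δ - 1)
      have := hδ.1
      gcongr)
  rw [dist_zero_right, hrestrict]
  refine hbound.trans_lt ?_
  have hδp := hδ.1
  calc C * (2 * η / δ) * (volume : Measure E3).real (thinShell δ)
      ≤ C * (2 * η / δ) * (8 * δ * V) := by gcongr
    _ = 16 * C * V * η := by field_simp; ring
    _ < (16 * C * V + 1) * η := by linarith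
    _ = κ := by rw [hηdef]; field_simp

end Flux

section Source

variable {F : M → ℝ} (hF : Continuous F) (hint : IntegrableOn (Sig.source F) (outside 1))
include hint

lemma integrableOn_cutoff_source (δ : ℝ) :
    IntegrableOn (fun x => cutoff δ x * Sig.source F x) (outside 1) :=
  hint.bdd_mul (contDiff_cutoff δ).continuous.aestronglyMeasurable
    (Eventually.of_forall fun x => abs_cutoff_le_one δ x)

/-- The integrand is dominated by |source|, and at a fixed interior point the cutoff equals one as
soon as 2δ < ‖x‖² − 1. -/
lemma tendsto_integral_cutoff_source :
    Tendsto (fun δ => ∫ x in outside 1, cutoff δ x * Sig.source F x) (𝓝[>] 0)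
      (𝓝 (∫ x in outside 1, Sig.source F x)) := by
  refine tendsto_integral_filter_of_dominated_convergence (fun x => ‖Sig.source F x‖) ?_ ?_
    hint.norm ?_
  · exact Eventually.of_forall fun δ => (Sig.integrableOn_cutoff_source hint δ).aestronglyMeasurable
  · refine Eventually.of_forall fun δ => Eventually.of_forall fun x => ?_
    rw [norm_mul]
    exact mul_le_of_le_one_left (norm_nonneg _) (abs_cutoff_le_one δ x)
  · filter_upwards [ae_restrict_mem (isOpen_outside 1).measurableSet] with x hx
    have hx1 : 1 < ‖x‖ := hx
    have hp : 0 < (‖x‖ ^ 2 - 1) / 2 := by nlinarith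
    refine tendsto_const_nhds.congr' ?_
    filter_upwards [Ioo_mem_nhdsGT hp] with δ hδ
    rw [cutoff_eq_one hδ.1 (by linarith [hδ.2]), one_mul]

end Source

end PartialCauchySurface

end Limit

/-! ### Assembly of the flux identity and the conclusion. -/

section Main

variable {M : Type*} [TopologicalSpace M] [ChartedSpace E4 M] [IsManifold (𝓡 4) ∞ M]

namespace PartialCauchySurface

variable {S : CircularBlackHole M} (Sig : PartialCauchySurface S) {ε : ℝ} {Φ F : M → ℝ}
  {Φc Fc : ℝ → ℝ → ℝ}

/-- The divergence theorem for the cut off current on the whole surface. -/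
lemma integral_cutoffDivergence (hΦ : ContMDiff (𝓡 4) 𝓘(ℝ, ℝ) ∞ Φ)
    (hΦc : ∀ x : Fin 4 → ℝ, S.rH < x 1 → x 2 ∈ Icc 0 Real.pi →
      Φ (S.Ψ (polar x)) = Φc (x 1) (x 2))
    (hFc : ∀ x : Fin 4 → ℝ, S.rH < x 1 → x 2 ∈ Icc 0 Real.pi →
      F (S.Ψ (polar x)) = Fc (x 1) (x 2))
    (hE : ∀ x ∈ polarExterior S.rH,
      dAlembertian (hartleThorne S.N S.A S.B S.w) (fun z => Φc (z 1) (z 2)) x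
        + ε * Fc (x 1) (x 2) = 0)
    (hint : IntegrableOn (Sig.source F) (outside 1)) {m : ℝ}
    (hflux : Tendsto (fun r => ∫ θ in Ioo 0 Real.pi, radialFlux S Φc ![r, θ, 0]) atTop (𝓝 m))
    {δ : ℝ} (hδ : 0 < δ) :
    -ε * ∫ x in outside 1, cutoff δ x * Sig.source F x =
      2 * Real.pi * m
        - ∫ x in outside 1, fderiv ℝ (cutoff δ) x (WithLp.toLp 2 (Sig.current Φ x)) := by
  set G := Sig.cutoffDivergence ε Φ F (cutoff δ) with hG
  have i1 := Sig.integrableOn_cutoff_source hint δ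
  have i2 := Sig.integrableOn_fderiv_cutoff hΦ hδ
  have hGi : IntegrableOn G (outside 1) := (i1.const_mul (-ε)).add i2
  have hsplit : ∫ x in outside 1, G x = -ε * (∫ x in outside 1, cutoff δ x * Sig.source F x)
      + ∫ x in outside 1, fderiv ℝ (cutoff δ) x (WithLp.toLp 2 (Sig.current Φ x)) := by
    rw [← integral_const_mul]
    exact integral_add (i1.const_mul (-ε)) i2
  -- The cutoff and its gradient vanish at all points of radius at most `r₁`; from radius `R` on the
  -- cutoff is one. Hence the inner sphere contributes nothing and the outer one contributes the
  -- full flux.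
  obtain ⟨r₁, hr₁, hlow⟩ := Sig.exists_lt_norm_proj hδ
  obtain ⟨R, hR⟩ := Sig.exists_norm_proj_lt δ
  set A : ℝ → Set E3 := fun r => {x | x ∈ outside 1 ∧ ‖Sig.proj x‖ ∈ Ioo r₁ r} with hA
  have hAm (r : ℝ) : MeasurableSet (A r) :=
    (Sig.contDiffOn_proj.continuousOn.norm.isOpen_inter_preimage (isOpen_outside 1)
      isOpen_Ioo).measurableSet
  have hAmono : Monotone A := fun r r' h x hx => ⟨hx.1, hx.2.1, hx.2.2.trans_le h⟩
  have hAsub : (⋃ r, A r) ⊆ outside 1 := iUnion_subset fun r x hx => hx.1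
  -- The spherical regions increase to everything of radius above `r₁`, and the integrand vanishes
  -- on the remainder.
  have hlim := tendsto_setIntegral_of_monotone hAm hAmono (hGi.mono_set hAsub)
  have hAll : ∫ x in ⋃ r, A r, G x = ∫ x in outside 1, G x := by
    refine (setIntegral_eq_of_subset_of_forall_sdiff_eq_zero (isOpen_outside 1).measurableSet hAsub
      fun x hx => ?_).symm
    have hxn : ‖Sig.proj x‖ ≤ r₁ := by
      by_contra! h
      exact hx.2 (mem_iUnion.2 ⟨‖Sig.proj x‖ + 1, hx.1, h, lt_add_one _⟩)
    have h2 := hlow x hx.1 hxn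
    rw [hG, cutoffDivergence, cutoff_eq_zero hδ h2, fderiv_cutoff_eq_zero hδ (Or.inl h2)]
    simp
  have heq : ∀ᶠ r in atTop, 2 * Real.pi * (∫ θ in Ioo 0 Real.pi, radialFlux S Φc ![r, θ, 0])
      = ∫ x in A r, G x := by
    filter_upwards [eventually_ge_atTop r₁, eventually_ge_atTop R] with r h1 h2
    rw [← Sig.setIntegral_cutoffDivergence hΦ hΦc hFc hE (contDiff_cutoff δ) hr₁ h1
      (fun x hx hxr => cutoff_eq_zero hδ (hlow x hx hxr.le)) (fun x hx hxr => ?_)]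
    · exact setIntegral_congr_set (Sig.image_K_ae_eq fun s hs => hr₁.trans hs.1)
    · refine cutoff_eq_one hδ ?_
      by_contra! h
      linarith [hR x ⟨hx, h.le⟩]
  have := tendsto_nhds_unique hlim ((hflux.const_mul (2 * Real.pi)).congr' heq)
  rw [hAll, hsplit] at this
  linarith

end PartialCauchySurface

end Main

theorem mainTheorem5 {M : Type*} [TopologicalSpace M] [T2Space M] [SecondCountableTopology M]
    [ChartedSpace E4 M] [IsManifold (𝓡 4) ∞ M]
    (S : CircularBlackHole M) (Sig : PartialCauchySurface S) (ε : ℝ)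
    -- the scalar field and the curvature scalar, as functions on spacetime and of `(r, θ)`
    (Φ F : M → ℝ) (Φc Fc : ℝ → ℝ → ℝ)
    (hΦ : ContMDiff (𝓡 4) 𝓘(ℝ, ℝ) ∞ Φ) (hF : Continuous F)
    (hΦc : ∀ x : Fin 4 → ℝ, S.rH < x 1 → x 2 ∈ Icc 0 Real.pi →
      Φ (S.Ψ (polar x)) = Φc (x 1) (x 2))
    (hFc : ∀ x : Fin 4 → ℝ, S.rH < x 1 → x 2 ∈ Icc 0 Real.pi →
      F (S.Ψ (polar x)) = Fc (x 1) (x 2))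
    -- the scalar field equation `□Φ + ε F = 0`
    (hE : ∀ x ∈ polarExterior S.rH,
      dAlembertian (hartleThorne S.N S.A S.B S.w) (fun z => Φc (z 1) (z 2)) x
        + ε * Fc (x 1) (x 2) = 0)
    -- the curvature scalar falls off at least as `r⁻⁵`
    (hdecay : ∃ C R : ℝ, ∀ r > R, ∀ θ ∈ Icc 0 Real.pi, |Fc r θ| ≤ C / r ^ 5)
    -- the asymptotic expansion of the scalar field
    (μ₁ μ₂ : ℝ → ℝ) (hμ₁ : ContDiffOn ℝ 2 μ₁ (Icc 0 Real.pi))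
    (hμ₂ : ContDiffOn ℝ 2 μ₂ (Icc 0 Real.pi))
    (hexp : IsBigOInv 3 (fun r θ => Φc r θ - (μ₁ θ / r + μ₂ θ / r ^ 2))) :
    IntegrableOn (fun x => F (Sig.σ x) * Sig.surfaceDensity S.X x) {x : E3 | 1 < ‖x‖} ∧
    ∀ θ ∈ Icc 0 Real.pi,
      μ₁ θ = ε / (4 * Real.pi) *
        ∫ x in {x : E3 | 1 < ‖x‖}, F (Sig.σ x) * Sig.surfaceDensity S.X x := by
  have hint : IntegrableOn (Sig.source F) (outside 1) := Sig.integrableOn_source hF hFc hdecay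
  refine ⟨hint, fun θ hθ => ?_⟩
  have hΦs := S.smoothExterior_of_invariant hΦ hΦc
  have hconst := monopole_const S hΦs hμ₁ hμ₂ hexp hE hdecay
  have hflux := tendsto_integral_radialFlux S hΦs hμ₂ hexp hconst
  have hlhs := (Sig.tendsto_integral_cutoff_source hint).const_mul (-ε)
  have hrhs := (Sig.tendsto_integral_fderiv_cutoff hΦ hΦc).const_sub (2 * Real.pi * (-2 * μ₁ 0))
  -- The identity holds for each δ > 0. As δ → 0⁺ the horizon term disappears, leaving −ε ∫ source =
  -- −4π μ₁.
  have heq := tendsto_nhds_unique (hlhs.congr' (by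
    filter_upwards [self_mem_nhdsWithin] with δ hδ
    exact Sig.integral_cutoffDivergence hΦ hΦc hFc hE hint hflux hδ)) hrhs
  rw [hconst θ hθ]
  change μ₁ 0 = ε / (4 * Real.pi) * ∫ x in outside 1, Sig.source F x
  have hpi := Real.pi_pos
  field_simp
  linarith

end
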